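/- Let $k$ be an algebraically closed field of characteristic different from $2$ and $3$. Let $X\subseteq\mathbb P^4_k$ be a closed subscheme of dimension $0$ and degree $6$ (i.e. with constant Hilbert polynomial $6$) which is arithmetically Gorenstein (its homogeneous coordinate ring $k[x_0,\dots,x_4]/I_X$, with $I_X$ the saturated homogeneous ideal of $X$, is a Gorenstein ring) and non-degenerate (contained in no hyperplane). Then $X$ can be obtained by the Anglo-Hellenic construction, that is, there are: (1) a skew-symmetric $5\times5$ matrix $A=(a_{i,j})_{0\le i,j\le4}$ of linear forms in $k[x_0,\dots,x_4]$ with $a_{i,j}\in k[x_1,\dots,x_4]$ for $1\le i<j\le4$, such that the subscheme $\widetilde X\subseteq\mathbb P^4$ defined by the pfaffians $p_0,\dots,p_4$ ($p_i$ being the pfaffian of $A$ with the $i$-th row and column deleted) is a curve, i.e. has dimension $1$; (2) the Tom unprojection $\widetilde X_{unp}\subseteq\mathbb P^5$ of $\widetilde X$, defined in $k[x_0,\dots,x_4,s]$ by the ideal $$(p_0,\dots,p_4)+(x_1s-g_1,\;x_2s-g_2,\;x_3s-g_3,\;x_4s-g_4).$$ Here $Q$ is the $4\times4$ matrix with $(p_1,\dots,p_4)=(x_1,\dots,x_4)Q$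 obtained by writing $a_{i,j}=\sum_{m=1}^4c^m_{i,j}x_m$ for $1\le i<j\le4$ and collecting in $p_1,\dots,p_4$ the coefficients of $x_1,\dots,x_4$ (so the entries of $Q$ are $k$-linear combinations of $a_{0,1},\dots,a_{0,4}$), and $g_1,\dots,g_4$ are the quadratic forms such that the cofactors of the $l$-th column of $Q$ are $(-1)^{l-1}a_{0,l}\,g_1,\dots,(-1)^{l-1}a_{0,l}\,g_4$ for $l=1,\dots,4$ (so, if $a_{0,1}\ne0$, they are the cofactors of the first column of $Q$ divided by $a_{0,1}$); (3) a hyperplane $h\subseteq\mathbb P^5$ containing no irreducible component of $\widetilde X_{unp}$, and a linear isomorphism $\mathbb P^4\cong h$ which carries $X$ onto the scheme-theoretic intersection $\widetilde X_{unp}\cap h$. -/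

import Mathlib

open MvPolynomial

universe u

namespace TomUnprojection

/-! ### Gorenstein rings -/

/-- A local ring is Cohen-Macaulay when its depth equals its Krull dimension, i.e. when its maximal
ideal contains a regular sequence whose length is the Krull dimension. -/
def IsCohenMacaulayLocal (R : Type u) [CommRing R] [IsLocalRing R] : Prop :=
  ∃ rs : List R, (∀ r ∈ rs, r ∈ IsLocalRing.maximalIdeal R) ∧
    RingTheory.Sequence.IsRegular R rs ∧ ((rs.length : ℕ) : WithBot ℕ∞) = ringKrullDim R

/-- A Gorenstein local ring: a Noetherian Cohen-Macaulay local ring of finite injective dimension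
as a module over itself. -/
structure IsGorensteinLocal (R : Type u) [CommRing R] [IsLocalRing R] : Prop where
  noetherian : IsNoetherianRing R
  cohenMacaulay : IsCohenMacaulayLocal R
  finite_injectiveDimension :
    ∃ n : ℕ, CategoryTheory.HasInjectiveDimensionLE (ModuleCat.of R R) n

/-- A ring is Gorenstein when all its localizations at maximal ideals are. -/
def IsGorensteinRing (R : Type u) [CommRing R] : Prop :=
  ∀ (m : Ideal R) [m.IsMaximal], IsGorensteinLocal (Localization.AtPrime m)

/-! ### Closed subschemes of projective space through their homogeneous ideals -/

/-- The irrelevant ideal `(x_0, …, x_n)`. -/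
noncomputable def irrelevantIdeal (k : Type u) [Field k] (n : ℕ) :
    Ideal (MvPolynomial (Fin (n + 1)) k) :=
  Ideal.span (Set.range X)

/-- The saturation of `I` with respect to the irrelevant ideal. Two homogeneous ideals define the
same closed subscheme of projective space exactly when their saturations agree, and the saturation
of `I` is the homogeneous ideal of the closed subscheme defined by `I`. -/
def saturation {k : Type u} [Field k] {n : ℕ} (I : Ideal (MvPolynomial (Fin (n + 1)) k)) :
    Ideal (MvPolynomial (Fin (n + 1)) k) where
  carrier := {f | ∃ N : ℕ, ∀ g ∈ irrelevantIdeal k n ^ N, f * g ∈ I}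
  zero_mem' := ⟨0, fun g _ => by simp⟩
  add_mem' := by
    rintro a b ⟨N, hN⟩ ⟨M, hM⟩
    refine ⟨N + M, fun g hg => ?_⟩
    rw [add_mul]
    exact I.add_mem (hN g (Ideal.pow_le_pow_right (Nat.le_add_right N M) hg))
      (hM g (Ideal.pow_le_pow_right (Nat.le_add_left M N) hg))
  smul_mem' := by
    rintro c a ⟨N, hN⟩
    refine ⟨N, fun g hg => ?_⟩
    rw [smul_eq_mul, mul_assoc]
    exact I.mul_mem_left c (hN g hg)

/-- The Hilbert function of `k[x_0, …, x_n] / I`: the dimension of its part of degree `t`. -/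
noncomputable def hilbertFunction {k : Type u} [Field k] {n : ℕ}
    (I : Ideal (MvPolynomial (Fin (n + 1)) k)) (t : ℕ) : ℕ :=
  Module.finrank k
    ((homogeneousSubmodule (Fin (n + 1)) k t).map (Ideal.Quotient.mkₐ k I).toLinearMap)

/-- `I` is the homogeneous ideal of a closed subscheme of `ℙⁿ` which has Hilbert polynomial the
constant `d` (dimension `0` and degree `d`), which is arithmetically Gorenstein, and which spans
`ℙⁿ` (it lies in no hyperplane). -/
structure IsHilbAGZero {k : Type u} [Field k] (n d : ℕ)
    (I : Ideal (MvPolynomial (Fin (n + 1)) k)) : Prop where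
  homogeneous : ∀ f ∈ I, ∀ t : ℕ, homogeneousComponent t f ∈ I
  saturated : saturation I = I
  hilbertPolynomial : ∃ t₀ : ℕ, ∀ t ≥ t₀, hilbertFunction I t = d
  gorenstein : IsGorensteinRing (MvPolynomial (Fin (n + 1)) k ⧸ I)
  nondegenerate : ∀ f ∈ I, f.IsHomogeneous 1 → f = 0

/-! ### Pfaffians and the Tom unprojection -/

/-- The pfaffian of a `4 × 4` skew-symmetric matrix. -/
def pf4 {R : Type u} [CommRing R] (B : Matrix (Fin 4) (Fin 4) R) : R :=
  B 0 1 * B 2 3 - B 0 2 * B 1 3 + B 0 3 * B 1 2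

/-- The pfaffian `p_i` of the submatrix of a `5 × 5` skew-symmetric matrix obtained by deleting the
`i`-th row and column. -/
def subPf {R : Type u} [CommRing R] (A : Matrix (Fin 5) (Fin 5) R) (i : Fin 5) : R :=
  pf4 (A.submatrix i.succAbove i.succAbove)

/-- The ideal `(p_0, …, p_4)` of the pfaffians of order four. -/
def pfaffianIdeal {R : Type u} [CommRing R] (A : Matrix (Fin 5) (Fin 5) R) : Ideal R :=
  Ideal.span (Set.range (subPf A))

variable {k : Type u} [Field k]

/-- The matrices to which the construction applies: skew-symmetric `5 × 5` matrices of linear forms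
in `x_0, …, x_4`, with `a_{i,j} ∈ k[x_1, …, x_4]` for `i, j ≥ 1`, whose pfaffians of order four
define a curve in `ℙ⁴` (so the affine cone over it has dimension two). -/
structure IsTomMatrix (A : Matrix (Fin 5) (Fin 5) (MvPolynomial (Fin 5) k)) : Prop where
  diag : ∀ i, A i i = 0
  skew : ∀ i j, A j i = -A i j
  linear : ∀ i j, (A i j).IsHomogeneous 1
  tom : ∀ i j : Fin 4, A i.succ j.succ ∈ supported k {v : Fin 5 | v ≠ 0}
  curve : ringKrullDim (MvPolynomial (Fin 5) k ⧸ pfaffianIdeal A) = 2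

/-- The matrix `A` in which every `a_{i,j}` with `i, j ≥ 1` is replaced by the coefficient of `x_m`
in it (the row and the column of index `0` are kept). -/
noncomputable def coeffMatrix (A : Matrix (Fin 5) (Fin 5) (MvPolynomial (Fin 5) k)) (m : Fin 5) :
    Matrix (Fin 5) (Fin 5) (MvPolynomial (Fin 5) k) :=
  fun i j => if i = 0 ∨ j = 0 then A i j else C (coeff (Finsupp.single m 1) (A i j))

/-- The `4 × 4` matrix `Q` with `(p_1, …, p_4) = (x_1, …, x_4) Q`: each term of `p_j`, `j ≥ 1`, is
`± a_{0,a} a_{b,c}` with `b, c ≥ 1`, and `Q` collects the coefficients of `x_1, …, x_4` in the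
factors `a_{b,c}`, so that its entries are linear combinations of the `a_{0,a}`. The indices
`0, …, 3` of rows and columns stand for `1, …, 4`. -/
noncomputable def tomQ (A : Matrix (Fin 5) (Fin 5) (MvPolynomial (Fin 5) k)) :
    Matrix (Fin 4) (Fin 4) (MvPolynomial (Fin 5) k) :=
  fun m j => subPf (coeffMatrix A m.succ) j.succ

/-- `g_1, …, g_4` are the cofactors of the first column of `Q`, divided by `a_{0,1}`. As `a_{0,1}`
may vanish, the same is asked with the other columns: the cofactors of the `l`-th column are
`(-1)^(l-1) a_{0,l}` times `g_1, …, g_4` (with `l - 1` written `l` below). The `(l, i)` entry of the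
adjugate is the cofactor of the `(i, l)` entry of `Q`. -/
def IsTomNumerator (A : Matrix (Fin 5) (Fin 5) (MvPolynomial (Fin 5) k))
    (g : Fin 4 → MvPolynomial (Fin 5) k) : Prop :=
  ∀ l i : Fin 4, (tomQ A).adjugate l i = (-1) ^ (l : ℕ) * A 0 l.succ * g i

/-- The ideal `(p_0, …, p_4) + (x_1 s - g_1, …, x_4 s - g_4)` of `k[x_0, …, x_4, s]`, the variable
`s` being the one of index `5`. -/
noncomputable def unprojectionIdeal (A : Matrix (Fin 5) (Fin 5) (MvPolynomial (Fin 5) k))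
    (g : Fin 4 → MvPolynomial (Fin 5) k) : Ideal (MvPolynomial (Fin 6) k) :=
  (pfaffianIdeal A).map (rename (R := k) (Fin.castSucc : Fin 5 → Fin 6)) ⊔
    Ideal.span (Set.range fun i : Fin 4 =>
      X i.succ.castSucc * X (Fin.last 5) - rename (Fin.castSucc : Fin 5 → Fin 6) (g i))

/-- The linear form on `ℙ⁵` with coefficients `c`. -/
noncomputable def linearForm (c : Fin 6 → k) : MvPolynomial (Fin 6) k :=
  ∑ i, C (c i) * X i

/-- Restriction of polynomials along the linear map `k⁵ → k⁶` with matrix `T`. -/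
noncomputable def restrictAlong (T : Matrix (Fin 6) (Fin 5) k) :
    MvPolynomial (Fin 6) k →ₐ[k] MvPolynomial (Fin 5) k :=
  aeval fun i => ∑ j, C (T i j) * X j

/-- The closed subscheme of `ℙ⁴` with homogeneous ideal `I` can be obtained by the Anglo-Hellenic
construction: there are a matrix `A` as above, with its Tom unprojection in `ℙ⁵`, a hyperplane
`h = {c = 0}` of `ℙ⁵` containing no component of the unprojection, and a linear isomorphism
`T : ℙ⁴ ≅ h` carrying the subscheme onto the scheme-theoretic intersection of the unprojection
with `h`. -/
def IsAngloHellenic (I : Ideal (MvPolynomial (Fin 5) k)) : Prop :=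
  ∃ (A : Matrix (Fin 5) (Fin 5) (MvPolynomial (Fin 5) k)) (g : Fin 4 → MvPolynomial (Fin 5) k)
    (c : Fin 6 → k) (T : Matrix (Fin 6) (Fin 5) k),
    IsTomMatrix A ∧ IsTomNumerator A g ∧
    c ≠ 0 ∧ (∀ P ∈ (unprojectionIdeal A g).minimalPrimes, linearForm c ∉ P) ∧
    (∀ v : Fin 6 → k, (∃ w : Fin 5 → k, T.mulVec w = v) ↔ ∑ i, c i * v i = 0) ∧
    saturation ((unprojectionIdeal A g).map (restrictAlong T)) = I

end TomUnprojection

/-! A linear form `l` which is regular modulo `I` makes the scheme affine: it is the spectrum of B =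
k[x]/(I, l - 1), an algebra of dimension 6. The linear forms have a five-dimensional image in B,
which contains 1, the image of `l`. Let φ be a functional with this image as kernel. A Gorenstein
ring has simple socle after reduction modulo `l`, and this is what makes the pairing φ(bc)
nondegenerate (`exists_isFrobeniusModel`). So the scheme is Spec B embedded by a basis of ker φ. Two
nondegenerate functionals differ by a unit of B (`IsFrobeniusModel.exists_isUnit`), and multiplying
the coordinates by a unit does not change the quadrics through the points, so up to linear
isomorphism the scheme depends on B alone.

Nondegeneracy also forces `I` to be generated by quadrics (`IsFrobeniusModel.span_quadrics`), and
there are at most 15 - 6 = 9 independent ones (`IsFrobeniusModel.finrank_quadrics_le`). An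
unprojection has nine quadratic equations. Hence it suffices to find six elements β of B, in the
kernel of some nondegenerate functional and with a single linear relation `c`, which satisfy the
nine equations of an unprojection, provided that these equations stay linearly independent on the
hyperplane `c = 0` (`IsFrobeniusModel.isAngloHellenic_of_form`).

It remains to classify B and to exhibit one matrix for each type. If all cotangent spaces of Spec B
have dimension at most one, B is generated by one element t with t f(t) = 0 and f monic of degree 5.
The unprojection is then a rational normal quintic with a chord: the hyperplane cuts the quintic in
the roots of f and the chord in one more point.

Otherwise exactly one maximal ideal M has a larger cotangent space (`isCotangentCyclic_of_ne`), of
dimension 5 - dim M². Let ζ span the socle at M. Away from characteristic 2, the pairing on the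
annihilator of M² yields orthonormal vectors y_i with y_i y_j = δ_ij ζ (`exists_orthonormal`), and
splitting them off leaves an algebra with one generator (`exists_generator_of_orthonormal`). Four,
two or one such vectors occur when dim M² is at most 1, equal to 2, or equal to 3 with the
annihilator of M² not contained in M². In the last case, where M² is its own annihilator, two linear
forms have product zero or one of them has square zero; both alternatives fit the conic family, the
second one because 3 is invertible. -/

namespace TomUnprojection

/-! ### The socle of a hyperplane section of a local ring of finite injective dimension -/

section ExtVanishing

open CategoryTheory Abelian

variable {Λ : Type u} [CommRing Λ]

/-- `Ext^i(N, Λ) = 0`. -/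
def ExtVanishes (i : ℕ) (N : Type u) [AddCommGroup N] [Module Λ N] : Prop :=
  ∀ e : Ext (ModuleCat.of Λ N) (ModuleCat.of Λ Λ) i, e = 0

/-- The short complex of modules attached to two maps with zero composition. -/
abbrev shortComplexOf {N₁ N₂ N₃ : Type u} [AddCommGroup N₁] [Module Λ N₁] [AddCommGroup N₂]
    [Module Λ N₂] [AddCommGroup N₃] [Module Λ N₃] (f : N₁ →ₗ[Λ] N₂) (g : N₂ →ₗ[Λ] N₃)
    (h : g ∘ₗ f = 0) : ShortComplex (ModuleCat.{u} Λ) :=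
  ShortComplex.mk (ModuleCat.ofHom f) (ModuleCat.ofHom g)
    (by rw [← ModuleCat.ofHom_comp, h]; rfl)

theorem shortExact_shortComplexOf {N₁ N₂ N₃ : Type u} [AddCommGroup N₁] [Module Λ N₁]
    [AddCommGroup N₂] [Module Λ N₂] [AddCommGroup N₃] [Module Λ N₃] (f : N₁ →ₗ[Λ] N₂)
    (g : N₂ →ₗ[Λ] N₃) (hf : Function.Injective f) (hg : Function.Surjective g)
    (hfg : Function.Exact f g) :
    (shortComplexOf f g hfg.linearMap_comp_eq_zero).ShortExact where
  exact := (ShortComplex.ShortExact.moduleCat_exact_iff_function_exact _).2 hfg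
  mono_f := (ModuleCat.mono_iff_injective _).2 hf
  epi_g := (ModuleCat.epi_iff_surjective _).2 hg

theorem ExtVanishes.of_linearEquiv {i : ℕ} {N N' : Type u} [AddCommGroup N] [Module Λ N]
    [AddCommGroup N'] [Module Λ N'] (e : N ≃ₗ[Λ] N') (h : ExtVanishes (Λ := Λ) i N') :
    ExtVanishes (Λ := Λ) i N := by
  intro x
  have : x = (Ext.mk₀ (ModuleCat.ofHom e.toLinearMap)).comp
      ((Ext.mk₀ (ModuleCat.ofHom e.symm.toLinearMap)).comp x (zero_add i)) (zero_add i) := by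
    rw [← Ext.comp_assoc_of_second_deg_zero, Ext.mk₀_comp_mk₀, ← ModuleCat.ofHom_comp]
    simp
  rw [this, h ((Ext.mk₀ (ModuleCat.ofHom e.symm.toLinearMap)).comp x (zero_add i))]
  simp

theorem ExtVanishes.of_exact {i : ℕ} {N₁ N₂ N₃ : Type u} [AddCommGroup N₁] [Module Λ N₁]
    [AddCommGroup N₂] [Module Λ N₂] [AddCommGroup N₃] [Module Λ N₃] (f : N₁ →ₗ[Λ] N₂)
    (g : N₂ →ₗ[Λ] N₃) (hf : Function.Injective f) (hg : Function.Surjective g)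
    (hfg : Function.Exact f g) (h₁ : ExtVanishes (Λ := Λ) i N₁)
    (h₃ : ExtVanishes (Λ := Λ) i N₃) : ExtVanishes (Λ := Λ) i N₂ := by
  intro x
  obtain ⟨y, hy⟩ := Ext.contravariant_sequence_exact₂ (shortExact_shortComplexOf f g hf hg hfg)
    _ x (h₁ _)
  rw [← hy, h₃ y]
  simp

/-- Dévissage: N is built by extensions from modules Λ ⧸ p, and every such p contains a power of the
maximal ideal, hence equals it. -/
theorem ExtVanishes.of_residueField [IsNoetherianRing Λ] [IsLocalRing Λ] {i : ℕ}
    (h : ExtVanishes (Λ := Λ) i (Λ ⧸ IsLocalRing.maximalIdeal Λ)) (N : Type u) [AddCommGroup N]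
    [Module Λ N] [hN : Module.Finite Λ N]
    (hn : ∃ n, IsLocalRing.maximalIdeal Λ ^ n ≤ Module.annihilator Λ N) :
    ExtVanishes (Λ := Λ) i N := by
  revert hn
  induction hN using IsNoetherianRing.induction_on_isQuotientEquivQuotientPrime Λ with
  | subsingleton N =>
    intro _
    refine .of_linearEquiv (N' := PUnit) (LinearEquiv.ofSubsingleton _ _) fun x => ?_
    have : 𝟙 (ModuleCat.of Λ PUnit.{u+1}) = 0 := by ext
    rw [← Ext.mk₀_id_comp x, this]; simp
  | quotient N p a =>
    rintro ⟨n, hn⟩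
    have hp : p.asIdeal = IsLocalRing.maximalIdeal Λ := by
      apply le_antisymm (IsLocalRing.le_maximalIdeal p.isPrime.ne_top)
      refine Ideal.IsPrime.le_of_pow_le (n := n) (hn.trans ?_)
      rw [a.annihilator_eq, Ideal.annihilator_quotient]
    exact .of_linearEquiv (a.trans (Submodule.quotEquivOfEq _ _ hp)) h
  | exact N₁ N₂ N₃ f g hf hg hfg h₁ h₃ =>
    rintro ⟨n, hn⟩
    exact .of_exact f g hf hg hfg
      (h₁ ⟨n, hn.trans (LinearMap.annihilator_le_of_injective f hf)⟩)
      (h₃ ⟨n, hn.trans (LinearMap.annihilator_le_of_surjective g hg)⟩)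

section NonZeroDivisor

variable (l : Λ)

/-- Multiplication by `l`, as an endomorphism of `Λ`. -/
abbrev mulEnd : Λ →ₗ[Λ] Λ := LinearMap.lsmul Λ Λ l

/-- The short exact sequence `0 → Λ → Λ → Λ ⧸ (l) → 0`. -/
theorem exact_mulEnd_mkQ :
    Function.Exact (mulEnd l) (Submodule.mkQ (Ideal.span {l})) := by
  intro x
  rw [← LinearMap.mem_ker, Submodule.ker_mkQ, Ideal.mem_span_singleton']
  constructor
  · rintro ⟨a, rfl⟩
    exact ⟨a, by simp [mul_comm]⟩
  · rintro ⟨a, rfl⟩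
    exact ⟨a, by simp [mul_comm]⟩

variable {l}

theorem mulEnd_injective (hl : l ∈ nonZeroDivisors Λ) : Function.Injective (mulEnd l) := by
  rw [injective_iff_map_eq_zero]
  intro a ha
  exact (mem_nonZeroDivisors_iff.1 hl).1 a (by simpa using ha)

/-- Multiplication by l is a projective resolution of length one. -/
theorem extVanishes_quotient (hl : l ∈ nonZeroDivisors Λ) {i : ℕ} :
    ExtVanishes (Λ := Λ) (i + 2) (Λ ⧸ Ideal.span {l}) := by
  intro x
  have hS := shortExact_shortComplexOf _ _ (mulEnd_injective hl)
    (Submodule.mkQ_surjective (Ideal.span {l})) (exact_mulEnd_mkQ l)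
  have hP : Projective (ModuleCat.of Λ Λ) := inferInstance
  obtain ⟨y, hy⟩ := Ext.contravariant_sequence_exact₃ hS _ x
    (Ext.eq_zero_of_projective (P := ModuleCat.of Λ Λ) _) (n₀ := i + 1) (by omega)
  rw [← hy, Ext.eq_zero_of_projective (P := ModuleCat.of Λ Λ) y, Ext.comp_zero]

/-- A module killed by `l` has no nonzero map to a module on which `l` is regular. -/
theorem linearMap_eq_zero_of_smul (hl : l ∈ nonZeroDivisors Λ) {N : Type u} [AddCommGroup N]
    [Module Λ N] (hN : ∀ x : N, l • x = 0) (f : N →ₗ[Λ] Λ) : f = 0 := by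
  ext x
  refine mulEnd_injective hl ?_
  simp only [LinearMap.lsmul_apply, LinearMap.zero_apply]
  rw [← map_smul, hN, map_zero, smul_zero]

/-- If `Ext²(C, Λ) = 0`, then maps to `Λ ⧸ (l)` extend along monomorphisms into `Λ ⧸ (l)` with
cokernel `C`. -/
theorem exists_extension_of_extVanishes (hl : l ∈ nonZeroDivisors Λ) {N C : Type u}
    [AddCommGroup N] [Module Λ N] [AddCommGroup C] [Module Λ C] (hN : ∀ x : N, l • x = 0)
    (ι : N →ₗ[Λ] Λ ⧸ Ideal.span {l}) (π : (Λ ⧸ Ideal.span {l}) →ₗ[Λ] C)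
    (hι : Function.Injective ι) (hπ : Function.Surjective π) (hιπ : Function.Exact ι π)
    (hC : ExtVanishes (Λ := Λ) 2 C) (h : N →ₗ[Λ] Λ ⧸ Ideal.span {l}) :
    ∃ h' : (Λ ⧸ Ideal.span {l}) →ₗ[Λ] Λ ⧸ Ideal.span {l}, h' ∘ₗ ι = h := by
  have hS := shortExact_shortComplexOf _ _ (mulEnd_injective hl)
    (Submodule.mkQ_surjective (Ideal.span {l})) (exact_mulEnd_mkQ l)
  have hT := shortExact_shortComplexOf ι π hι hπ hιπ
  -- Composition with `δ` is the connecting map from Hom(-, Λ ⧸ (l)) to Ext¹(-, Λ). The extension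
  -- problem is solved in Ext¹, where the obstruction lies in Ext²(C, Λ).
  set δ := hS.extClass
  obtain ⟨x, hx⟩ := Ext.contravariant_sequence_exact₁ hT (ModuleCat.of Λ Λ) (n₀ := 1)
    ((Ext.mk₀ (ModuleCat.ofHom h)).comp δ (zero_add 1)) (n₁ := 2) (by norm_num) (hC _)
  -- As l kills Λ ⧸ (l), it kills `x`, so `x` comes from an endomorphism of Λ ⧸ (l).
  obtain ⟨y, hy⟩ := Ext.covariant_sequence_exact₁ _ hS (n₁ := 1) x (by
    have e : (ModuleCat.ofHom (mulEnd l) : ModuleCat.of Λ Λ ⟶ ModuleCat.of Λ Λ) =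
        l • 𝟙 (ModuleCat.of Λ Λ) := by
      ext; simp
    have := Ext.postcomp_smul_id_eq_zero_of_mem_annihilator (R := Λ) (r := l)
      (M := ModuleCat.of Λ Λ) (N := ModuleCat.of Λ (Λ ⧸ Ideal.span {l})) (by
        rw [Ideal.annihilator_quotient]; exact Ideal.mem_span_singleton_self l) 1
    change x.comp (Ext.mk₀ (ModuleCat.ofHom (mulEnd l))) _ = 0
    rw [e]
    exact DFunLike.congr_fun (congrArg AddCommGrpCat.Hom.hom this) x) (n₀ := 0) (by norm_num)
  obtain ⟨g, rfl⟩ := (Ext.addEquiv₀).symm.surjective y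
  refine ⟨g.hom, ?_⟩
  -- A map with zero class lifts to Λ, and a map to Λ from a module killed by l is zero.
  have key : (Ext.mk₀ (ModuleCat.ofHom (g.hom ∘ₗ ι - h))).comp δ (zero_add 1) = 0 := by
    have e : ModuleCat.ofHom (g.hom ∘ₗ ι - h) =
        ModuleCat.ofHom ι ≫ g - ModuleCat.ofHom h := by
      ext; rfl
    rw [e, show Ext.mk₀ (ModuleCat.ofHom ι ≫ g - ModuleCat.ofHom h) = Ext.mk₀ (ModuleCat.ofHom ι ≫ g) -
        Ext.mk₀ (ModuleCat.ofHom h) from map_sub Ext.addEquiv₀.symm _ _, sub_eq_add_neg, Ext.add_comp, Ext.neg_comp,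
      ← sub_eq_add_neg, sub_eq_zero, ← hx, ← hy, ← Ext.mk₀_comp_mk₀]
    rw [Ext.comp_assoc_of_second_deg_zero]
    rfl
  obtain ⟨z, hz⟩ := Ext.covariant_sequence_exact₃ _ hS _ _ key
  obtain ⟨w, rfl⟩ := (Ext.addEquiv₀).symm.surjective z
  have hw : w = 0 := by
    ext1
    exact linearMap_eq_zero_of_smul hl hN w.hom
  rw [hw] at hz
  simp only [map_zero, Ext.zero_comp] at hz
  have := (Ext.mk₀_eq_zero_iff _).1 hz.symm
  rw [← sub_eq_zero]
  exact congrArg ModuleCat.Hom.hom this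

/-- If `Λ` is a Noetherian local ring of finite injective dimension and `l` is a parameter which
is a nonzerodivisor, then the socle of `Λ ⧸ (l)` is simple. -/
theorem socle_simple_of_hasInjectiveDimensionLE [IsNoetherianRing Λ] [IsLocalRing Λ] {n : ℕ}
    (hn : HasInjectiveDimensionLE (ModuleCat.of Λ Λ) n) (hl : l ∈ nonZeroDivisors Λ)
    (hm : ∃ N, IsLocalRing.maximalIdeal Λ ^ N ≤ Ideal.span {l})
    (hl' : l ∈ IsLocalRing.maximalIdeal Λ)
    {f g : Λ} (hf : f ∉ Ideal.span {l})
    (hfm : ∀ r ∈ IsLocalRing.maximalIdeal Λ, r * f ∈ Ideal.span {l})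
    (hgm : ∀ r ∈ IsLocalRing.maximalIdeal Λ, r * g ∈ Ideal.span {l}) :
    ∃ a : Λ, g - a * f ∈ Ideal.span {l} := by
  let sm (f : Λ) (h : ∀ r ∈ IsLocalRing.maximalIdeal Λ, r * f ∈ Ideal.span {l}) :
      (Λ ⧸ IsLocalRing.maximalIdeal Λ) →ₗ[Λ] Λ ⧸ Ideal.span {l} :=
    Submodule.liftQ _ (LinearMap.toSpanSingleton Λ _ (Ideal.Quotient.mk (Ideal.span {l}) f))
      (fun r hr => Ideal.Quotient.eq_zero_iff_mem.2 (h r hr))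
  have sm_mk (f : Λ) (h) (a : Λ) : sm f h (Ideal.Quotient.mk _ a) =
      Ideal.Quotient.mk (Ideal.span {l}) (a * f) := rfl
  have hfinl (N : Type u) [AddCommGroup N] [Module Λ N] (q : (Λ ⧸ Ideal.span {l}) →ₗ[Λ] N)
      (hq : Function.Surjective q) : ∃ n, IsLocalRing.maximalIdeal Λ ^ n ≤
        Module.annihilator Λ N := by
    obtain ⟨N, hN⟩ := hm
    refine ⟨N, hN.trans (le_trans ?_ (LinearMap.annihilator_le_of_surjective q hq))⟩
    rw [Ideal.annihilator_quotient]
  have sm_inj : Function.Injective (sm f hfm) := by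
    rw [injective_iff_map_eq_zero]
    intro a
    obtain ⟨a, rfl⟩ := Ideal.Quotient.mk_surjective a
    intro h
    rw [sm_mk f hfm, Ideal.Quotient.eq_zero_iff_mem] at h
    rw [Ideal.Quotient.eq_zero_iff_mem]
    by_contra ha
    rw [IsLocalRing.notMem_maximalIdeal] at ha
    exact hf ((Ideal.unit_mul_mem_iff_mem _ ha).1 h)
  -- Descending induction from the injective dimension. The socle element f embeds the residue field
  -- in Λ ⧸ (l), whose Ext vanishes from degree 2 on, so each Ext of the residue field is governed
  -- by the next Ext of the cokernel, a module of finite length.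
  have hκ (i : ℕ) : ExtVanishes (Λ := Λ) (i + 2) (Λ ⧸ IsLocalRing.maximalIdeal Λ) := by
    suffices ∀ d i, n + 1 ≤ i + 2 + d →
        ExtVanishes (Λ := Λ) (i + 2) (Λ ⧸ IsLocalRing.maximalIdeal Λ) from
      this (n + 1) i (by omega)
    intro d
    induction d with
    | zero =>
      intro i hi x
      exact Ext.eq_zero_of_hasInjectiveDimensionLT x (n + 1) (by omega)
    | succ d ih =>
      intro i hi x
      have hS := shortExact_shortComplexOf (sm f hfm) (LinearMap.range (sm f hfm)).mkQ sm_inj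
        (Submodule.mkQ_surjective _) (LinearMap.exact_map_mkQ_range _)
      obtain ⟨y, hy⟩ := Ext.contravariant_sequence_exact₁ hS _ x (n₁ := i + 3) (by omega)
        (ExtVanishes.of_residueField (ih (i + 1) (by omega)) _
          (hfinl _ _ (Submodule.mkQ_surjective (LinearMap.range (sm f hfm)))) _)
      rw [← hy, extVanishes_quotient hl y, Ext.comp_zero]
  by_contra hcon
  push Not at hcon
  -- If g is no multiple of f, two copies of the residue field embed in Λ ⧸ (l).
  let ι := (sm f hfm).coprod (sm g hgm)
  have hι : Function.Injective ι := by
    rw [injective_iff_map_eq_zero]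
    rintro ⟨a, b⟩
    obtain ⟨a, rfl⟩ := Ideal.Quotient.mk_surjective a
    obtain ⟨b, rfl⟩ := Ideal.Quotient.mk_surjective b
    intro h
    simp only [ι, LinearMap.coprod_apply, sm_mk, ← map_add] at h
    rw [Ideal.Quotient.eq_zero_iff_mem] at h
    have hb : b ∈ IsLocalRing.maximalIdeal Λ := by
      by_contra hb
      rw [IsLocalRing.notMem_maximalIdeal] at hb
      obtain ⟨u, rfl⟩ := hb
      refine hcon (-(↑u⁻¹ * a)) ?_
      have := Ideal.mul_mem_left _ (↑u⁻¹ : Λ) h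
      convert this using 1
      have hu : (↑u⁻¹ : Λ) * ↑u = 1 := u.inv_mul
      linear_combination (-g) * hu
    have ha : a ∈ IsLocalRing.maximalIdeal Λ := by
      by_contra ha
      rw [IsLocalRing.notMem_maximalIdeal] at ha
      exact hf ((Ideal.unit_mul_mem_iff_mem _ ha).1
        ((Ideal.add_mem_iff_left _ (hgm b hb)).1 h))
    rw [Prod.mk_eq_zero]
    exact ⟨Ideal.Quotient.eq_zero_iff_mem.2 ha, Ideal.Quotient.eq_zero_iff_mem.2 hb⟩
  obtain ⟨h', hh'⟩ := exists_extension_of_extVanishes hl (N := _ × _) (by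
      rintro ⟨a, b⟩
      obtain ⟨a, rfl⟩ := Ideal.Quotient.mk_surjective a
      obtain ⟨b, rfl⟩ := Ideal.Quotient.mk_surjective b
      rw [Prod.smul_mk, Prod.mk_eq_zero]
      exact ⟨Ideal.Quotient.eq_zero_iff_mem.2 (Ideal.mul_mem_right _ _ hl'),
        Ideal.Quotient.eq_zero_iff_mem.2 (Ideal.mul_mem_right _ _ hl')⟩)
    ι (LinearMap.range ι).mkQ hι (Submodule.mkQ_surjective _) (LinearMap.exact_map_mkQ_range _)
    (ExtVanishes.of_residueField (hκ 0) _
      (hfinl _ _ (Submodule.mkQ_surjective (LinearMap.range ι))))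
    ((0 : (Λ ⧸ IsLocalRing.maximalIdeal Λ) →ₗ[Λ] _).coprod (sm g hgm))
  -- The extension of the map (0, g) is multiplication by some c with c f = 0 and c g = g modulo l.
  -- If c is in the maximal ideal then g = 0, and if c is a unit then f = 0.
  obtain ⟨c, hc⟩ := Ideal.Quotient.mk_surjective (h' 1)
  have hh (a : Λ) : h' (Ideal.Quotient.mk _ a) = Ideal.Quotient.mk _ (a * c) := by
    have : (Ideal.Quotient.mk (Ideal.span {l}) a) = a • 1 := by
      conv_lhs => rw [← mul_one a]
      rfl
    rw [this, map_smul, ← hc]; rfl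
  have h1 := LinearMap.congr_fun hh' (Ideal.Quotient.mk _ 1, 0)
  have h2 := LinearMap.congr_fun hh' (0, Ideal.Quotient.mk _ 1)
  simp only [LinearMap.comp_apply, ι, LinearMap.coprod_apply, sm_mk, map_zero, add_zero, zero_add,
    one_mul, hh, LinearMap.zero_apply] at h1 h2
  rw [Ideal.Quotient.eq_zero_iff_mem] at h1
  rw [Ideal.Quotient.eq] at h2
  by_cases hcm : c ∈ IsLocalRing.maximalIdeal Λ
  · refine hcon 0 ?_
    have := Ideal.sub_mem _ (hgm c hcm) h2
    convert this using 1
    ring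
  · rw [IsLocalRing.notMem_maximalIdeal] at hcm
    exact hf ((Ideal.mul_unit_mem_iff_mem _ hcm).1 h1)

end NonZeroDivisor

end ExtVanishing

/-! ### Graded pieces -/

section Graded

variable {k : Type u} [Field k] {σ : Type*}

attribute [local instance] MvPolynomial.gradedAlgebra in
theorem homogeneousComponent_mul_of_isHomogeneous {a b : MvPolynomial σ k} {d n : ℕ}
    (hb : b.IsHomogeneous d) :
    homogeneousComponent n (a * b) =
      if d ≤ n then homogeneousComponent (n - d) a * b else 0 := by
  have := DirectSum.coe_decompose_mul_of_right_mem (homogeneousSubmodule σ k) (a := a) n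
    (show b ∈ homogeneousSubmodule σ k d from hb)
  simp only [← decomposition.decompose'_apply]
  exact this

theorem homogeneousComponent_eq_ite {f : MvPolynomial σ k} {t : ℕ} (hf : f.IsHomogeneous t)
    (j : ℕ) : homogeneousComponent j f = if j = t then f else 0 :=
  homogeneousComponent_of_mem hf

/-- A homogeneous polynomial of positive degree is a combination of products of the variables with
homogeneous polynomials of smaller degree. -/
theorem mem_span_X_mul {f : MvPolynomial σ k} {t : ℕ} (hf : f.IsHomogeneous (t + 1)) :
    f ∈ Submodule.span k {q | ∃ i, ∃ h : MvPolynomial σ k, h.IsHomogeneous t ∧ q = X i * h} := by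
  classical
  rw [f.as_sum]
  refine Submodule.sum_mem _ fun d hd => ?_
  have hdeg := hf.degree_eq_sum_deg_support hd
  have hne : d ≠ 0 := by
    rintro rfl
    simp at hdeg
  obtain ⟨i, hi⟩ : ∃ i, d i ≠ 0 := by
    by_contra h
    push Not at h
    exact hne (Finsupp.ext h)
  have hd' : (d - Finsupp.single i 1) + Finsupp.single i 1 = d :=
    tsub_add_cancel_of_le (Finsupp.single_le_iff.2 (Nat.one_le_iff_ne_zero.2 hi))
  refine Submodule.subset_span ⟨i, monomial (d - Finsupp.single i 1) (coeff d f), ?_, ?_⟩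
  · apply isHomogeneous_monomial
    have h2 : d.degree = t + 1 := by rw [hdeg]; rfl
    rw [← hd', map_add, Finsupp.degree_single] at h2
    omega
  · rw [X, monomial_mul, one_mul, add_comm, hd']

end Graded

/-! ### Regular linear forms and dehomogenization -/

section Hyperplane

variable {k : Type u} [Field k] {n : ℕ}

/-- Over an infinite field, some linear form is a nonzerodivisor modulo a saturated ideal. -/
theorem exists_linear_regular [Infinite k] {I : Ideal (MvPolynomial (Fin (n + 1)) k)}
    (hI : saturation I = I) :
    ∃ l : MvPolynomial (Fin (n + 1)) k, l.IsHomogeneous 1 ∧ ∀ f, l * f ∈ I → f ∈ I := by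
  classical
  let S := MvPolynomial (Fin (n + 1)) k
  let E := homogeneousSubmodule (Fin (n + 1)) k 1
  have hfin := associatedPrimes.finite S (S ⧸ I)
  let F : Ideal S → Submodule k E := fun p => (p.restrictScalars k).comap E.subtype
  -- An associated prime containing all linear forms contains the irrelevant ideal, so the class
  -- that it annihilates comes from the saturation, which is `I`.
  have htop : ⊤ ∉ hfin.toFinset.image F := by
    intro h
    obtain ⟨p, hp, hpt⟩ := Finset.mem_image.1 h
    rw [Set.Finite.mem_toFinset] at hp
    have hX (i : Fin (n + 1)) : (X i : S) ∈ p := by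
      have : (⟨X i, isHomogeneous_X k i⟩ : E) ∈ F p := by rw [hpt]; trivial
      exact this
    obtain ⟨hp', x, hx⟩ := Submodule.isAssociatedPrime_iff.1 hp
    obtain ⟨f, rfl⟩ := Ideal.Quotient.mk_surjective x
    have hf : f ∈ saturation I := by
      refine ⟨1, fun g hg => ?_⟩
      rw [pow_one] at hg
      have : g ∈ p := by
        refine (Ideal.span_le.2 ?_ : irrelevantIdeal k n ≤ p) hg
        rintro _ ⟨i, rfl⟩
        exact hX i
      rw [hx, Submodule.mem_colon_singleton] at this
      rw [mul_comm]
      exact Ideal.Quotient.eq_zero_iff_mem.1 this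
    rw [hI] at hf
    apply hp'.ne_top
    rw [Ideal.eq_top_iff_one, hx, Submodule.mem_colon_singleton]
    rw [Ideal.Quotient.eq_zero_iff_mem.2 hf, smul_zero]
    exact Submodule.zero_mem _
  -- A vector space over an infinite field is not a finite union of proper subspaces.
  have := Subspace.biUnion_ne_univ_of_top_notMem htop
  obtain ⟨l, hl⟩ := (Set.ne_univ_iff_exists_notMem _).1 this
  refine ⟨l, l.2, fun f hf => ?_⟩
  have hreg : IsSMulRegular (S ⧸ I) (l : S) := by
    by_contra hcon
    have : (l : S) ∈ ⋃ p ∈ associatedPrimes S (S ⧸ I), (p : Set S) := by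
      rw [biUnion_associatedPrimes_eq_compl_regular]
      exact hcon
    simp only [Set.mem_iUnion] at this
    obtain ⟨p, hp, hlp⟩ := this
    apply hl
    simp only [Set.mem_iUnion]
    exact ⟨F p, Finset.mem_image.2 ⟨p, hfin.mem_toFinset.2 hp, rfl⟩, hlp⟩
  rw [← Ideal.Quotient.eq_zero_iff_mem]
  apply hreg
  change _ = (l : S) • (0 : S ⧸ I)
  rw [smul_zero]
  exact Ideal.Quotient.eq_zero_iff_mem.2 hf

/-- Dehomogenizing with respect to a linear form which is a nonzerodivisor modulo a homogeneous
ideal loses nothing. -/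
theorem mem_of_mem_sup_span_sub_one {I : Ideal (MvPolynomial (Fin (n + 1)) k)}
    (hI : ∀ f ∈ I, ∀ t : ℕ, homogeneousComponent t f ∈ I)
    {l : MvPolynomial (Fin (n + 1)) k} (hl : l.IsHomogeneous 1) (hreg : ∀ f, l * f ∈ I → f ∈ I)
    {f : MvPolynomial (Fin (n + 1)) k} {t : ℕ} (hf : f.IsHomogeneous t)
    (h : f ∈ I ⊔ Ideal.span {l - 1}) : f ∈ I := by
  obtain ⟨i, hi, q, hq, rfl⟩ := Submodule.mem_sup.1 h
  obtain ⟨g, rfl⟩ := Ideal.mem_span_singleton'.1 hq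
  set f := i + g * (l - 1) with hfdef
  have hcomp (j : ℕ) : homogeneousComponent j f + homogeneousComponent j g
      - homogeneousComponent j (g * l) ∈ I := by
    have : homogeneousComponent j f + homogeneousComponent j g
      - homogeneousComponent j (g * l) = homogeneousComponent j i := by
      rw [hfdef, mul_sub, mul_one, map_add, map_sub]; ring
    rw [this]
    exact hI i hi j
  have key (j : ℕ) : (if t ≤ j then l ^ (j - t) * f else 0) + homogeneousComponent j g ∈ I := by
    induction j with
    | zero =>
      have := hcomp 0
      rw [homogeneousComponent_mul_of_isHomogeneous hl, homogeneousComponent_eq_ite hf] at this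
      rw [if_neg (show ¬ 1 ≤ 0 by omega), sub_zero] at this
      convert this using 2
      by_cases ht : t = 0
      · simp [ht]
      · simp [ht, Ne.symm ht]
    | succ j ih =>
      have := I.add_mem (hcomp (j + 1)) (I.mul_mem_left l ih)
      rw [homogeneousComponent_mul_of_isHomogeneous hl, homogeneousComponent_eq_ite hf] at this
      simp only [Nat.le_add_left, if_true, Nat.add_sub_cancel] at this
      convert this using 1
      rcases lt_trichotomy t (j + 1) with ht | ht | ht
      · rw [if_pos ht.le, if_neg ht.ne', if_pos (Nat.lt_succ_iff.1 ht),
          Nat.succ_sub (Nat.lt_succ_iff.1 ht), pow_succ]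
        ring
      · subst ht
        simp
        ring
      · rw [if_neg (by omega), if_neg (by omega), if_neg (by omega)]
        ring
  have hbig := key (max t (g.totalDegree + 1))
  rw [if_pos (le_max_left _ _), homogeneousComponent_eq_zero _ _ (by
    exact lt_of_lt_of_le (Nat.lt_succ_self _) (le_max_right _ _)), add_zero] at hbig
  have hpow (m : ℕ) : l ^ m * f ∈ I → f ∈ I := by
    induction m with
    | zero => simp
    | succ m ih =>
      intro h
      exact ih (hreg _ (by rwa [pow_succ', mul_assoc] at h))
  exact hpow _ hbig

end Hyperplane

/-! ### The socle of a Gorenstein coordinate ring modulo a linear form -/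

section Socle

/-- If the localization of `R` at a maximal ideal `M` is Gorenstein and `l ∈ M` is a nonzerodivisor
with `M`-primary quotient, then the socle of the localization of `R ⧸ (l)` is simple. -/
theorem socle_simple_localization {R : Type u} [CommRing R] {M : Ideal R} [hM : M.IsMaximal]
    (hG : IsGorensteinLocal (Localization.AtPrime M)) {l : R} (hl : l ∈ M)
    (hreg : l ∈ nonZeroDivisors R) {N : ℕ} (hN : M ^ N ≤ Ideal.span {l}) {f g : R}
    (hf : ∀ s, s ∉ M → s * f ∉ Ideal.span {l})
    (hfM : ∀ r ∈ M, r * f ∈ Ideal.span {l}) (hgM : ∀ r ∈ M, r * g ∈ Ideal.span {l}) :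
    ∃ s b, s ∉ M ∧ s * g - b * f ∈ Ideal.span {l} := by
  obtain ⟨hnoeth, -, d, hd⟩ := hG
  have hmem (h : R) :
      algebraMap R (Localization.AtPrime M) h ∈ Ideal.span {algebraMap _ _ l} →
        ∃ s, s ∉ M ∧ s * h ∈ Ideal.span {l} := by
    rw [← Set.image_singleton, ← Ideal.map_span,
      IsLocalization.mem_map_algebraMap_iff M.primeCompl]
    rintro ⟨⟨⟨a, ha⟩, s, hs⟩, e⟩
    rw [← map_mul, IsLocalization.eq_iff_exists M.primeCompl] at e
    obtain ⟨⟨t, ht⟩, e⟩ := e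
    refine ⟨t * s, M.primeCompl.mul_mem ht hs, ?_⟩
    have : t * s * h = t * a := by
      rw [mul_assoc, mul_comm s]; exact e
    rw [this]
    exact Ideal.mul_mem_left _ _ ha
  have hmem' {h : R} (hh : h ∈ Ideal.span {l}) :
      algebraMap R (Localization.AtPrime M) h ∈ Ideal.span {algebraMap _ _ l} := by
    have := Ideal.mem_map_of_mem (algebraMap R (Localization.AtPrime M)) hh
    rwa [Ideal.map_span, Set.image_singleton] at this
  have hmax : IsLocalRing.maximalIdeal (Localization.AtPrime M) = Ideal.map (algebraMap _ _) M :=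
    Localization.AtPrime.map_eq_maximalIdeal.symm
  have hsoc {h : R} (hX : ∀ r ∈ M, r * h ∈ Ideal.span {l}) :
      ∀ r ∈ IsLocalRing.maximalIdeal (Localization.AtPrime M),
        r * algebraMap _ _ h ∈ Ideal.span {algebraMap R (Localization.AtPrime M) l} := by
    intro r hr
    rw [hmax] at hr
    have : Ideal.map (algebraMap R (Localization.AtPrime M)) M ≤
        Submodule.comap (LinearMap.mulRight (Localization.AtPrime M) (algebraMap _ _ h))
          (Ideal.span {algebraMap R (Localization.AtPrime M) l}) := by
      rw [Ideal.map_le_iff_le_comap]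
      intro r hr
      have := hmem' (hX r hr)
      rw [map_mul] at this
      exact this
    exact this hr
  obtain ⟨a, ha⟩ := socle_simple_of_hasInjectiveDimensionLE (n := d) hd
    (l := algebraMap R (Localization.AtPrime M) l)
    (IsLocalization.map_nonZeroDivisors_le M.primeCompl _
      (Submonoid.mem_map_of_mem (algebraMap _ _) hreg))
    ⟨N, by
      rw [hmax, ← Ideal.map_pow, Ideal.map_le_iff_le_comap]
      intro x hx
      exact hmem' (hN hx)⟩
    (by rw [hmax]; exact Ideal.mem_map_of_mem _ hl)
    (f := algebraMap _ _ f) (g := algebraMap _ _ g)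
    (fun hcon => by
      obtain ⟨s, hs, hsf⟩ := hmem f hcon
      exact hf s hs hsf)
    (hsoc hfM) (hsoc hgM)
  obtain ⟨b, ⟨s, hs⟩, rfl⟩ := IsLocalization.exists_mk'_eq M.primeCompl a
  have h1 := Ideal.mul_mem_left _ (algebraMap R (Localization.AtPrime M) s) ha
  rw [mul_sub, ← mul_assoc, IsLocalization.mk'_spec'_mk, ← map_mul, ← map_mul, ← map_sub] at h1
  obtain ⟨t, ht, h2⟩ := hmem _ h1
  refine ⟨t * s, t * b, M.primeCompl.mul_mem ht hs, ?_⟩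
  convert h2 using 1
  ring

variable {k : Type u} [Field k] {n : ℕ}

theorem sub_C_constantCoeff_mem (r : MvPolynomial (Fin (n + 1)) k) :
    r - C (constantCoeff r) ∈ irrelevantIdeal k n := by
  induction r using MvPolynomial.induction_on with
  | C a => simp
  | add p q hp hq =>
    rw [map_add, C_add, add_sub_add_comm]
    exact Ideal.add_mem _ hp hq
  | mul_X p i _ =>
    rw [map_mul, constantCoeff_X, mul_zero, C_0, sub_zero]
    exact Ideal.mul_mem_left _ _ (Ideal.subset_span ⟨i, rfl⟩)

theorem irrelevantIdeal_eq_ker :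
    irrelevantIdeal k n = RingHom.ker (constantCoeff (R := k) (σ := Fin (n + 1))) := by
  refine le_antisymm (Ideal.span_le.2 ?_) fun f hf => ?_
  · rintro _ ⟨i, rfl⟩
    simp
  · have := sub_C_constantCoeff_mem f
    rwa [RingHom.mem_ker.1 hf, C_0, sub_zero] at this

/-- In a Gorenstein homogeneous coordinate ring, the socle of the quotient by a regular linear form
with Artinian quotient is simple. -/
theorem socle_simple {I : Ideal (MvPolynomial (Fin (n + 1)) k)}
    (hG : IsGorensteinRing (MvPolynomial (Fin (n + 1)) k ⧸ I))
    (hIm : I ≤ irrelevantIdeal k n)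
    {l : MvPolynomial (Fin (n + 1)) k} (hl : l ∈ irrelevantIdeal k n)
    (hreg : ∀ f, l * f ∈ I → f ∈ I) {N : ℕ}
    (hN : irrelevantIdeal k n ^ N ≤ I ⊔ Ideal.span {l})
    {f g : MvPolynomial (Fin (n + 1)) k} (hf : f ∉ I ⊔ Ideal.span {l})
    (hfX : ∀ i, X i * f ∈ I ⊔ Ideal.span {l}) (hgX : ∀ i, X i * g ∈ I ⊔ Ideal.span {l}) :
    ∃ c : k, g - C c * f ∈ I ⊔ Ideal.span {l} := by
  set J := I ⊔ Ideal.span {l} with hJ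
  set q := Ideal.Quotient.mk I with hq
  have hqs : Function.Surjective q := Ideal.Quotient.mk_surjective
  have hmul {f : MvPolynomial (Fin (n + 1)) k} (hfX : ∀ i, X i * f ∈ J)
      {r : MvPolynomial (Fin (n + 1)) k} (hr : r ∈ irrelevantIdeal k n) : r * f ∈ J := by
    have : irrelevantIdeal k n ≤ Submodule.comap (LinearMap.mulRight _ f) J := by
      refine Ideal.span_le.2 ?_
      rintro _ ⟨i, rfl⟩
      exact hfX i
    exact this hr
  -- On socle elements a polynomial acts through its constant term, so the coefficients found in the
  -- localization can be replaced by scalars.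
  have hconst {f : MvPolynomial (Fin (n + 1)) k} (hfX : ∀ i, X i * f ∈ J)
      (r : MvPolynomial (Fin (n + 1)) k) : r * f - C (constantCoeff r) * f ∈ J := by
    rw [← sub_mul]
    exact hmul hfX (sub_C_constantCoeff_mem r)
  have hmax : (irrelevantIdeal k n).IsMaximal := by
    rw [irrelevantIdeal_eq_ker]
    exact RingHom.ker_isMaximal_of_surjective _ (fun a => ⟨C a, by simp⟩)
  have hkerq : RingHom.ker q = I := Ideal.mk_ker
  have hM : (Ideal.map q (irrelevantIdeal k n)).IsMaximal :=
    Ideal.IsMaximal.map_of_surjective_of_ker_le hqs (by rw [hkerq]; exact hIm)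
  have hcomapM : (Ideal.map q (irrelevantIdeal k n)).comap q = irrelevantIdeal k n := by
    rw [Ideal.comap_map_of_surjective' _ hqs, hkerq, sup_eq_left.2 hIm]
  have hcomapJ (x : MvPolynomial (Fin (n + 1)) k) : q x ∈ Ideal.span {q l} ↔ x ∈ J := by
    rw [← Ideal.mem_comap, ← Set.image_singleton, ← Ideal.map_span,
      Ideal.comap_map_of_surjective' _ hqs, hkerq, sup_comm]
  have hunit (s) : q s ∉ Ideal.map q (irrelevantIdeal k n) ↔ constantCoeff s ≠ 0 := by
    rw [← Ideal.mem_comap, hcomapM, irrelevantIdeal_eq_ker, RingHom.mem_ker]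
  have hqM {f : MvPolynomial (Fin (n + 1)) k} (hfX : ∀ i, X i * f ∈ J) :
      ∀ r ∈ Ideal.map q (irrelevantIdeal k n), r * q f ∈ Ideal.span {q l} := by
    intro r hr
    obtain ⟨r, rfl⟩ := hqs r
    rw [← Ideal.mem_comap, hcomapM] at hr
    rw [← map_mul, hcomapJ]
    exact hmul hfX hr
  obtain ⟨s, b, hs, hsb⟩ := socle_simple_localization (hG (Ideal.map q (irrelevantIdeal k n)))
    (l := q l) (f := q f) (g := q g) (N := N) (Ideal.mem_map_of_mem _ hl)
    (by
      rw [mem_nonZeroDivisors_iff_right]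
      intro x hx
      obtain ⟨x, rfl⟩ := hqs x
      rw [← map_mul, Ideal.Quotient.eq_zero_iff_mem, mul_comm] at hx
      exact Ideal.Quotient.eq_zero_iff_mem.2 (hreg _ hx))
    (by
      rw [← Ideal.map_pow, Ideal.map_le_iff_le_comap]
      intro x hx
      rw [Ideal.mem_comap, hcomapJ]
      exact hN hx)
    (by
      intro s hs hcon
      obtain ⟨s, rfl⟩ := hqs s
      rw [hunit] at hs
      rw [← map_mul, hcomapJ] at hcon
      have h1 := J.sub_mem hcon (hconst hfX s)
      rw [sub_sub_cancel] at h1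
      have h2 := J.mul_mem_left (C (constantCoeff s)⁻¹) h1
      rw [← mul_assoc, ← C_mul, inv_mul_cancel₀ hs, C_1, one_mul] at h2
      exact hf h2)
    (hqM hfX) (hqM hgX)
  obtain ⟨b, rfl⟩ := hqs b
  obtain ⟨s, rfl⟩ := hqs s
  rw [hunit] at hs
  rw [← map_mul, ← map_mul, ← map_sub, hcomapJ] at hsb
  refine ⟨(constantCoeff s)⁻¹ * constantCoeff b, ?_⟩
  have h3 := J.sub_mem (J.sub_mem hsb (hconst hgX s)) (J.neg_mem (hconst hfX b))
  have h4 := J.mul_mem_left (C (constantCoeff s)⁻¹) h3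
  convert h4 using 1
  have e1 : (C (constantCoeff s) * C (constantCoeff s)⁻¹ : MvPolynomial (Fin (n + 1)) k) = 1 := by
    rw [← C_mul, mul_inv_cancel₀ hs, C_1]
  rw [C_mul]
  linear_combination (-g) * e1

end Socle

/-! ### From the ideal to a Frobenius algebra of dimension six -/

section FrobeniusModel

variable {k : Type u} [Field k]

theorem eq_C_of_isHomogeneous_zero {σ : Type*} {f : MvPolynomial σ k} (hf : f.IsHomogeneous 0) :
    f = C (coeff 0 f) :=
  totalDegree_eq_zero_iff_eq_C.1 (Nat.le_zero.1 hf.totalDegree_le)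

theorem coeff_single_sum_C_mul_X {σ : Type*} [Fintype σ] (c : σ → k) (i : σ) :
    coeff (Finsupp.single i 1) (∑ j, C (c j) * X j) = c i := by
  classical
  simp [coeff_sum, coeff_C_mul, coeff_X, Finsupp.single_left_inj]

theorem isHomogeneous_sum_C_mul_X {σ : Type*} [Fintype σ] (c : σ → k) :
    (∑ j, C (c j) * X j : MvPolynomial σ k).IsHomogeneous 1 :=
  IsHomogeneous.sum _ _ _ fun i _ => by
    simpa using (isHomogeneous_C σ (c i)).mul (isHomogeneous_X k i)

theorem exists_of_mem_sup_span {n : ℕ} {I : Ideal (MvPolynomial (Fin (n + 1)) k)}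
    (hI : ∀ f ∈ I, ∀ t : ℕ, homogeneousComponent t f ∈ I)
    {l : MvPolynomial (Fin (n + 1)) k} (hl : l.IsHomogeneous 1)
    {f : MvPolynomial (Fin (n + 1)) k} (h : f ∈ I ⊔ Ideal.span {l}) (t : ℕ) :
    ∃ a : MvPolynomial (Fin (n + 1)) k, a.IsHomogeneous t ∧
      homogeneousComponent (t + 1) f - l * a ∈ I := by
  obtain ⟨i, hi, q, hq, rfl⟩ := Submodule.mem_sup.1 h
  obtain ⟨g, rfl⟩ := Ideal.mem_span_singleton'.1 hq
  refine ⟨homogeneousComponent t g, homogeneousComponent_isHomogeneous _ _, ?_⟩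
  rw [map_add, homogeneousComponent_mul_of_isHomogeneous hl, if_pos (Nat.le_add_left _ _),
    Nat.add_sub_cancel, mul_comm, add_sub_cancel_right]
  exact hI _ hi _

/-- `Proj (k[x_0, …, x_4] ⧸ I)` is the spectrum of a Frobenius algebra `B` of dimension six, embedded
by a basis `v` of the kernel of the Frobenius form, and that kernel contains `1`. -/
structure IsFrobeniusModel (I : Ideal (MvPolynomial (Fin 5) k)) {B : Type u} [CommRing B]
    [Algebra k B] (φ : B →ₗ[k] k) (v : Fin 5 → B) : Prop where
  finrank_eq : Module.finrank k B = 6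
  nondegenerate : ∀ b : B, (∀ c, φ (b * c) = 0) → b = 0
  linearIndependent : LinearIndependent k v
  span_eq : Submodule.span k (Set.range v) = LinearMap.ker φ
  map_one : φ 1 = 0
  mem_iff : ∀ (f : MvPolynomial (Fin 5) k) (t : ℕ), f.IsHomogeneous t → (f ∈ I ↔ aeval v f = 0)

-- Since `l` becomes 1, the images `F t` of the forms of degree t increase with t, and their
-- dimensions are the values of the Hilbert function. Nondegeneracy gives 5 for t = 1 and the
-- Hilbert polynomial gives 6 for large t, so `F 2` is already everything. The functional `φ` is the
-- one with kernel `F 1`, and the simple socle makes it nondegenerate.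
set_option maxHeartbeats 1000000 in
theorem IsHilbAGZero.exists_isFrobeniusModel_aux {I : Ideal (MvPolynomial (Fin 5) k)}
    (hI : IsHilbAGZero 4 6 I) {l : MvPolynomial (Fin 5) k} (hl : l.IsHomogeneous 1)
    (hreg : ∀ f, l * f ∈ I → f ∈ I) {B : Type u} [CommRing B] [Algebra k B]
    (q : MvPolynomial (Fin 5) k →ₐ[k] B) (hqs : Function.Surjective q) (hql : q l = 1)
    (hqI : ∀ (f : MvPolynomial (Fin 5) k) (t : ℕ), f.IsHomogeneous t → (f ∈ I ↔ q f = 0)) :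
    ∃ φ : B →ₗ[k] k, IsFrobeniusModel I φ (fun i => q (X i)) := by
  let H (t : ℕ) : Submodule k (MvPolynomial (Fin 5) k) := homogeneousSubmodule (Fin 5) k t
  let F (t : ℕ) : Submodule k B := (H t).map q.toLinearMap
  have hF {t : ℕ} {b : B} : b ∈ F t ↔ ∃ f : (MvPolynomial (Fin 5) k), f.IsHomogeneous t ∧ q f = b := Iff.rfl
  have hdim (t : ℕ) : Module.finrank k (F t) = hilbertFunction I t := by
    have e (g : (MvPolynomial (Fin 5) k) →ₗ[k] B) (g' : (MvPolynomial (Fin 5) k) →ₗ[k] (MvPolynomial (Fin 5) k) ⧸ I) (h : ∀ f ∈ H t, g f = 0 ↔ g' f = 0) :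
        Module.finrank k ((H t).map g) = Module.finrank k ((H t).map g') := by
      rw [← LinearMap.range_domRestrict, ← LinearMap.range_domRestrict]
      refine LinearEquiv.finrank_eq ((LinearMap.quotKerEquivRange _).symm ≪≫ₗ
        Submodule.quotEquivOfEq _ _ ?_ ≪≫ₗ LinearMap.quotKerEquivRange _)
      ext f
      exact h f f.2
    refine e _ _ fun f hf => ?_
    refine (hqI f t hf).symm.trans ?_
    exact Ideal.Quotient.eq_zero_iff_mem.symm
  have hmono : Monotone F := monotone_nat_of_le_succ fun t b hb => by
    obtain ⟨f, hf, rfl⟩ := hF.1 hb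
    exact hF.2 ⟨f * l, hf.mul hl, by rw [map_mul, hql, mul_one]⟩
  have hmul {s t : ℕ} {a b : B} (ha : a ∈ F s) (hb : b ∈ F t) : a * b ∈ F (s + t) := by
    obtain ⟨f, hf, rfl⟩ := hF.1 ha
    obtain ⟨g, hg, rfl⟩ := hF.1 hb
    exact hF.2 ⟨f * g, hf.mul hg, map_mul _ _ _⟩
  obtain ⟨t₀, ht₀⟩ := hI.hilbertPolynomial
  have hfd (t : ℕ) (ht : t₀ ≤ t) : Module.Finite k (F t) :=
    Module.finite_of_finrank_pos (by rw [hdim, ht₀ t ht]; norm_num)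
  have hstab (t : ℕ) (ht : t₀ ≤ t) : F t = F t₀ := by
    have := hfd t ht
    exact (Submodule.eq_of_le_of_finrank_eq (hmono ht)
      (by rw [hdim, hdim, ht₀ t ht, ht₀ t₀ le_rfl])).symm
  have htop : F t₀ = ⊤ := by
    rw [eq_top_iff]
    rintro b -
    obtain ⟨f, rfl⟩ := hqs b
    rw [← sum_homogeneousComponent f, map_sum]
    refine Submodule.sum_mem _ fun i _ => ?_
    rw [← hstab _ (le_max_left t₀ i)]
    exact hmono (le_max_right t₀ i) (hF.2 ⟨_, homogeneousComponent_isHomogeneous _ _, rfl⟩)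
  have hB : Module.finrank k B = 6 := by
    rw [← finrank_top, ← htop, hdim, ht₀ t₀ le_rfl]
  have : Module.Finite k B := Module.finite_of_finrank_pos (by rw [hB]; norm_num)
  let v : Fin 5 → B := fun i => q (X i)
  have hv (f : (MvPolynomial (Fin 5) k)) : aeval v f = q f := by
    have : aeval v = q := by ext i; simp [v]
    rw [this]
  have hlin (c : Fin 5 → k) : (∑ i, C (c i) * X i : (MvPolynomial (Fin 5) k)).IsHomogeneous 1 :=
    IsHomogeneous.sum _ _ _ fun i _ => by
      simpa using (isHomogeneous_C (Fin 5) (c i)).mul (isHomogeneous_X k i)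
  have hqlin (c : Fin 5 → k) : q (∑ i, C (c i) * X i : (MvPolynomial (Fin 5) k)) = ∑ i, c i • v i := by
    rw [map_sum]
    refine Finset.sum_congr rfl fun i _ => ?_
    rw [← smul_eq_C_mul, map_smul]
  have hvli : LinearIndependent k v := by
    rw [Fintype.linearIndependent_iff]
    intro c hc i
    rw [← hqlin, ← hqI _ 1 (hlin c)] at hc
    have h0 := hI.nondegenerate _ hc (hlin c)
    have := congrArg (coeff (Finsupp.single i 1)) h0
    rwa [coeff_single_sum_C_mul_X, coeff_zero] at this
  have hvF : Submodule.span k (Set.range v) = F 1 := by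
    refine le_antisymm (Submodule.span_le.2 ?_) fun b hb => ?_
    · rintro _ ⟨i, rfl⟩
      exact hF.2 ⟨X i, isHomogeneous_X k i, rfl⟩
    · obtain ⟨f, hf, rfl⟩ := hF.1 hb
      have := mem_span_X_mul (t := 0) hf
      refine (Submodule.span_le (p := (Submodule.span k (Set.range v)).comap q.toLinearMap)).2
        ?_ this
      rintro _ ⟨i, h, hh, rfl⟩
      rw [eq_C_of_isHomogeneous_zero hh]
      change q (X i * C (coeff 0 h)) ∈ Submodule.span k (Set.range v)
      rw [mul_comm, ← smul_eq_C_mul, map_smul]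
      exact Submodule.smul_mem _ _ (Submodule.subset_span ⟨i, rfl⟩)
  have hF1 : Module.finrank k (F 1) = 5 := by
    rw [← hvF, finrank_span_eq_card hvli]; rfl
  have hXF {t : ℕ} {p : Submodule k B} (h : ∀ i, ∀ b ∈ F t, v i * b ∈ p) : F (t + 1) ≤ p := by
    intro b hb
    obtain ⟨f, hf, rfl⟩ := hF.1 hb
    refine (Submodule.span_le (p := p.comap q.toLinearMap)).2 ?_ (mem_span_X_mul hf)
    rintro _ ⟨i, g, hg, rfl⟩
    change q (X i * g) ∈ p
    rw [map_mul]
    exact h i _ (hF.2 ⟨g, hg, rfl⟩)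
  have hv1 (i : Fin 5) : v i ∈ F 1 := hF.2 ⟨X i, isHomogeneous_X k i, rfl⟩
  -- If `F 2` were equal to `F 1`, the filtration would stop at dimension 5.
  have hF2 : F 2 = ⊤ := by
    have hne : F 2 ≠ F 1 := by
      intro heq
      have hle (t : ℕ) : F (t + 1) ≤ F 1 := by
        induction t with
        | zero => exact le_rfl
        | succ t ih =>
          refine hXF fun i b hb => ?_
          rw [← heq]
          exact hmul (hv1 i) (ih hb)
      have h1 : F 1 = ⊤ := by
        rw [eq_top_iff, ← htop]
        exact (hmono (Nat.le_succ t₀)).trans (hle t₀)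
      rw [h1, finrank_top, hB] at hF1
      norm_num at hF1
    have hlt : F 1 < F 2 := lt_of_le_of_ne (hmono (by norm_num)) hne.symm
    have := Submodule.finrank_lt_finrank_of_lt hlt
    refine Submodule.eq_top_of_finrank_eq (le_antisymm (Submodule.finrank_le _) ?_)
    rw [hB]; omega
  have hF1top : F 1 < ⊤ := lt_top_iff_ne_top.2 fun h => by
    rw [h, finrank_top, hB] at hF1
    norm_num at hF1
  obtain ⟨φ, hφ0, hφ⟩ := Submodule.exists_le_ker_of_lt_top _ hF1top
  have hker : F 1 = LinearMap.ker φ := by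
    refine Submodule.eq_of_le_of_finrank_le hφ ?_
    have h1 : LinearMap.ker φ < ⊤ := lt_top_iff_ne_top.2 fun h => hφ0 (LinearMap.ker_eq_top.1 h)
    have := Submodule.finrank_lt_finrank_of_lt h1
    rw [finrank_top, hB] at this
    omega
  have hφ1 : φ 1 = 0 := hφ (hF.2 ⟨l, hl, hql⟩)
  -- The reduction modulo `l` vanishes from degree 3 on, so all quadratic forms lie in its socle.
  have hcube {f : (MvPolynomial (Fin 5) k)} (hf : f.IsHomogeneous 3) : f ∈ I ⊔ Ideal.span {l} := by
    have : q f ∈ F 2 := by rw [hF2]; trivial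
    obtain ⟨h, hh, hqh⟩ := hF.1 this
    have h3 : f - h * l ∈ I := by
      rw [hqI _ 3 (hf.sub (hh.mul hl)), map_sub, map_mul, hql, mul_one, hqh, sub_self]
    rw [← sub_add_cancel f (h * l)]
    exact Submodule.add_mem_sup h3 (Ideal.mul_mem_left _ _ (Ideal.mem_span_singleton_self _))
  have hlm : l ∈ irrelevantIdeal k 4 := by
    rw [irrelevantIdeal_eq_ker, RingHom.mem_ker, constantCoeff_eq]
    exact hl.coeff_eq_zero (by simp)
  have hIm : I ≤ irrelevantIdeal k 4 := by
    intro f hf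
    rw [irrelevantIdeal_eq_ker, RingHom.mem_ker, constantCoeff_eq]
    by_contra hne
    have h0 := hI.homogeneous f hf 0
    rw [homogeneousComponent_zero] at h0
    have h1 : (1 : (MvPolynomial (Fin 5) k)) ∈ I := by
      have := I.mul_mem_left (C (coeff 0 f)⁻¹) h0
      rwa [← C_mul, inv_mul_cancel₀ hne, C_1] at this
    have := hI.nondegenerate (X 0) (by simpa using I.mul_mem_left (X 0) h1) (isHomogeneous_X k 0)
    exact X_ne_zero _ this
  have hN : irrelevantIdeal k 4 ^ 3 ≤ I ⊔ Ideal.span {l} := by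
    rw [pow_succ, pow_two, irrelevantIdeal, Ideal.span_mul_span', Ideal.span_mul_span',
      Ideal.span_le]
    rintro _ ⟨_, ⟨_, ⟨i, rfl⟩, _, ⟨j, rfl⟩, rfl⟩, _, ⟨m, rfl⟩, rfl⟩
    exact hcube (((isHomogeneous_X k i).mul (isHomogeneous_X k j)).mul (isHomogeneous_X k m))
  obtain ⟨b₀, -, hb₀⟩ := SetLike.exists_of_lt hF1top
  obtain ⟨g, hg, hgb⟩ := hF.1 (show b₀ ∈ F 2 by rw [hF2]; trivial)
  have hgl : g ∉ I ⊔ Ideal.span {l} := by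
    intro h
    obtain ⟨a, ha, hga⟩ := exists_of_mem_sup_span hI.homogeneous hl h 1
    rw [homogeneousComponent_eq_ite hg, if_pos rfl, hqI _ 2 (hg.sub (hl.mul ha)), map_sub, map_mul,
      hql, one_mul, sub_eq_zero, hgb] at hga
    exact hb₀ (hF.2 ⟨a, ha, hga.symm⟩)
  refine ⟨φ, hB, fun b hb => ?_, hvli, hvF.trans hker, hφ1,
    fun f t hf => by rw [hv]; exact hqI f t hf⟩
  -- An element `b` orthogonal to everything lies in `ker φ` and lifts to a linear form `f`, which
  -- is in the socle. The socle is spanned by the quadratic form `g`, so for reasons of degree `f`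
  -- is a multiple of `l` modulo `I`. Then `b` is a nonzero constant and `φ = 0`.
  by_contra hb0
  have hbF : b ∈ F 1 := by
    rw [hker, LinearMap.mem_ker, ← mul_one b]
    exact hb 1
  obtain ⟨f, hf, hfb⟩ := hF.1 hbF
  obtain ⟨c, hc⟩ := socle_simple hI.gorenstein hIm hlm hreg hN hgl (g := f)
    (fun i => hcube ((isHomogeneous_X k i).mul hg))
    (fun i => by
      have : v i * b ∈ F 1 := by
        rw [hker, LinearMap.mem_ker, mul_comm]
        exact hb _
      obtain ⟨h, hh, hqh⟩ := hF.1 this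
      have h3 : X i * f - h * l ∈ I := by
        rw [hqI _ 2 (((isHomogeneous_X k i).mul hf).sub (hh.mul hl)), map_sub, map_mul, map_mul,
          hql, mul_one, hqh, hfb, sub_self]
      rw [← sub_add_cancel (X i * f) (h * l)]
      exact Submodule.add_mem_sup h3 (Ideal.mul_mem_left _ _ (Ideal.mem_span_singleton_self _)))
  obtain ⟨a, ha, hfa⟩ := exists_of_mem_sup_span hI.homogeneous hl hc 0
  rw [map_sub, homogeneousComponent_eq_ite hf, if_pos rfl,
    homogeneousComponent_eq_ite (t := 2) (by simpa using (isHomogeneous_C (Fin 5) c).mul hg),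
    if_neg (by norm_num), sub_zero, hqI _ 1 (hf.sub (hl.mul ha)), map_sub, map_mul, hql, one_mul,
    sub_eq_zero, hfb, eq_C_of_isHomogeneous_zero ha] at hfa
  have hne : coeff 0 a ≠ 0 := by
    rintro h0
    rw [h0, C_0, map_zero] at hfa
    exact hb0 hfa
  apply hφ0
  ext x
  have := hb x
  rw [hfa, ← algebraMap_eq, AlgHom.commutes, ← Algebra.smul_def, map_smul, smul_eq_mul] at this
  simpa [hne] using this

theorem exists_isFrobeniusModel [Infinite k] {I : Ideal (MvPolynomial (Fin 5) k)}
    (hI : IsHilbAGZero 4 6 I) :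
    ∃ (B : Type u) (_ : CommRing B) (_ : Algebra k B) (φ : B →ₗ[k] k) (v : Fin 5 → B),
      IsFrobeniusModel I φ v := by
  obtain ⟨l, hl, hreg⟩ := exists_linear_regular hI.saturated
  have hq0 (f : MvPolynomial (Fin 5) k) :
      Ideal.Quotient.mkₐ k (I ⊔ Ideal.span {l - 1}) f = 0 ↔ f ∈ I ⊔ Ideal.span {l - 1} :=
    Ideal.Quotient.eq_zero_iff_mem
  obtain ⟨φ, h⟩ := hI.exists_isFrobeniusModel_aux hl hreg
    (Ideal.Quotient.mkₐ k (I ⊔ Ideal.span {l - 1})) Ideal.Quotient.mk_surjective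
    (by
      rw [← sub_eq_zero, ← map_one (Ideal.Quotient.mkₐ k (I ⊔ Ideal.span {l - 1})), ← map_sub, hq0]
      exact Ideal.mem_sup_right (Ideal.mem_span_singleton_self _))
    (fun f t hf => by
      rw [hq0]
      exact ⟨fun h => Ideal.mem_sup_left h,
        fun h => mem_of_mem_sup_span_sub_one hI.homogeneous hl hreg hf h⟩)
  exact ⟨_, _, _, φ, _, h⟩

end FrobeniusModel

/-! ### The ideal of a Frobenius model is generated by at most nine quadrics -/

section Reduction

variable {k : Type u} [Field k]

theorem homogeneousComponent_mem_span {σ : Type*} {s : Set (MvPolynomial σ k)} {d : ℕ}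
    (hs : ∀ f ∈ s, f.IsHomogeneous d) {f : MvPolynomial σ k} (hf : f ∈ Ideal.span s) (t : ℕ) :
    homogeneousComponent t f ∈ Ideal.span s := by
  obtain ⟨n, a, x, rfl⟩ := Submodule.mem_span_set'.1 hf
  rw [map_sum]
  refine Ideal.sum_mem _ fun i _ => ?_
  rw [smul_eq_mul, homogeneousComponent_mul_of_isHomogeneous (hs _ (x i).2)]
  split_ifs
  · exact Ideal.mul_mem_left _ _ (Ideal.subset_span (x i).2)
  · exact Ideal.zero_mem _

theorem mem_of_forall_homogeneousComponent_mem {σ : Type*} {I : Ideal (MvPolynomial σ k)}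
    {f : MvPolynomial σ k} (h : ∀ t, homogeneousComponent t f ∈ I) : f ∈ I := by
  rw [← sum_homogeneousComponent f]
  exact I.sum_mem fun t _ => h t

theorem saturation_mono {n : ℕ} {I J : Ideal (MvPolynomial (Fin (n + 1)) k)} (h : I ≤ J) :
    saturation I ≤ saturation J :=
  fun _ ⟨N, hN⟩ => ⟨N, fun g hg => h (hN g hg)⟩

theorem le_saturation {n : ℕ} (I : Ideal (MvPolynomial (Fin (n + 1)) k)) : I ≤ saturation I :=
  fun _ hf => ⟨0, fun g _ => I.mul_mem_right g hf⟩

theorem finite_and_finrank_homogeneousSubmodule_two_le :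
    Module.Finite k (homogeneousSubmodule (Fin 5) k 2) ∧
      Module.finrank k (homogeneousSubmodule (Fin 5) k 2) ≤ 15 := by
  let m : Sym2 (Fin 5) → MvPolynomial (Fin 5) k :=
    Sym2.lift ⟨fun i j => X i * X j, fun i j => mul_comm _ _⟩
  have hle : homogeneousSubmodule (Fin 5) k 2 ≤ Submodule.span k (Set.range m) := by
    intro f hf
    refine Submodule.span_le.2 ?_ (mem_span_X_mul (t := 1) hf)
    rintro _ ⟨i, h, hh, rfl⟩
    refine (Submodule.span_le (p := (Submodule.span k (Set.range m)).comap
      (LinearMap.mulLeft k (X i)))).2 ?_ (mem_span_X_mul (t := 0) hh)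
    rintro _ ⟨j, h, hh, rfl⟩
    rw [eq_C_of_isHomogeneous_zero hh]
    change X i * (X j * C (coeff 0 h)) ∈ Submodule.span k (Set.range m)
    rw [← mul_assoc, mul_comm, ← smul_eq_C_mul]
    exact Submodule.smul_mem _ _ (Submodule.subset_span ⟨s(i, j), rfl⟩)
  have h1 := finrank_range_le_card (R := k) m
  have : Fintype.card (Sym2 (Fin 5)) = 15 := by decide
  have hfin : Module.Finite k (Submodule.span k (Set.range m)) :=
    Module.Finite.span_of_finite k (Set.finite_range m)
  exact ⟨Submodule.finiteDimensional_of_le hle, (Submodule.finrank_mono hle).trans (h1.trans this.le)⟩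

namespace IsFrobeniusModel

variable {I : Ideal (MvPolynomial (Fin 5) k)} {B : Type u} [CommRing B] [Algebra k B]
  {φ : B →ₗ[k] k} {v : Fin 5 → B}

theorem exists_linear (hM : IsFrobeniusModel I φ v) {b : B} (hb : φ b = 0) :
    ∃ l : MvPolynomial (Fin 5) k, l.IsHomogeneous 1 ∧ aeval v l = b := by
  have : b ∈ Submodule.span k (Set.range v) := by rw [hM.span_eq]; exact hb
  obtain ⟨c, rfl⟩ := (Submodule.mem_span_range_iff_exists_fun k).1 this
  refine ⟨∑ i, C (c i) * X i, isHomogeneous_sum_C_mul_X c, ?_⟩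
  simp [map_sum, Algebra.smul_def]

theorem finite (hM : IsFrobeniusModel I φ v) : Module.Finite k B :=
  Module.finite_of_finrank_pos (by rw [hM.finrank_eq]; norm_num)

/-- The Frobenius form is nondegenerate on `ker φ` modulo the constants. -/
theorem exists_mul_ne_zero (hM : IsFrobeniusModel I φ v) {b : B} (hb : b ∉ Submodule.span k {1}) :
    ∃ c, φ c = 0 ∧ φ (b * c) ≠ 0 := by
  by_contra! hcon
  have hφ : ∃ e, φ e ≠ 0 := by
    by_contra! h
    exact hb (by rw [hM.nondegenerate b fun c => h _]; exact Submodule.zero_mem _)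
  obtain ⟨e, he⟩ := hφ
  -- The functional `φ (b * ·)` vanishes on `ker φ`, so it is a multiple of `φ`.
  have : b - ((φ (b * e)) / φ e) • 1 = 0 := by
    refine hM.nondegenerate _ fun c => ?_
    have h0 := hcon (c - (φ c / φ e) • e) (by simp [he])
    rw [mul_sub, map_sub, mul_smul_comm, map_smul, smul_eq_mul, sub_eq_zero] at h0
    rw [sub_mul, map_sub, h0, smul_mul_assoc, one_mul, map_smul, smul_eq_mul]
    ring
  rw [sub_eq_zero] at this
  exact hb (by rw [this]; exact Submodule.smul_mem _ _ (Submodule.mem_span_singleton_self _))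

/-- Two linear conditions leave a subspace of dimension at least four, too large to consist of
constants. -/
theorem exists_orthogonal (hM : IsFrobeniusModel I φ v) (b : B) :
    ∃ c, φ c = 0 ∧ φ (c * b) = 0 ∧ c ∉ Submodule.span k {1} := by
  have := hM.finite
  by_contra! hcon
  let f : B →ₗ[k] (Fin 2 → k) := LinearMap.pi ![φ, φ ∘ₗ LinearMap.mulRight k b]
  have hle : LinearMap.ker f ≤ Submodule.span k {1} := by
    intro c hc
    have h := congrFun (LinearMap.mem_ker.1 hc)
    exact hcon c (h 0) (h 1)
  have h1 := Submodule.finrank_mono hle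
  have h2 : Module.finrank k (Submodule.span k {(1 : B)}) ≤ 1 := by
    simpa using finrank_span_le_card (R := k) ({1} : Set B)
  have h3 := f.finrank_range_add_finrank_ker
  have h4 := Submodule.finrank_le (LinearMap.range f)
  rw [Module.finrank_fin_fun] at h4
  rw [hM.finrank_eq] at h3
  omega

/-- The quadrics in the ideal. -/
noncomputable def quadrics (I : Ideal (MvPolynomial (Fin 5) k)) : Submodule k (MvPolynomial (Fin 5) k) :=
  I.restrictScalars k ⊓ homogeneousSubmodule (Fin 5) k 2

/-- The kernel of `φ` is the space of values of linear forms, so `f` takes the same value as some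
multiple of `l`. -/
theorem mem_span_quadrics_sup (hM : IsFrobeniusModel I φ v) {l : MvPolynomial (Fin 5) k}
    (hl : l.IsHomogeneous 1) (hl1 : aeval v l = 1) {f : MvPolynomial (Fin 5) k}
    (hf : f.IsHomogeneous 2) (h : φ (aeval v f) = 0) :
    f ∈ Ideal.span (quadrics I : Set _) ⊔ Ideal.span {l} := by
  obtain ⟨h, hh, e⟩ := hM.exists_linear h
  rw [← sub_add_cancel f (h * l)]
  refine Submodule.add_mem_sup (Ideal.subset_span ⟨?_, hf.sub (hh.mul hl)⟩)
    (Ideal.mul_mem_left _ _ (Ideal.mem_span_singleton_self _))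
  exact (hM.mem_iff _ 2 (hf.sub (hh.mul hl))).2 (by simp [hl1, e])

/-- Modulo the quadrics and `l`, a quadratic form depends only on its value under `φ`. Choose linear
forms x, orthogonal to X_i and not constant in B, and y with φ(xy) nonzero: every quadratic form is
a multiple of xy, and X_i x is zero, so all cubic forms vanish. -/
theorem mem_span_quadrics_sup_of_three_le (hM : IsFrobeniusModel I φ v)
    {l : MvPolynomial (Fin 5) k} (hl : l.IsHomogeneous 1) (hl1 : aeval v l = 1) (t : ℕ)
    {f : MvPolynomial (Fin 5) k} (hf : f.IsHomogeneous (t + 3)) :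
    f ∈ Ideal.span (quadrics I : Set _) ⊔ Ideal.span {l} := by
  set K := Ideal.span (quadrics I : Set _) ⊔ Ideal.span {l} with hK
  induction t generalizing f with
  | zero =>
    refine (Submodule.span_le (p := K.restrictScalars k)).2 ?_ (mem_span_X_mul hf)
    rintro _ ⟨i, f, hf, rfl⟩
    change X i * f ∈ K
    obtain ⟨c, hc, hci, hc1⟩ := hM.exists_orthogonal (v i)
    obtain ⟨d, hd, hcd⟩ := hM.exists_mul_ne_zero hc1
    obtain ⟨x, hx, rfl⟩ := hM.exists_linear hc
    obtain ⟨y, hy, rfl⟩ := hM.exists_linear hd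
    have h1 : f - C (φ (aeval v f) / φ (aeval v x * aeval v y)) * (x * y) ∈ K := by
      have hxy : (C (φ (aeval v f) / φ (aeval v x * aeval v y)) * (x * y)).IsHomogeneous 2 := by
        simpa using (isHomogeneous_C (Fin 5) _).mul (hx.mul hy)
      refine hM.mem_span_quadrics_sup hl hl1 (hf.sub hxy) ?_
      rw [map_sub, ← smul_eq_C_mul, map_smul, map_sub, map_smul, smul_eq_mul,
        map_mul (aeval v), div_mul_cancel₀ _ hcd, sub_self]
    have h2 : x * X i ∈ K := by
      refine hM.mem_span_quadrics_sup hl hl1 (hx.mul (isHomogeneous_X k i)) ?_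
      rw [map_mul, aeval_X]
      exact hci
    have := K.add_mem (K.mul_mem_left (X i) h1)
      (K.mul_mem_left (C (φ (aeval v f) / φ (aeval v x * aeval v y)) * y) h2)
    convert this using 1
    ring
  | succ t ih =>
    refine (Submodule.span_le (p := K.restrictScalars k)).2 ?_ (mem_span_X_mul hf)
    rintro _ ⟨i, f, hf, rfl⟩
    exact K.mul_mem_left _ (ih hf)

/-- The ideal is generated by quadrics. -/
theorem span_quadrics (hM : IsFrobeniusModel I φ v)
    (hI : ∀ f ∈ I, ∀ t : ℕ, homogeneousComponent t f ∈ I) :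
    Ideal.span (quadrics I : Set _) = I := by
  refine le_antisymm (Ideal.span_le.2 fun f hf => hf.1) fun f hf => ?_
  refine mem_of_forall_homogeneousComponent_mem fun t => ?_
  have key (t : ℕ) : ∀ f ∈ I, f.IsHomogeneous t → f ∈ Ideal.span (quadrics I : Set _) := by
    obtain ⟨l, hl, hl1⟩ := hM.exists_linear hM.map_one
    induction t with
    | zero =>
      intro f hf hft
      have h0 := (hM.mem_iff f 0 hft).1 hf
      rw [eq_C_of_isHomogeneous_zero hft, ← algebraMap_eq, AlgHom.commutes,
        Algebra.algebraMap_eq_smul_one] at h0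
      have h1 : (1 : B) ≠ 0 := fun h => by
        have := hM.finrank_eq
        have hs : Subsingleton B := subsingleton_of_zero_eq_one h.symm
        rw [Module.finrank_zero_of_subsingleton] at this
        norm_num at this
      rw [eq_C_of_isHomogeneous_zero hft, (smul_eq_zero_iff_left h1).1 h0, C_0]
      exact Ideal.zero_mem _
    | succ t ih =>
      intro f hf hft
      rcases t with _ | _ | t
      · have h0 := (hM.mem_iff f _ hft).1 hf
        suffices f = 0 by rw [this]; exact Ideal.zero_mem _
        have hlin : ∃ c : Fin 5 → k, f = ∑ i, C (c i) * X i := by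
          have := mem_span_X_mul (t := 0) hft
          have hsub : Submodule.span k {q : MvPolynomial (Fin 5) k |
              ∃ i, ∃ h : MvPolynomial (Fin 5) k, h.IsHomogeneous 0 ∧ q = X i * h} ≤
              Submodule.span k (Set.range (X : Fin 5 → MvPolynomial (Fin 5) k)) := by
            refine Submodule.span_le.2 ?_
            rintro _ ⟨j, h, hh, rfl⟩
            rw [eq_C_of_isHomogeneous_zero hh, mul_comm, ← smul_eq_C_mul]
            exact Submodule.smul_mem _ _ (Submodule.subset_span ⟨j, rfl⟩)
          obtain ⟨c, hc⟩ := (Submodule.mem_span_range_iff_exists_fun k).1 (hsub this)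
          exact ⟨c, by rw [← hc]; simp [smul_eq_C_mul]⟩
        obtain ⟨c, rfl⟩ := hlin
        have hc := Fintype.linearIndependent_iff.1 hM.linearIndependent c
          (by simpa [Algebra.smul_def] using h0)
        simp [hc]
      · exact Ideal.subset_span ⟨hf, hft⟩
      -- Modulo the quadrics `f` equals `l * a`. As `l` takes the value 1, the form `a` is again in
      -- `I`, of smaller degree.
      · obtain ⟨a, ha, hfa⟩ := exists_of_mem_sup_span
          (fun f hf t => homogeneousComponent_mem_span (d := 2) (fun f hf => hf.2) hf t) hl
          (hM.mem_span_quadrics_sup_of_three_le hl hl1 t hft) (t + 2)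
        rw [homogeneousComponent_eq_ite hft, if_pos rfl] at hfa
        have h1 : aeval v a = 0 := by
          have h2 : f - l * a ∈ I := Ideal.span_le.2 (fun f hf => hf.1) hfa
          have h3 := (hM.mem_iff _ (t + 2 + 1) (hft.sub (by
            have := hl.mul ha
            rwa [add_comm 1] at this))).1 h2
          rw [map_sub, (hM.mem_iff f _ hft).1 hf, map_mul, hl1, one_mul, zero_sub,
            neg_eq_zero] at h3
          exact h3
        have h4 := ih a ((hM.mem_iff a _ ha).2 h1) ha
        rw [← sub_add_cancel f (l * a)]
        exact Ideal.add_mem _ hfa (Ideal.mul_mem_left _ _ h4)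
  exact key t _ (hI f hf t) (homogeneousComponent_isHomogeneous _ _)

/-- Evaluation of quadratic forms, from a space of dimension at most 15, is onto B: its image
contains `ker φ` through the multiples of a form with value 1, and a product of two linear forms
outside `ker φ`. -/
theorem finrank_quadrics_le (hM : IsFrobeniusModel I φ v) :
    Module.finrank k (quadrics I) ≤ 9 := by
  have := hM.finite
  obtain ⟨hfin, h3⟩ := finite_and_finrank_homogeneousSubmodule_two_le (k := k)
  let f := (aeval v : MvPolynomial (Fin 5) k →ₐ[k] B).toLinearMap.domRestrict
    (homogeneousSubmodule (Fin 5) k 2)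
  obtain ⟨l, hl, hl1⟩ := hM.exists_linear hM.map_one
  have hV : LinearMap.ker φ ≤ LinearMap.range f := by
    intro b hb
    obtain ⟨h, hh, rfl⟩ := hM.exists_linear hb
    exact ⟨⟨h * l, hh.mul hl⟩, by simp [f, hl1]⟩
  have hker : Module.finrank k (LinearMap.ker φ) = 5 := by
    rw [← hM.span_eq, finrank_span_eq_card hM.linearIndependent]; rfl
  have hlt : LinearMap.ker φ < LinearMap.range f := by
    refine lt_of_le_of_ne hV fun h => ?_
    obtain ⟨c, hc, -, hc1⟩ := hM.exists_orthogonal 0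
    obtain ⟨d, hd, hcd⟩ := hM.exists_mul_ne_zero hc1
    obtain ⟨x, hx, rfl⟩ := hM.exists_linear hc
    obtain ⟨y, hy, rfl⟩ := hM.exists_linear hd
    apply hcd
    rw [← LinearMap.mem_ker, h]
    exact ⟨⟨x * y, hx.mul hy⟩, by simp [f]⟩
  have h1 := Submodule.finrank_lt_finrank_of_lt hlt
  have h2 := f.finrank_range_add_finrank_ker
  have h4 : Module.finrank k (quadrics I) ≤ Module.finrank k (LinearMap.ker f) := by
    have hle : quadrics I ≤ (LinearMap.ker f).map (Submodule.subtype _) := by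
      rintro q ⟨hq, hq2⟩
      exact ⟨⟨q, hq2⟩, (hM.mem_iff q 2 hq2).1 hq, rfl⟩
    exact (Submodule.finrank_mono hle).trans (Submodule.finrank_map_le _ _)
  omega

end IsFrobeniusModel
end Reduction

/-! ### Krull dimension of cones -/

section Dimension

variable {k : Type u} [Field k]

theorem ringKrullDim_le_of_isIntegral {A R : Type*} [CommRing A] [CommRing R] [Algebra A R]
    [Algebra.IsIntegral A R] : ringKrullDim R ≤ ringKrullDim A :=
  Order.krullDim_le_of_strictMono (PrimeSpectrum.comap (algebraMap A R)) fun _ _ h =>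
    Ideal.IsIntegral.comap_lt_comap (A := R) (R := A) h

theorem mem_irrelevantIdeal_pow {n t : ℕ} {f : MvPolynomial (Fin (n + 1)) k}
    (hf : f.IsHomogeneous t) : f ∈ irrelevantIdeal k n ^ t := by
  induction t generalizing f with
  | zero => simp
  | succ t ih =>
    refine (Submodule.span_le (p := (irrelevantIdeal k n ^ (t + 1)).restrictScalars k)).2 ?_
      (mem_span_X_mul hf)
    rintro _ ⟨i, h, hh, rfl⟩
    rw [pow_succ']
    exact Ideal.mul_mem_mul (Ideal.subset_span ⟨i, rfl⟩) (ih hh)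

/-- The hypothesis makes R a module over k[l_0, l_1] generated by the forms of degree at most M,
hence finite over a polynomial ring in two variables. -/
theorem ringKrullDim_le_two_of_forall_eq {R : Type u} [CommRing R] [Algebra k R] {n M : ℕ}
    (q : MvPolynomial (Fin (n + 1)) k →ₐ[k] R) (hq : Function.Surjective q) (l : Fin 2 → R)
    (h : ∀ t, M ≤ t → ∀ f : MvPolynomial (Fin (n + 1)) k, f.IsHomogeneous (t + 1) →
      ∃ a : Fin 2 → MvPolynomial (Fin (n + 1)) k, (∀ i, (a i).IsHomogeneous t) ∧
        q f = ∑ i, l i * q (a i)) :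
    ringKrullDim R ≤ 2 := by
  classical
  let ψ : MvPolynomial (Fin 2) k →ₐ[k] R := aeval l
  let _ : Algebra (MvPolynomial (Fin 2) k) R := ψ.toRingHom.toAlgebra
  have hsmul (a : MvPolynomial (Fin 2) k) (b : R) : a • b = ψ a * b := rfl
  have : IsScalarTower k (MvPolynomial (Fin 2) k) R := ⟨fun a b c => by
    rw [hsmul, hsmul, map_smul, smul_mul_assoc]⟩
  let N : Submodule (MvPolynomial (Fin 2) k) R := Submodule.span _
    (⋃ t ∈ Set.Iic M, q '' (homogeneousSubmodule (Fin (n + 1)) k t : Set _))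
  have hN (t : ℕ) : ∀ f : MvPolynomial (Fin (n + 1)) k, f.IsHomogeneous t → q f ∈ N := by
    induction t with
    | zero =>
      intro f hf
      exact Submodule.subset_span (Set.mem_biUnion (Nat.zero_le M) ⟨f, hf, rfl⟩)
    | succ t ih =>
      intro f hf
      by_cases htM : t + 1 ≤ M
      · exact Submodule.subset_span (Set.mem_biUnion (x := t + 1) htM ⟨f, hf, rfl⟩)
      · obtain ⟨a, ha, e⟩ := h t (by omega) f hf
        rw [e]
        refine N.sum_mem fun i _ => ?_
        have : l i * q (a i) = (X i : MvPolynomial (Fin 2) k) • q (a i) := by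
          rw [hsmul, aeval_X]
        rw [this]
        exact N.smul_mem _ (ih _ (ha i))
  have hNtop : N = ⊤ := by
    rw [eq_top_iff]
    rintro b -
    obtain ⟨f, rfl⟩ := hq b
    rw [← sum_homogeneousComponent f, map_sum]
    exact N.sum_mem fun i _ => hN i _ (homogeneousComponent_isHomogeneous _ _)
  have hfin : Module.Finite (MvPolynomial (Fin 2) k) R := by
    refine ⟨?_⟩
    have hfg (t : ℕ) : ((homogeneousSubmodule (Fin (n + 1)) k t).map q.toLinearMap).FG :=
      (homogeneousSubmodule_fg _ _ t).map _
    choose s hs using hfg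
    rw [← hNtop]
    refine ⟨(Finset.range (M + 1)).biUnion s, le_antisymm (Submodule.span_le.2 ?_)
      (Submodule.span_le.2 ?_)⟩
    · intro x hx
      obtain ⟨t, ht, hx⟩ := Finset.mem_biUnion.1 (Finset.mem_coe.1 hx)
      refine Submodule.subset_span (Set.mem_biUnion (x := t) ?_ ?_)
      · exact Nat.lt_succ_iff.1 (Finset.mem_range.1 ht)
      · have : x ∈ (homogeneousSubmodule (Fin (n + 1)) k t).map q.toLinearMap := by
          rw [← hs t]; exact Submodule.subset_span hx
        exact this
    · intro x hx
      simp only [Set.mem_iUnion] at hx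
      obtain ⟨t, ht, hx⟩ := hx
      have hx' : x ∈ (homogeneousSubmodule (Fin (n + 1)) k t).map q.toLinearMap := hx
      rw [← hs t] at hx'
      refine Submodule.span_le_restrictScalars k (MvPolynomial (Fin 2) k) _
        (Submodule.span_mono ?_ hx')
      exact fun y hy => Finset.mem_biUnion.2 ⟨t, Finset.mem_range.2 (Nat.lt_succ_iff.2 ht), hy⟩
  have hint : Algebra.IsIntegral (MvPolynomial (Fin 2) k) R := Algebra.IsIntegral.of_finite _ _
  refine (ringKrullDim_le_of_isIntegral (A := MvPolynomial (Fin 2) k)).trans ?_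
  rw [MvPolynomial.ringKrullDim_of_isNoetherianRing, ringKrullDim_eq_zero_of_field]
  simp

/-- A quotient of a polynomial ring by a homogeneous ideal has dimension at most two if two linear
forms cut the cone out at the origin. -/
theorem ringKrullDim_quotient_le_two {n : ℕ} {s : Set (MvPolynomial (Fin (n + 1)) k)}
    {d : ℕ} (hs : ∀ f ∈ s, f.IsHomogeneous d) {l : Fin 2 → MvPolynomial (Fin (n + 1)) k}
    (hl : ∀ i, (l i).IsHomogeneous 1)
    (h : ∀ P : Ideal (MvPolynomial (Fin (n + 1)) k), P.IsPrime → s ⊆ P →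
      (∀ i, l i ∈ P) → ∀ i, X i ∈ P) :
    ringKrullDim (MvPolynomial (Fin (n + 1)) k ⧸ Ideal.span s) ≤ 2 := by
  set J := Ideal.span s with hJ
  set K := J ⊔ Ideal.span (Set.range l) with hK
  have hrad : irrelevantIdeal k n ≤ K.radical := by
    refine Ideal.span_le.2 ?_
    rintro _ ⟨i, rfl⟩
    rw [SetLike.mem_coe, Ideal.radical_eq_sInf, Ideal.mem_sInf]
    rintro P ⟨hP, hPp⟩
    exact h P hPp (Ideal.subset_span.trans ((le_sup_left : J ≤ K).trans hP))
      (fun i => hP (Ideal.mem_sup_right (Ideal.subset_span ⟨i, rfl⟩))) i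
  obtain ⟨M, hM⟩ := Ideal.exists_pow_le_of_le_radical_of_fg hrad
    (IsNoetherian.noetherian (irrelevantIdeal k n))
  refine ringKrullDim_le_two_of_forall_eq (M := M) (Ideal.Quotient.mkₐ k J)
    Ideal.Quotient.mk_surjective (fun i => Ideal.Quotient.mkₐ k J (l i)) fun t ht f hf => ?_
  have hfK : f ∈ K :=
    hM (Ideal.pow_le_pow_right (ht.trans (Nat.le_succ t)) (mem_irrelevantIdeal_pow hf))
  obtain ⟨j, hj, b, hb, e⟩ := Submodule.mem_sup.1 hfK
  obtain ⟨b, rfl⟩ := Ideal.mem_span_range_iff_exists_fun.1 hb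
  refine ⟨fun i => homogeneousComponent t (b i),
    fun i => homogeneousComponent_isHomogeneous _ _, ?_⟩
  have h1 := homogeneousComponent_mem_span hs hj (t + 1)
  have h2 : homogeneousComponent (t + 1) f = f := by
    rw [homogeneousComponent_eq_ite hf, if_pos rfl]
  rw [← e, map_add, map_sum, e] at h2
  rw [← h2, map_add, Ideal.Quotient.mkₐ_eq_mk, Ideal.Quotient.eq_zero_iff_mem.2 h1, zero_add,
    map_sum]
  refine Finset.sum_congr rfl fun i _ => ?_
  rw [homogeneousComponent_mul_of_isHomogeneous (hl i), if_pos (Nat.le_add_left _ _),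
    Nat.add_sub_cancel, map_mul, mul_comm]

theorem two_le_ringKrullDim_quotient {R : Type*} [CommRing R] {J P₀ P₁ P₂ : Ideal R}
    (h0 : P₀.IsPrime) (h1 : P₁.IsPrime) (h2 : P₂.IsPrime) (hJ : J ≤ P₀) (h01 : P₀ < P₁)
    (h12 : P₁ < P₂) : 2 ≤ ringKrullDim (R ⧸ J) := by
  rw [ringKrullDim_quotient]
  let p : LTSeries (PrimeSpectrum.zeroLocus (R := R) J) :=
    { length := 2
      toFun := ![⟨⟨P₀, h0⟩, hJ⟩, ⟨⟨P₁, h1⟩, hJ.trans h01.le⟩, ⟨⟨P₂, h2⟩, hJ.trans (h01.trans h12).le⟩]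
      step := by
        intro i
        fin_cases i
        · exact h01
        · exact h12 }
  exact Order.LTSeries.length_le_krullDim p

theorem two_le_ringKrullDim_quotient_of_surjective {n : ℕ} {s : Set (MvPolynomial (Fin n) k)}
    (y : Fin n → MvPolynomial (Fin 2) k) (hs : ∀ f ∈ s, aeval y f = 0)
    (hy : ∀ i, ∃ j, y j = X i) : 2 ≤ ringKrullDim (MvPolynomial (Fin n) k ⧸ Ideal.span s) := by
  have hle : ∀ f ∈ Ideal.span s, (aeval y : _ →ₐ[k] MvPolynomial (Fin 2) k).toRingHom f = 0 := by
    intro f hf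
    exact (Ideal.span_le (I := RingHom.ker (aeval y : _ →ₐ[k] MvPolynomial (Fin 2) k))).2 hs hf
  have := ringKrullDim_le_of_surjective (Ideal.Quotient.lift _ _ hle)
    (Ideal.Quotient.lift_surjective_of_surjective _ _ fun f => by
      have : (aeval y : MvPolynomial (Fin n) k →ₐ[k] MvPolynomial (Fin 2) k).range = ⊤ := by
        rw [eq_top_iff, ← adjoin_range_X, Algebra.adjoin_le_iff]
        rintro _ ⟨i, rfl⟩
        obtain ⟨j, hj⟩ := hy i
        exact ⟨X j, by simpa using hj⟩
      exact (this.symm ▸ Algebra.mem_top : f ∈ (aeval y : MvPolynomial (Fin n) k →ₐ[k] _).range))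
  refine le_trans (le_of_eq ?_) this
  rw [MvPolynomial.ringKrullDim_of_isNoetherianRing, ringKrullDim_eq_zero_of_field]
  simp

end Dimension

/-! ### Tom matrices with explicit coefficients, and the nine equations -/

section TomMatrix

variable {k : Type u} [Field k]

/-- The linear form in `x_0, …, x_4` with coefficients `e`. -/
noncomputable def lin (e : Fin 5 → k) : MvPolynomial (Fin 5) k := ∑ m, C (e m) * X m

theorem coeff_lin (e : Fin 5 → k) (m : Fin 5) : coeff (Finsupp.single m 1) (lin e) = e m :=
  coeff_single_sum_C_mul_X e m

theorem lin_isHomogeneous (e : Fin 5 → k) : (lin e).IsHomogeneous 1 :=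
  isHomogeneous_sum_C_mul_X e

/-- The skew-symmetric matrix of linear forms with entries `b` in the row of index `0` and entries
`d` (in the order `12, 13, 14, 23, 24, 34`) above the diagonal elsewhere. -/
noncomputable def tomMatrix (b : Fin 4 → Fin 5 → k) (d : Fin 6 → Fin 5 → k) :
    Matrix (Fin 5) (Fin 5) (MvPolynomial (Fin 5) k) :=
  !![0, lin (b 0), lin (b 1), lin (b 2), lin (b 3);
    -lin (b 0), 0, lin (d 0), lin (d 1), lin (d 2);
    -lin (b 1), -lin (d 0), 0, lin (d 3), lin (d 4);
    -lin (b 2), -lin (d 1), -lin (d 3), 0, lin (d 5);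
    -lin (b 3), -lin (d 2), -lin (d 4), -lin (d 5), 0]

/-- The pfaffians of the matrix with rows `b` and `d`, for entries in any ring. -/
def pfaffians {R : Type*} [CommRing R] (b : Fin 4 → R) (d : Fin 6 → R) : Fin 5 → R :=
  ![d 0 * d 5 - d 1 * d 4 + d 2 * d 3, b 1 * d 5 - b 2 * d 4 + b 3 * d 3,
    b 0 * d 5 - b 2 * d 2 + b 3 * d 1, b 0 * d 4 - b 1 * d 2 + b 3 * d 0,
    b 0 * d 3 - b 1 * d 1 + b 2 * d 0]

theorem subPf_tomMatrix (b : Fin 4 → Fin 5 → k) (d : Fin 6 → Fin 5 → k) :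
    subPf (tomMatrix b d) = pfaffians (fun i => lin (b i)) (fun i => lin (d i)) := by
  funext i
  fin_cases i <;> rfl

theorem tomQ_tomMatrix (b : Fin 4 → Fin 5 → k) (d : Fin 6 → Fin 5 → k) (m j : Fin 4) :
    tomQ (tomMatrix b d) m j =
      pfaffians (fun i => lin (b i)) (fun i => C (d i m.succ)) j.succ := by
  simp only [← coeff_lin (d _) m.succ]
  fin_cases j <;> rfl

theorem lin_mem_supported {e : Fin 5 → k} (he : e 0 = 0) :
    lin e ∈ supported k {v : Fin 5 | v ≠ 0} := by
  refine Subalgebra.sum_mem _ fun m _ => ?_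
  by_cases hm : m = 0
  · subst hm; rw [he, C_0, zero_mul]; exact Subalgebra.zero_mem _
  · exact Subalgebra.mul_mem _ (Subalgebra.algebraMap_mem _ (e m))
      (X_mem_supported.2 hm)

set_option maxHeartbeats 1000000 in
theorem isTomMatrix_tomMatrix {b : Fin 4 → Fin 5 → k} {d : Fin 6 → Fin 5 → k}
    (hd : ∀ i, d i 0 = 0)
    (hcurve : ringKrullDim (MvPolynomial (Fin 5) k ⧸ pfaffianIdeal (tomMatrix b d)) = 2) :
    IsTomMatrix (tomMatrix b d) where
  diag i := by fin_cases i <;> rfl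
  skew i j := by fin_cases i <;> fin_cases j <;> simp [tomMatrix]
  linear i j := by
    have h2 := fun e => (lin_isHomogeneous (k := k) e).neg
    fin_cases i <;> fin_cases j <;>
      simp [tomMatrix, isHomogeneous_zero, lin_isHomogeneous, h2]
  tom i j := by
    have h1 := fun i => lin_mem_supported (hd i)
    fin_cases i <;> fin_cases j <;> simp [tomMatrix] <;> apply h1
  curve := hcurve

theorem subPf_isHomogeneous (b : Fin 4 → Fin 5 → k) (d : Fin 6 → Fin 5 → k) (i : Fin 5) :
    (subPf (tomMatrix b d) i).IsHomogeneous 2 := by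
  have h (e e' : Fin 5 → k) : (lin e * lin e').IsHomogeneous 2 :=
    (lin_isHomogeneous e).mul (lin_isHomogeneous e')
  rw [subPf_tomMatrix]
  fin_cases i <;> exact ((h _ _).sub (h _ _)).add (h _ _)

/-- The value at the point `x` of the linear form with coefficients `e`. -/
def evalLin {E : Type*} [CommRing E] [Algebra k E] (x : Fin 5 → E) (e : Fin 5 → k) : E :=
  e 0 • x 0 + e 1 • x 1 + e 2 • x 2 + e 3 • x 3 + e 4 • x 4

theorem aeval_lin {E : Type*} [CommRing E] [Algebra k E] (x : Fin 5 → E) (e : Fin 5 → k) :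
    aeval x (lin e) = evalLin x e := by
  simp [lin, evalLin, Fin.sum_univ_five, Algebra.smul_def]

theorem aeval_subPf {E : Type*} [CommRing E] [Algebra k E] (x : Fin 5 → E)
    (b : Fin 4 → Fin 5 → k) (d : Fin 6 → Fin 5 → k) (i : Fin 5) :
    aeval x (subPf (tomMatrix b d) i) =
      pfaffians (fun i => evalLin x (b i)) (fun i => evalLin x (d i)) i := by
  rw [subPf_tomMatrix]
  simp only [← aeval_lin]
  fin_cases i <;> simp [pfaffians]

/-- The nine equations of the unprojection. -/
noncomputable def equations (b : Fin 4 → Fin 5 → k) (d : Fin 6 → Fin 5 → k)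
    (g : Fin 4 → MvPolynomial (Fin 5) k) : Fin 5 ⊕ Fin 4 → MvPolynomial (Fin 6) k :=
  Sum.elim (fun i => rename Fin.castSucc (subPf (tomMatrix b d) i))
    (fun i => X i.succ.castSucc * X (Fin.last 5) - rename Fin.castSucc (g i))

theorem unprojectionIdeal_eq (b : Fin 4 → Fin 5 → k) (d : Fin 6 → Fin 5 → k)
    (g : Fin 4 → MvPolynomial (Fin 5) k) :
    unprojectionIdeal (tomMatrix b d) g = Ideal.span (Set.range (equations b d g)) := by
  rw [unprojectionIdeal, equations, pfaffianIdeal, Ideal.map_span, ← Set.range_comp,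
    Set.Sum.elim_range, Ideal.span_union]
  rfl

theorem equations_isHomogeneous (b : Fin 4 → Fin 5 → k) (d : Fin 6 → Fin 5 → k)
    {g : Fin 4 → MvPolynomial (Fin 5) k} (hg : ∀ i, (g i).IsHomogeneous 2) (j) :
    (equations b d g j).IsHomogeneous 2 := by
  rcases j with i | i
  · exact (subPf_isHomogeneous b d i).rename_isHomogeneous
  · exact ((isHomogeneous_X k _).mul (isHomogeneous_X k _)).sub (hg i).rename_isHomogeneous

/-- The values at the point `x` of the nine equations of the unprojection. -/
noncomputable def equationValues {E : Type*} [CommRing E] [Algebra k E] (b : Fin 4 → Fin 5 → k)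
    (d : Fin 6 → Fin 5 → k) (g : Fin 4 → MvPolynomial (Fin 5) k) (x : Fin 6 → E) :
    Fin 5 ⊕ Fin 4 → E :=
  Sum.elim (pfaffians (fun i => evalLin (x ∘ Fin.castSucc) (b i))
      (fun i => evalLin (x ∘ Fin.castSucc) (d i)))
    (fun i => x i.succ.castSucc * x (Fin.last 5) - aeval (x ∘ Fin.castSucc) (g i))

theorem aeval_equations {E : Type*} [CommRing E] [Algebra k E] (b : Fin 4 → Fin 5 → k)
    (d : Fin 6 → Fin 5 → k) (g : Fin 4 → MvPolynomial (Fin 5) k) (x : Fin 6 → E) (j) :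
    aeval x (equations b d g j) = equationValues b d g x j := by
  rcases j with i | i
  · rw [equations, Sum.elim_inl, aeval_rename, aeval_subPf]; rfl
  · rw [equations, Sum.elim_inr, map_sub, map_mul, aeval_X, aeval_X, aeval_rename]; rfl

/-- A linear form lies in no minimal prime of an ideal if each point of the zero locus of the ideal
lies on a parametrized surface in the zero locus on which the form does not vanish. -/
theorem notMem_of_mem_minimalPrimes {n : ℕ} {s : Set (MvPolynomial (Fin n) k)}
    {l : MvPolynomial (Fin n) k}
    (h : ∀ (Ω : Type u) [Field Ω] [Algebra k Ω] [IsAlgClosed Ω] (x : Fin n → Ω),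
      (∀ f ∈ s, aeval x f = 0) → ∃ (y : Fin n → MvPolynomial (Fin 2) k) (p : Fin 2 → Ω),
        (∀ f ∈ s, aeval y f = 0) ∧ aeval y l ≠ 0 ∧ ∀ i, aeval p (y i) = x i)
    {P : Ideal (MvPolynomial (Fin n) k)} (hP : P ∈ (Ideal.span s).minimalPrimes) : l ∉ P := by
  have hPp : P.IsPrime := hP.1.1
  let D := MvPolynomial (Fin n) k ⧸ P
  -- The surface hypothesis is applied to the generic point of the component, over an algebraically
  -- closed field so that parameters may require roots.
  let Ω := AlgebraicClosure (FractionRing D)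
  let θ : MvPolynomial (Fin n) k →ₐ[k] Ω :=
    (IsScalarTower.toAlgHom k D Ω).comp (Ideal.Quotient.mkₐ k P)
  have hθ (f : MvPolynomial (Fin n) k) : θ f = 0 ↔ f ∈ P := by
    have hinj : Function.Injective (algebraMap D Ω) := by
      rw [IsScalarTower.algebraMap_eq D (FractionRing D) Ω]
      exact (algebraMap (FractionRing D) Ω).injective.comp (IsFractionRing.injective D _)
    change algebraMap D Ω (Ideal.Quotient.mk P f) = 0 ↔ _
    rw [map_eq_zero_iff _ hinj, Ideal.Quotient.eq_zero_iff_mem]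
  have hx : aeval (fun i => θ (X i)) = θ := by ext i; simp
  obtain ⟨y, p, hy, hyl, hpy⟩ := h Ω (fun i => θ (X i)) fun f hf => by
    rw [hx, hθ]; exact hP.1.2 (Ideal.subset_span hf)
  let ψ : MvPolynomial (Fin n) k →ₐ[k] MvPolynomial (Fin 2) k := aeval y
  have hcomp : (aeval p).comp ψ = θ := by
    ext i
    simpa [ψ] using hpy i
  -- The ideal of the surface is a prime containing `s` and contained in `P`, so it is `P` by
  -- minimality.
  have hker : RingHom.ker ψ ≤ P := by
    intro f hf
    rw [← hθ, ← hcomp, AlgHom.comp_apply, RingHom.mem_ker.1 hf, map_zero]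
  have := hP.2 ⟨RingHom.ker_isPrime ψ.toRingHom, (Ideal.span_le (I := RingHom.ker ψ)).2 hy⟩ hker
  exact fun hl => hyl (this hl)

end TomMatrix

/-! ### From a solution in the Frobenius algebra to a hyperplane section -/

section Construction

variable {k : Type u} [Field k]

/-- A left kernel contained in the line of `c` gives rank at least 5, which is the dimension of the
hyperplane. -/
theorem range_mulVecLin_eq_ker {T : Matrix (Fin 6) (Fin 5) k} {c : Fin 6 → k}
    (hc : c ≠ 0) (hcT : Matrix.vecMul c T = 0)
    (hT : ∀ p : Fin 6 → k, Matrix.vecMul p T = 0 → p ∈ Submodule.span k {c}) :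
    LinearMap.range T.mulVecLin = LinearMap.ker (Fintype.linearCombination k c) := by
  have hle : LinearMap.range T.mulVecLin ≤ LinearMap.ker (Fintype.linearCombination k c) := by
    rintro _ ⟨w, rfl⟩
    rw [LinearMap.mem_ker, Fintype.linearCombination_apply]
    have : Matrix.vecMul c T ⬝ᵥ w = 0 := by rw [hcT, zero_dotProduct]
    rw [← Matrix.dotProduct_mulVec] at this
    simpa [dotProduct, mul_comm] using this
  refine Submodule.eq_of_le_of_finrank_le hle ?_
  have h1 := (Matrix.transpose T).mulVecLin.finrank_range_add_finrank_ker
  have h2 : LinearMap.ker (Matrix.transpose T).mulVecLin ≤ Submodule.span k {c} := by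
    intro p hp
    refine hT p ?_
    rw [← Matrix.mulVec_transpose]
    exact hp
  have h3 := Submodule.finrank_mono h2
  have h4 : Module.finrank k (Submodule.span k {c}) ≤ 1 := by
    simpa using finrank_span_le_card (R := k) ({c} : Set (Fin 6 → k))
  have h5 : Module.finrank k (LinearMap.range (Matrix.transpose T).mulVecLin) =
      Module.finrank k (LinearMap.range T.mulVecLin) := Matrix.rank_transpose T
  have h6 := (Fintype.linearCombination k c).finrank_range_add_finrank_ker
  have h7 : 0 < Module.finrank k (LinearMap.range (Fintype.linearCombination k c)) := by
    obtain ⟨i, hi⟩ := Function.ne_iff.1 hc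
    rw [Module.finrank_pos_iff_exists_ne_zero]
    refine ⟨⟨c i, Pi.single i 1, ?_⟩, ?_⟩
    · simp [Fintype.linearCombination_apply, Pi.single_apply]
    · exact fun h => hi (congrArg Subtype.val h)
  rw [Module.finrank_fin_fun] at h1 h6
  omega

theorem aeval_mul_of_isHomogeneous {σ E : Type*} [CommRing E] [Algebra k E] {n : ℕ}
    {f : MvPolynomial σ k} (hf : f.IsHomogeneous n) (r : E) (x : σ → E) :
    aeval (fun i => r * x i) f = r ^ n * aeval x f := by
  induction n generalizing f with
  | zero =>
    rw [eq_C_of_isHomogeneous_zero hf]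
    simp
  | succ n ih =>
    refine Submodule.span_induction ?_ (by simp) ?_ ?_ (mem_span_X_mul hf)
    · rintro _ ⟨i, h, hh, rfl⟩
      rw [map_mul, map_mul, ih hh, aeval_X, aeval_X]
      ring
    · intro x y _ _ hx hy
      rw [map_add, map_add, hx, hy, mul_add]
    · intro a x _ hx
      rw [map_smul, map_smul, hx, mul_smul_comm]

/-- If the nine equations of an unprojection vanish at a point `β` with values in the Frobenius
algebra, spanning up to a unit the kernel of the Frobenius form, then the unprojection cuts out on
the hyperplane of relations of `β` the scheme with ideal `I`. -/
theorem IsFrobeniusModel.isAngloHellenic {I : Ideal (MvPolynomial (Fin 5) k)}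
    (hI : IsHilbAGZero 4 6 I) {B : Type u} [CommRing B] [Algebra k B] {φ : B →ₗ[k] k}
    {v : Fin 5 → B} (hM : IsFrobeniusModel I φ v)
    {b : Fin 4 → Fin 5 → k} {d : Fin 6 → Fin 5 → k} {g : Fin 4 → MvPolynomial (Fin 5) k}
    (hd : ∀ i, d i 0 = 0)
    (hcurve : ringKrullDim (MvPolynomial (Fin 5) k ⧸ pfaffianIdeal (tomMatrix b d)) = 2)
    (hg : ∀ i, (g i).IsHomogeneous 2) (hQ : IsTomNumerator (tomMatrix b d) g)
    {c : Fin 6 → k} (hc : c ≠ 0)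
    (hmin : ∀ P ∈ (Ideal.span (Set.range (equations b d g))).minimalPrimes, linearForm c ∉ P)
    (hind : ∀ μ : Fin 5 ⊕ Fin 4 → k,
      (∀ p : Fin 6 → k, ∑ i, c i * p i = 0 → ∑ j, μ j * equationValues b d g p j = 0) → μ = 0)
    {β : Fin 6 → B} {r : B} (hr : IsUnit r) (hβφ : ∀ i, φ (r * β i) = 0)
    (hβ : ∀ j, equationValues b d g β j = 0) (hcβ : ∑ i, c i • β i = 0)
    (hβc : ∀ p : Fin 6 → k, ∑ i, p i • β i = 0 → ∃ a : k, p = a • c) : IsAngloHellenic I := by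
  have hmem (i : Fin 6) : ∃ t : Fin 5 → k, ∑ j, t j • v j = r * β i := by
    have : r * β i ∈ Submodule.span k (Set.range v) := by rw [hM.span_eq]; exact hβφ i
    exact (Submodule.mem_span_range_iff_exists_fun k).1 this
  -- The rows of `T` are the coordinates of `r * β i` in the basis `v`, so that evaluating at `v`
  -- after restriction along `T` is evaluating at `r * β`.
  choose T hT using hmem
  have hvec (p : Fin 6 → k) : ∑ j, Matrix.vecMul p (Matrix.of T) j • v j = r * ∑ i, p i • β i := by
    simp only [Matrix.vecMul, dotProduct, Matrix.of_apply, Finset.sum_smul]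
    rw [Finset.sum_comm, Finset.mul_sum]
    refine Finset.sum_congr rfl fun i _ => ?_
    rw [mul_smul_comm, ← hT, Finset.smul_sum]
    simp [mul_smul]
  have hvec0 (p : Fin 6 → k) : Matrix.vecMul p (Matrix.of T) = 0 ↔ ∑ i, p i • β i = 0 := by
    constructor
    · intro h
      have := hvec p
      rw [h] at this
      simpa [hr.mul_right_eq_zero] using this.symm
    · intro h
      have := hvec p
      rw [h, mul_zero] at this
      funext j
      exact Fintype.linearIndependent_iff.1 hM.linearIndependent _ this j
  have hrange := range_mulVecLin_eq_ker (T := Matrix.of T) hc ((hvec0 c).2 hcβ) fun p hp => by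
    obtain ⟨a, rfl⟩ := hβc p ((hvec0 p).1 hp)
    exact Submodule.smul_mem _ _ (Submodule.mem_span_singleton_self _)
  have hT' (p : Fin 6 → k) :
      (∃ w : Fin 5 → k, (Matrix.of T).mulVec w = p) ↔ ∑ i, c i * p i = 0 := by
    have : p ∈ LinearMap.range (Matrix.of T).mulVecLin ↔
        p ∈ LinearMap.ker (Fintype.linearCombination k c) := by rw [hrange]
    rw [LinearMap.mem_ker, Fintype.linearCombination_apply] at this
    simpa [mul_comm] using this
  refine ⟨tomMatrix b d, g, c, Matrix.of T, isTomMatrix_tomMatrix hd hcurve, hQ, hc, ?_, hT', ?_⟩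
  · rw [unprojectionIdeal_eq]; exact hmin
  let q : Fin 5 ⊕ Fin 4 → MvPolynomial (Fin 5) k :=
    fun j => restrictAlong (Matrix.of T) (equations b d g j)
  have hq2 (j) : (q j).IsHomogeneous 2 := by
    have := (equations_isHomogeneous b d hg j).aeval
      (fun i => (∑ j, C (Matrix.of T i j) * X j : MvPolynomial (Fin 5) k))
      (fun i => isHomogeneous_sum_C_mul_X _)
    exact this
  have hqI (j) : q j ∈ I := by
    rw [hM.mem_iff _ 2 (hq2 j)]
    have h1 : aeval v (q j) = aeval (fun i => r * β i) (equations b d g j) := by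
      change aeval v (aeval _ _) = _
      rw [← AlgHom.comp_apply, comp_aeval]
      congr 2
      funext i
      rw [← hT]
      simp [Algebra.smul_def]
    -- The unit `r` only contributes a factor `r ^ 2`.
    rw [h1, aeval_mul_of_isHomogeneous (equations_isHomogeneous b d hg j), aeval_equations, hβ,
      mul_zero]
  have hqind : LinearIndependent k q := by
    rw [Fintype.linearIndependent_iff]
    intro μ hμ j
    refine congrFun (hind μ fun p hp => ?_) j
    obtain ⟨w, rfl⟩ := (hT' p).2 hp
    have h1 := congrArg (aeval w) hμ
    rw [map_zero, map_sum] at h1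
    rw [← h1]
    refine Finset.sum_congr rfl fun j _ => ?_
    rw [map_smul, smul_eq_mul, ← aeval_equations]
    congr 1
    change _ = aeval w (aeval _ _)
    rw [← AlgHom.comp_apply (aeval w), comp_aeval]
    congr 2
    funext i
    simp [Matrix.mulVec, dotProduct]
  -- Nine independent elements in a space of dimension at most nine.
  have hspan : Submodule.span k (Set.range q) = quadrics I := by
    have : Module.Finite k (quadrics I) :=
      have := (finite_and_finrank_homogeneousSubmodule_two_le (k := k)).1
      Submodule.finiteDimensional_of_le (inf_le_right : quadrics I ≤ _)
    refine Submodule.eq_of_le_of_finrank_le (Submodule.span_le.2 ?_) ?_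
    · rintro _ ⟨j, rfl⟩
      exact ⟨hqI j, hq2 j⟩
    · rw [finrank_span_eq_card hqind]
      exact hM.finrank_quadrics_le
  have hmap : (unprojectionIdeal (tomMatrix b d) g).map (restrictAlong (Matrix.of T)) = I := by
    rw [unprojectionIdeal_eq, Ideal.map_span, ← Set.range_comp, ← hM.span_quadrics hI.homogeneous,
      ← hspan]
    refine le_antisymm (Ideal.span_mono Submodule.subset_span) ?_
    rw [Ideal.span_le]
    exact Submodule.span_le_restrictScalars k (MvPolynomial (Fin 5) k) _
  rw [hmap, hI.saturated]

end Construction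

/-! ### Reduction to a choice of matrix, hyperplane and point of the algebra -/

section Master

variable {k : Type u} [Field k]

theorem ringKrullDim_tomMatrix_le {b : Fin 4 → Fin 5 → k} {d : Fin 6 → Fin 5 → k}
    (l : Fin 2 → Fin 5 → k)
    (h : ∀ (D : Type u) [CommRing D] [IsDomain D] [Algebra k D] (x : Fin 5 → D),
      (∀ i, pfaffians (fun i => evalLin x (b i)) (fun i => evalLin x (d i)) i = 0) →
        evalLin x (l 0) = 0 → evalLin x (l 1) = 0 → ∀ i, x i = 0) :
    ringKrullDim (MvPolynomial (Fin 5) k ⧸ pfaffianIdeal (tomMatrix b d)) ≤ 2 := by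
  refine ringKrullDim_quotient_le_two (d := 2) (l := fun i => lin (l i)) ?_
    (fun i => lin_isHomogeneous _) fun P hP hs hl i => ?_
  · rintro _ ⟨i, rfl⟩
    exact subPf_isHomogeneous b d i
  have hq (f : MvPolynomial (Fin 5) k) :
      aeval (fun i => Ideal.Quotient.mkₐ k P (X i)) f = Ideal.Quotient.mk P f := by
    have : aeval (fun i => Ideal.Quotient.mkₐ k P (X i)) = Ideal.Quotient.mkₐ k P := by
      ext i; simp
    rw [this]; rfl
  rw [← Ideal.Quotient.eq_zero_iff_mem]
  refine h (MvPolynomial (Fin 5) k ⧸ P) (fun i => Ideal.Quotient.mkₐ k P (X i))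
    (fun i => ?_) ?_ ?_ i
  · rw [← aeval_subPf, hq, Ideal.Quotient.eq_zero_iff_mem]
    exact hs ⟨i, rfl⟩
  · rw [← aeval_lin, hq, Ideal.Quotient.eq_zero_iff_mem]
    exact hl 0
  · rw [← aeval_lin, hq, Ideal.Quotient.eq_zero_iff_mem]
    exact hl 1

theorem two_le_ringKrullDim_tomMatrix {b : Fin 4 → Fin 5 → k} {d : Fin 6 → Fin 5 → k}
    (y : Fin 5 → MvPolynomial (Fin 2) k)
    (h : ∀ i, pfaffians (fun i => evalLin y (b i)) (fun i => evalLin y (d i)) i = 0)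
    (hy : ∀ i, ∃ j, y j = X i) :
    2 ≤ ringKrullDim (MvPolynomial (Fin 5) k ⧸ pfaffianIdeal (tomMatrix b d)) := by
  refine two_le_ringKrullDim_quotient_of_surjective y ?_ hy
  rintro _ ⟨i, rfl⟩
  rw [aeval_subPf]
  exact h i

theorem linearForm_notMem {b : Fin 4 → Fin 5 → k} {d : Fin 6 → Fin 5 → k}
    {g : Fin 4 → MvPolynomial (Fin 5) k} {c : Fin 6 → k}
    (h : ∀ (Ω : Type u) [Field Ω] [Algebra k Ω] [IsAlgClosed Ω] (x : Fin 6 → Ω),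
      (∀ j, equationValues b d g x j = 0) →
        ∃ (y : Fin 6 → MvPolynomial (Fin 2) k) (p : Fin 2 → Ω),
          (∀ j, equationValues b d g y j = 0) ∧ ∑ i, c i • y i ≠ 0 ∧ ∀ i, aeval p (y i) = x i) :
    ∀ P ∈ (Ideal.span (Set.range (equations b d g))).minimalPrimes, linearForm c ∉ P := by
  intro P hP
  refine notMem_of_mem_minimalPrimes (fun Ω _ _ _ x hx => ?_) hP
  obtain ⟨y, p, hy, hyc, hp⟩ := h Ω x fun j => by
    rw [← aeval_equations]; exact hx _ ⟨j, rfl⟩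
  refine ⟨y, p, ?_, ?_, hp⟩
  · rintro _ ⟨j, rfl⟩
    rw [aeval_equations]; exact hy j
  · simpa [linearForm, Algebra.smul_def] using hyc

/-- Two nondegenerate forms differ by a unit. -/
theorem IsFrobeniusModel.exists_isUnit {I : Ideal (MvPolynomial (Fin 5) k)} {B : Type u}
    [CommRing B] [Algebra k B] {φ : B →ₗ[k] k} {v : Fin 5 → B} (hM : IsFrobeniusModel I φ v)
    {ψ : B →ₗ[k] k} (hψ : ∀ b, (∀ c, ψ (b * c) = 0) → b = 0) :
    ∃ r, IsUnit r ∧ ∀ b, φ (r * b) = ψ b := by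
  have := hM.finite
  let f : B →ₗ[k] (B →ₗ[k] k) :=
    LinearMap.mk₂ k (fun a b => φ (a * b)) (by simp [add_mul]) (by simp) (by simp [mul_add])
      (by simp)
  have hf : Function.Injective f := by
    rw [← LinearMap.ker_eq_bot, LinearMap.ker_eq_bot']
    exact fun b hb => hM.nondegenerate b fun c => LinearMap.congr_fun hb c
  have hs : Function.Surjective f :=
    (LinearMap.injective_iff_surjective_of_finrank_eq_finrank
      (Subspace.dual_finrank_eq (K := k) (V := B)).symm).1 hf
  obtain ⟨r, hr⟩ := hs ψ
  refine ⟨r, ?_, fun b => LinearMap.congr_fun hr b⟩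
  have := IsArtinianRing.of_finite k B
  -- An element killed by `r` is orthogonal to everything under `ψ`.
  refine IsArtinianRing.isUnit_of_mem_nonZeroDivisors (mem_nonZeroDivisors_iff_right.2 ?_)
  intro b hb
  refine hψ b fun c => ?_
  rw [← hr]
  change φ (r * (b * c)) = 0
  rw [← mul_assoc, mul_comm r, hb, zero_mul, map_zero]

/-- The form φ given by the scheme is unknown, but any nondegenerate `ψ` adapted to a presentation
of B may replace it, at the price of a unit. Minimal primes are controlled by covering the zero
locus with parametrized surfaces. -/
theorem IsFrobeniusModel.isAngloHellenic_of_form {I : Ideal (MvPolynomial (Fin 5) k)}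
    (hI : IsHilbAGZero 4 6 I) {B : Type u} [CommRing B] [Algebra k B] {φ : B →ₗ[k] k}
    {v : Fin 5 → B} (hM : IsFrobeniusModel I φ v)
    {b : Fin 4 → Fin 5 → k} {d : Fin 6 → Fin 5 → k} {g : Fin 4 → MvPolynomial (Fin 5) k}
    (hd : ∀ i, d i 0 = 0)
    (hcurve : ringKrullDim (MvPolynomial (Fin 5) k ⧸ pfaffianIdeal (tomMatrix b d)) = 2)
    (hg : ∀ i, (g i).IsHomogeneous 2) (hQ : IsTomNumerator (tomMatrix b d) g)
    {c : Fin 6 → k} (hc : c ≠ 0)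
    (hmin : ∀ (Ω : Type u) [Field Ω] [Algebra k Ω] [IsAlgClosed Ω] (x : Fin 6 → Ω),
      (∀ j, equationValues b d g x j = 0) →
        ∃ (y : Fin 6 → MvPolynomial (Fin 2) k) (p : Fin 2 → Ω),
          (∀ j, equationValues b d g y j = 0) ∧ ∑ i, c i • y i ≠ 0 ∧ ∀ i, aeval p (y i) = x i)
    (hind : ∀ μ : Fin 5 ⊕ Fin 4 → k,
      (∀ p : Fin 6 → k, ∑ i, c i * p i = 0 → ∑ j, μ j * equationValues b d g p j = 0) → μ = 0)
    {β : Fin 6 → B} {ψ : B →ₗ[k] k} (hψ : ∀ b, (∀ c, ψ (b * c) = 0) → b = 0)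
    (hβψ : ∀ i, ψ (β i) = 0)
    (hβ : ∀ j, equationValues b d g β j = 0) (hcβ : ∑ i, c i • β i = 0)
    (hβc : ∀ p : Fin 6 → k, ∑ i, p i • β i = 0 → ∃ a : k, p = a • c) : IsAngloHellenic I := by
  obtain ⟨r, hr, hrψ⟩ := hM.exists_isUnit hψ
  exact hM.isAngloHellenic hI hd hcurve hg hQ hc (linearForm_notMem hmin) hind hr
    (fun i => by rw [hrψ, hβψ]) hβ hcβ hβc

end Master

/-! ### Tools for checking the families -/

section Families

variable {k : Type u} [Field k]

theorem nondegenerate_of_gram {B : Type*} [CommRing B] [Algebra k B] (e : Module.Basis (Fin 6) k B)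
    {ψ : B →ₗ[k] k} (h : ∀ a : Fin 6 → k, (∀ j, ∑ i, a i * ψ (e i * e j) = 0) → a = 0)
    (b : B) (hb : ∀ c, ψ (b * c) = 0) : b = 0 := by
  have h0 : ⇑(e.repr b) = 0 := h _ fun j => by
    have := hb (e j)
    rw [← e.sum_repr b, Finset.sum_mul, map_sum] at this
    simpa using this
  rw [← e.sum_repr b, h0]
  simp

/-- The indices in `Fin 4` other than a given one, in increasing order. -/
def others : Fin 4 → Fin 3 → Fin 4 := ![![1, 2, 3], ![0, 2, 3], ![0, 1, 3], ![0, 1, 2]]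

theorem succAbove_eq_others (i : Fin 4) (j : Fin 3) : i.succAbove j = others i j := by
  fin_cases i <;> fin_cases j <;> rfl

theorem adjugate_fin_four {R : Type*} [CommRing R] (a : Matrix (Fin 4) (Fin 4) R) (l i : Fin 4) :
    a.adjugate l i = (-1) ^ (i + l : ℕ) * (
      a (others i 0) (others l 0) * a (others i 1) (others l 1) * a (others i 2) (others l 2) -
      a (others i 0) (others l 0) * a (others i 1) (others l 2) * a (others i 2) (others l 1) -
      a (others i 0) (others l 1) * a (others i 1) (others l 0) * a (others i 2) (others l 2) +
      a (others i 0) (others l 1) * a (others i 1) (others l 2) * a (others i 2) (others l 0) +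
      a (others i 0) (others l 2) * a (others i 1) (others l 0) * a (others i 2) (others l 1) -
      a (others i 0) (others l 2) * a (others i 1) (others l 1) * a (others i 2) (others l 0)) := by
  rw [Matrix.adjugate_fin_succ_eq_det_submatrix, Matrix.det_fin_three]
  simp only [Matrix.submatrix_apply, succAbove_eq_others]

end Families

/-! ### Four orthonormal vectors -/

section OrthonormalFamily

variable {k : Type u} [Field k]

/-- The pfaffians are the relations among three orthonormal vectors x_1, x_2, x_3. The fourth vector
enters through the unprojection, whose last equation x_4 s = -x_1² becomes e_4² = e_1² once s =
-x_4. -/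
noncomputable def orthonormalRow : Fin 4 → Fin 5 → k :=
  ![0, ![0, 1, 0, 0, 0], ![0, 0, -1, 0, 0], 0]

noncomputable def orthonormalBlock : Fin 6 → Fin 5 → k :=
  ![0, ![0, 0, 1, 0, 0], ![0, 0, 0, -1, 0], ![0, 0, 0, 1, 0], ![0, 0, -1, 0, 0], ![0, 1, 0, 0, 0]]

noncomputable def orthonormalNumerator : Fin 4 → MvPolynomial (Fin 5) k :=
  ![0, 0, 0, -X 1 ^ 2]

set_option maxHeartbeats 1000000 in
theorem orthonormal_isTomNumerator :
    IsTomNumerator (tomMatrix orthonormalRow orthonormalBlock)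
      (orthonormalNumerator (k := k)) := by
  have hQ : tomQ (tomMatrix (k := k) orthonormalRow orthonormalBlock) =
      !![X 1, 0, 0, 0; -X 2, 0, 0, -X 1; 0, -X 2, X 1, 0; 0, 0, 0, 0] := by
    ext1 m j
    rw [tomQ_tomMatrix]
    fin_cases m <;> fin_cases j <;>
      simp [pfaffians, lin, Fin.sum_univ_five, orthonormalRow, orthonormalBlock]
  intro l i
  rw [hQ]
  fin_cases l <;> fin_cases i <;>
    simp [adjugate_fin_four, others, tomMatrix, lin,
      Fin.sum_univ_five, orthonormalRow, orthonormalNumerator] <;> ring_nf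

theorem orthonormal_equationValues {E : Type*} [CommRing E] [Algebra k E] (x : Fin 6 → E) :
    equationValues (k := k) orthonormalRow orthonormalBlock orthonormalNumerator x =
      Sum.elim ![x 2 ^ 2 - x 3 ^ 2, x 1 ^ 2 - x 2 ^ 2, -(x 2 * x 3), x 1 * x 3, -(x 1 * x 2)]
        ![x 1 * x 5, x 2 * x 5, x 3 * x 5, x 4 * x 5 + x 1 ^ 2] := by
  funext j
  rcases j with j | j <;> fin_cases j <;>
    simp [equationValues, pfaffians, evalLin, orthonormalRow, orthonormalBlock,
      orthonormalNumerator] <;> ring_nf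

end OrthonormalFamily

section OrthonormalFamily

variable {k : Type u} [Field k]

theorem equationValues_iff {E : Type*} [CommRing E] [Algebra k E] {b : Fin 4 → Fin 5 → k}
    {d : Fin 6 → Fin 5 → k} {g : Fin 4 → MvPolynomial (Fin 5) k} {x : Fin 6 → E}
    {a : Fin 5 → E} {a' : Fin 4 → E} (h : equationValues b d g x = Sum.elim a a') :
    (∀ j, equationValues b d g x j = 0) ↔ (∀ j, a j = 0) ∧ ∀ j, a' j = 0 := by
  rw [h, Sum.forall]
  rfl

theorem orthonormal_ringKrullDim :
    ringKrullDim (MvPolynomial (Fin 5) k ⧸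
      pfaffianIdeal (tomMatrix (k := k) orthonormalRow orthonormalBlock)) = 2 := by
  refine le_antisymm (ringKrullDim_tomMatrix_le ![![1, 0, 0, 0, 0], ![0, 0, 0, 0, 1]] ?_)
    (two_le_ringKrullDim_tomMatrix ![X 0, 0, 0, 0, X 1] ?_ ?_)
  · intro D _ _ _ x hx h0 h4
    simp [Fin.forall_fin_succ, pfaffians, evalLin, orthonormalRow, orthonormalBlock] at hx h0 h4 ⊢
    obtain ⟨e0, e1, e2, e3, e4⟩ := hx
    refine ⟨h0, ?_, ?_, ?_, h4⟩ <;> refine pow_eq_zero_iff two_ne_zero |>.1 ?_ <;> grind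
  · simp [Fin.forall_fin_succ, pfaffians, evalLin, orthonormalRow, orthonormalBlock]
  · intro i
    fin_cases i
    · exact ⟨0, rfl⟩
    · exact ⟨4, rfl⟩

/-- The Anglo-Hellenic construction for the algebra with orthonormal socle-square. -/
theorem IsFrobeniusModel.isAngloHellenic_of_orthonormal {I : Ideal (MvPolynomial (Fin 5) k)}
    (hI : IsHilbAGZero 4 6 I) {B : Type u} [CommRing B] [Algebra k B] {φ : B →ₗ[k] k}
    {v : Fin 5 → B} (hM : IsFrobeniusModel I φ v) (e : Module.Basis (Fin 6) k B)
    (h0 : e 0 = 1) (h11 : e 1 * e 1 = e 5) (h22 : e 2 * e 2 = e 5) (h33 : e 3 * e 3 = e 5)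
    (h44 : e 4 * e 4 = e 5) (h12 : e 1 * e 2 = 0) (h13 : e 1 * e 3 = 0) (h14 : e 1 * e 4 = 0)
    (h23 : e 2 * e 3 = 0) (h24 : e 2 * e 4 = 0) (h34 : e 3 * e 4 = 0)
    (h15 : e 1 * e 5 = 0) (h25 : e 2 * e 5 = 0) (h35 : e 3 * e 5 = 0) (h45 : e 4 * e 5 = 0) :
    IsAngloHellenic I := by
  refine hM.isAngloHellenic_of_form hI (b := orthonormalRow) (d := orthonormalBlock)
    (g := orthonormalNumerator) (c := ![0, 0, 0, 0, 1, 1])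
    (β := ![e 0, e 1, e 2, e 3, e 4, -e 4]) (ψ := e.coord 5) ?_ orthonormal_ringKrullDim ?_
    orthonormal_isTomNumerator ?_ ?_ ?_ ?_ ?_ ?_ ?_ ?_
  · intro i; fin_cases i <;> rfl
  · intro i
    fin_cases i
    · exact isHomogeneous_zero _ _ _
    · exact isHomogeneous_zero _ _ _
    · exact isHomogeneous_zero _ _ _
    · exact ((isHomogeneous_X k 1).pow 2).neg
  · exact fun h => one_ne_zero (congrFun h 4)
  · intro Ω _ _ _ x hx
    rw [equationValues_iff (orthonormal_equationValues x)] at hx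
    simp [Fin.forall_fin_succ] at hx
    have hx1 : x 1 = 0 := by grind
    have hx2 : x 2 = 0 := by grind
    have hx3 : x 3 = 0 := by grind
    have h45 : x 4 * x 5 = 0 := by grind
    -- The zero locus consists of two lines of ℙ⁵, in the coordinates x_0, x_5 and x_0, x_4.
    rcases mul_eq_zero.1 h45 with h | h
    · refine ⟨![X 0, 0, 0, 0, 0, X 1], ![x 0, x 5], ?_, ?_, ?_⟩
      · rw [equationValues_iff (orthonormal_equationValues _)]
        simp [Fin.forall_fin_succ]
      · simp [Fin.sum_univ_six]
      · simp [Fin.forall_fin_succ, *]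
    · refine ⟨![X 0, 0, 0, 0, X 1, 0], ![x 0, x 4], ?_, ?_, ?_⟩
      · rw [equationValues_iff (orthonormal_equationValues _)]
        simp [Fin.forall_fin_succ]
      · simp [Fin.sum_univ_six]
      · simp [Fin.forall_fin_succ, *]
  · intro μ hμ
    simp only [orthonormal_equationValues, Fintype.sum_sum_type] at hμ
    -- The first five coordinates parametrize the hyperplane. Coordinate vectors and sums of two of
    -- them isolate the coefficients of a quadratic form.
    have h (p : Fin 5 → k) := hμ ![p 0, p 1, p 2, p 3, p 4, -p 4] (by simp [Fin.sum_univ_six])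
    have h4 := h (Pi.single 4 1)
    have h1 := h (Pi.single 1 1)
    have h3 := h (Pi.single 3 1)
    have h14 := h (Pi.single 1 1 + Pi.single 4 1)
    have h24 := h (Pi.single 2 1 + Pi.single 4 1)
    have h34 := h (Pi.single 3 1 + Pi.single 4 1)
    have h12 := h (Pi.single 1 1 + Pi.single 2 1)
    have h13 := h (Pi.single 1 1 + Pi.single 3 1)
    have h23 := h (Pi.single 2 1 + Pi.single 3 1)
    simp [Fin.sum_univ_succ] at h1 h3 h4 h14 h24 h34 h12 h13 h23
    funext j
    rcases j with j | j <;> fin_cases j <;> simp <;> grind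
  · refine nondegenerate_of_gram e fun a ha => ?_
    simp [Fin.forall_fin_succ, Fin.sum_univ_six, h0, h11, h22, h33, h44, h12, h13, h14, h23, h24,
      h34, h15, h25, h35, h45, mul_comm (e 2) (e 1), mul_comm (e 3), mul_comm (e 4), mul_comm (e 5)] at ha
    funext i
    fin_cases i <;> simp <;> grind
  · intro i
    fin_cases i <;> simp
  · rw [equationValues_iff (orthonormal_equationValues _)]
    simp [Fin.forall_fin_succ, pow_two, h11, h22, h33, h44, h12, h13, h14, h23, h24, h34]
  · simp [Fin.sum_univ_six]
  · intro p hp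
    have := Fintype.linearIndependent_iff.1 e.linearIndependent
      ![p 0, p 1, p 2, p 3, p 4 - p 5, 0] (by
        rw [← hp]
        simp [Fin.sum_univ_six]
        module)
    simp [Fin.forall_fin_succ] at this
    refine ⟨p 5, funext fun i => ?_⟩
    fin_cases i <;> simp <;> grind

end OrthonormalFamily

/-! ### One orthonormal vector beside a generator -/

section QuarticFamily

variable {k : Type u} [Field k]

/-- Three pfaffians are the equations of the twisted cubic, satisfied by (1, x, x², x³); the other
two say that x³ and x² are killed by x + a + b x⁻¹, that is, x (x⁴ + a x³ + b x²) = 0 and its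
analogue for x⁴ + a x³ + b x² one degree lower are imposed through x_3 + a x_2 + b x_1. -/
noncomputable def quarticRow : Fin 4 → Fin 5 → k :=
  ![0, ![1, 0, 0, 0, 0], ![0, 1, 0, 0, 0], ![0, 0, 1, 0, 0]]

noncomputable def quarticBlock (a b : k) : Fin 6 → Fin 5 → k :=
  ![![0, 1, 0, 0, 0], ![0, 0, 1, 0, 0], ![0, 0, 0, 1, 0], ![0, b, a, 1, 0], 0, 0]

noncomputable def quarticNumerator (a b : k) : Fin 4 → MvPolynomial (Fin 5) k :=
  ![0, 0, 0, X 2 * (X 2 + C a * X 1 + C b * X 0)]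

variable (a b : k)

set_option maxHeartbeats 1000000 in
theorem quartic_isTomNumerator :
    IsTomNumerator (tomMatrix quarticRow (quarticBlock a b)) (quarticNumerator a b) := by
  have hQ : tomQ (tomMatrix quarticRow (quarticBlock a b)) =
      !![C b * X 2, 0, X 2, X 1; C a * X 2, X 2, 0, -X 0; X 2, -X 1, -X 0, 0; 0, 0, 0, 0] := by
    ext1 m j
    rw [tomQ_tomMatrix]
    fin_cases m <;> fin_cases j <;>
      simp [pfaffians, lin, Fin.sum_univ_five, quarticRow, quarticBlock, mul_comm]
  intro l i
  rw [hQ]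
  fin_cases l <;> fin_cases i <;>
    simp [adjugate_fin_four, others, tomMatrix, lin,
      Fin.sum_univ_five, quarticRow, quarticNumerator] <;> ring_nf

theorem quartic_equationValues {E : Type*} [CommRing E] [Algebra k E] (x : Fin 6 → E) :
    equationValues quarticRow (quarticBlock a b) (quarticNumerator a b) x =
      Sum.elim ![x 3 * (x 3 + algebraMap k E a * x 2 + algebraMap k E b * x 1),
          x 2 * (x 3 + algebraMap k E a * x 2 + algebraMap k E b * x 1),
          x 2 ^ 2 - x 1 * x 3, x 1 * x 2 - x 0 * x 3, x 1 ^ 2 - x 0 * x 2]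
        ![x 1 * x 5, x 2 * x 5, x 3 * x 5,
          x 4 * x 5 - x 2 * (x 2 + algebraMap k E a * x 1 + algebraMap k E b * x 0)] := by
  funext j
  rcases j with j | j <;> fin_cases j <;>
    simp [equationValues, pfaffians, evalLin, quarticRow, quarticBlock,
      quarticNumerator, Algebra.smul_def] <;> ring_nf

theorem quartic_ringKrullDim :
    ringKrullDim (MvPolynomial (Fin 5) k ⧸
      pfaffianIdeal (tomMatrix quarticRow (quarticBlock a b))) = 2 := by
  refine le_antisymm (ringKrullDim_tomMatrix_le ![![1, 0, 0, 0, 0], ![0, 0, 0, 0, 1]] ?_)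
    (two_le_ringKrullDim_tomMatrix ![X 0, 0, 0, 0, X 1] ?_ ?_)
  · intro D _ _ _ x hx h0 h4
    simp [Fin.forall_fin_succ, pfaffians, evalLin, quarticRow, quarticBlock] at hx h0 h4 ⊢
    obtain ⟨e0, e1, e2, e3, e4⟩ := hx
    have h1 : x 1 = 0 := by simpa [h0] using e4
    have h2 : x 2 = 0 := by simpa [h0, h1] using e2
    have h3 : x 3 = 0 := by simpa [h0, h1, h2] using e0
    exact ⟨h0, h1, h2, h3, h4⟩
  · simp [Fin.forall_fin_succ, pfaffians, evalLin, quarticRow, quarticBlock]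
  · intro i
    fin_cases i
    · exact ⟨0, rfl⟩
    · exact ⟨4, rfl⟩

set_option maxHeartbeats 1000000 in
/-- The Anglo-Hellenic construction for the algebra generated by `x = e 1` and `y = e 5` with
`x y = 0` and `y ^ 2 = x ^ 4 + a x ^ 3 + b x ^ 2`. -/
theorem IsFrobeniusModel.isAngloHellenic_of_quartic [IsAlgClosed k]
    {I : Ideal (MvPolynomial (Fin 5) k)}
    (hI : IsHilbAGZero 4 6 I) {B : Type u} [CommRing B] [Algebra k B] {φ : B →ₗ[k] k}
    {v : Fin 5 → B} (hM : IsFrobeniusModel I φ v) (e : Module.Basis (Fin 6) k B)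
    (h0 : e 0 = 1) (h11 : e 1 * e 1 = e 2) (h12 : e 1 * e 2 = e 3) (h13 : e 1 * e 3 = e 4)
    (h14 : e 1 * (e 4 + a • e 3 + b • e 2) = 0) (h15 : e 1 * e 5 = 0)
    (h55 : e 5 * e 5 = e 4 + a • e 3 + b • e 2) :
    IsAngloHellenic I := by
  have h22 : e 2 * e 2 = e 4 := by rw [← h13, ← h12, ← h11]; ring
  have h25 : e 2 * e 5 = 0 := by rw [← h11, mul_assoc, h15, mul_zero]
  have h35 : e 3 * e 5 = 0 := by rw [← h12, mul_assoc, h25, mul_zero]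
  have h45 : e 4 * e 5 = 0 := by rw [← h13, mul_assoc, h35, mul_zero]
  refine hM.isAngloHellenic_of_form hI (b := quarticRow) (d := quarticBlock a b)
    (g := quarticNumerator a b) (c := ![0, 0, 0, 0, 1, -1])
    (β := ![e 0, e 1, e 2, e 3, e 5, e 5]) (ψ := e.coord 4) ?_ (quartic_ringKrullDim a b) ?_
    (quartic_isTomNumerator a b) ?_ ?_ ?_ ?_ ?_ ?_ ?_ ?_
  · intro i; fin_cases i <;> rfl
  · intro i
    fin_cases i
    · exact isHomogeneous_zero _ _ _
    · exact isHomogeneous_zero _ _ _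
    · exact isHomogeneous_zero _ _ _
    · exact (isHomogeneous_X k 2).mul (((isHomogeneous_X k 2).add
        (isHomogeneous_C_mul_X a 1)).add (isHomogeneous_C_mul_X b 0))
  · exact fun h => one_ne_zero (congrFun h 4)
  -- The roots of t² + a t + b give the components of the curve other than those through t = 0.
  · obtain ⟨r, s, hrs⟩ : ∃ r s : k, a = -(r + s) ∧ b = r * s := by
      obtain ⟨r, hr⟩ := IsAlgClosed.exists_root
        (Polynomial.X ^ 2 + Polynomial.C a * Polynomial.X + Polynomial.C b : Polynomial k) (by
          rw [show (Polynomial.X ^ 2 + Polynomial.C a * Polynomial.X + Polynomial.C b :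
            Polynomial k).degree = 2 by compute_degree!]
          norm_num)
      refine ⟨r, -a - r, by ring, ?_⟩
      simp at hr
      linear_combination hr
    obtain ⟨rfl, rfl⟩ := hrs
    intro Ω _ _ _ x hx
    rw [equationValues_iff (quartic_equationValues _ _ x)] at hx
    simp only [Fin.forall_fin_succ] at hx
    obtain ⟨⟨e0, e1, e2, e3, e4, -⟩, f1, f2, f3, f4, -⟩ := hx
    simp at e0 e1 e2 e3 e4 f1 f2 f3 f4
    -- The line joining the point (1, t, t², t³, 0, 0) of the twisted cubic to the vertex (0, 0, 0,
    -- 0, 1, 0).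
    have hsurf (t : k) (ht : t = 0 ∨ t ^ 2 - (r + s) * t + r * s = 0) (h5 : x 5 = 0)
        (h1 : x 1 = algebraMap k Ω t * x 0) (h2 : x 2 = algebraMap k Ω t ^ 2 * x 0)
        (h3 : x 3 = algebraMap k Ω t ^ 3 * x 0) :
        ∃ (y : Fin 6 → MvPolynomial (Fin 2) k) (p : Fin 2 → Ω),
          (∀ j, equationValues quarticRow (quarticBlock (-(r + s)) (r * s))
            (quarticNumerator (-(r + s)) (r * s)) y j = 0) ∧
          ∑ i, (![0, 0, 0, 0, 1, -1] : Fin 6 → k) i • y i ≠ 0 ∧ ∀ i, aeval p (y i) = x i := by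
      refine ⟨![X 0, C t * X 0, C t ^ 2 * X 0, C t ^ 3 * X 0, X 1, 0], ![x 0, x 4], ?_, ?_, ?_⟩
      · rw [equationValues_iff (quartic_equationValues _ _ _)]
        rcases ht with rfl | ht
        · simp [Fin.forall_fin_succ]
        have hC : (C t ^ 2 - (C r + C s) * C t + C r * C s : MvPolynomial (Fin 2) k) = 0 := by
          simp only [← C_sub, ← C_pow, ← C_mul, ← C_add, ht, C_0]
        simp [Fin.forall_fin_succ]
        grind
      · simp [Fin.sum_univ_six]
      · simp [Fin.forall_fin_succ, h1, h2, h3, h5]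
    rcases eq_or_ne (x 5) 0 with h5 | h5
    · rcases eq_or_ne (x 0) 0 with h0 | h0
      · have h1 : x 1 = 0 := by simpa [h0] using e4
        have h2 : x 2 = 0 := by simpa [h0, h1] using e2
        have h3 : x 3 = 0 := by simpa [h0, h1, h2] using e0
        exact hsurf 0 (by simp) h5 (by simp [h1]) (by simp [h2]) (by simp [h3])
      · rcases eq_or_ne (x 2) 0 with h2 | h2
        · have h1 : x 1 = 0 := by simpa [h2] using e4
          have h3 : x 3 = 0 := by simpa [h0, h1, h2] using e3
          exact hsurf 0 (by simp) h5 (by simp [h1]) (by simp [h2]) (by simp [h3])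
        · have h6 : (x 1 - algebraMap k Ω r * x 0) * (x 1 - algebraMap k Ω s * x 0) = 0 := by
            have h7 := f4
            rw [h5] at h7
            have h8 : x 2 + -(algebraMap k Ω r + algebraMap k Ω s) * x 1 +
              algebraMap k Ω r * algebraMap k Ω s * x 0 = 0 := by
              refine (mul_eq_zero.1 (?_ : x 2 * _ = 0)).resolve_left h2
              linear_combination -h7
            linear_combination e4 + x 0 * h8
          have key (t : k) (ht : x 1 = algebraMap k Ω t * x 0) :
              x 2 = algebraMap k Ω t ^ 2 * x 0 ∧ x 3 = algebraMap k Ω t ^ 3 * x 0 := by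
            have h2 : x 2 = algebraMap k Ω t ^ 2 * x 0 := by
              apply mul_left_cancel₀ h0
              rw [ht] at e4
              linear_combination -e4
            refine ⟨h2, ?_⟩
            apply mul_left_cancel₀ h0
            rw [ht, h2] at e3
            linear_combination -e3
          rcases mul_eq_zero.1 h6 with h | h
          · have := key r (sub_eq_zero.1 h)
            exact hsurf r (Or.inr (by ring)) h5 (sub_eq_zero.1 h) this.1 this.2
          · have := key s (sub_eq_zero.1 h)
            exact hsurf s (Or.inr (by ring)) h5 (sub_eq_zero.1 h) this.1 this.2
    · have h1 := f1.resolve_right h5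
      have h2 := f2.resolve_right h5
      have h3 := f3.resolve_right h5
      have h4 : x 4 = 0 := by simpa [h1, h2, h5] using f4
      -- The one component on which s does not vanish identically.
      refine ⟨![X 0, 0, 0, 0, 0, X 1], ![x 0, x 5], ?_, ?_, ?_⟩
      · rw [equationValues_iff (quartic_equationValues _ _ _)]
        simp [Fin.forall_fin_succ]
      · simp [Fin.sum_univ_six]
      · simp [Fin.forall_fin_succ, *]
  · intro μ hμ
    simp only [quartic_equationValues, Fintype.sum_sum_type] at hμ
    have h (p : Fin 5 → k) := hμ ![p 0, p 1, p 2, p 3, p 4, p 4] (by simp [Fin.sum_univ_six])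
    have h4 := h (Pi.single 4 1)
    have h1 := h (Pi.single 1 1)
    have h2 := h (Pi.single 2 1)
    have h3 := h (Pi.single 3 1)
    have h03 := h (Pi.single 0 1 + Pi.single 3 1)
    have h14 := h (Pi.single 1 1 + Pi.single 4 1)
    have h24 := h (Pi.single 2 1 + Pi.single 4 1)
    have h34 := h (Pi.single 3 1 + Pi.single 4 1)
    have h13 := h (Pi.single 1 1 + Pi.single 3 1)
    have h23 := h (Pi.single 2 1 + Pi.single 3 1)
    simp [Fin.sum_univ_succ] at h1 h2 h3 h4 h14 h24 h34 h03 h13 h23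
    funext j
    rcases j with j | j <;> fin_cases j <;> simp <;> grind
  · refine nondegenerate_of_gram e fun a ha => ?_
    simp [Fin.forall_fin_succ, Fin.sum_univ_six, h0, h11, h12, h13, h22, h15, h25, h35, h45, h55,
      mul_comm (e 2) (e 1), mul_comm (e 3) (e 1), mul_comm (e 5)] at ha
    funext i
    fin_cases i <;> simp <;> grind
  · intro i
    fin_cases i <;> simp
  · rw [equationValues_iff (quartic_equationValues _ _ _)]
    rw [Algebra.smul_def, Algebra.smul_def] at h14 h55
    simp only [Fin.forall_fin_succ]
    simp
    grind
  · simp [Fin.sum_univ_six]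
  · intro p hp
    have := Fintype.linearIndependent_iff.1 e.linearIndependent
      ![p 0, p 1, p 2, p 3, 0, p 4 + p 5] (by
        rw [← hp]
        simp [Fin.sum_univ_six]
        module)
    simp [Fin.forall_fin_succ] at this
    obtain ⟨p0, p1, p2, p3, p5⟩ := this
    refine ⟨p 4, funext fun i => ?_⟩
    fin_cases i <;> simp [p0, p1, p2, p3, eq_neg_of_add_eq_zero_right p5]

end QuarticFamily

/-! ### Two orthonormal vectors beside a generator -/

section CubicFamily

variable {k : Type u} [Field k]

/-- The pfaffians are satisfied by 1, x, x² and the first orthonormal vector x_3. The second one is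
x_4 = s on the hyperplane, where x_4 s = x_3² says that both vectors have the same square. -/
noncomputable def cubicRow : Fin 4 → Fin 5 → k :=
  ![![0, 0, 0, 1, 0], ![0, 1, 0, 0, 0], ![-1, 0, 0, 0, 0], 0]

noncomputable def cubicBlock (a : k) : Fin 6 → Fin 5 → k :=
  ![0, ![0, a, 1, 0, 0], 0, ![0, 0, 0, 1, 0], ![0, 0, -1, 0, 0], ![0, 1, 0, 0, 0]]

noncomputable def cubicNumerator : Fin 4 → MvPolynomial (Fin 5) k :=
  ![0, 0, 0, X 3 ^ 2]

variable (a : k)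

set_option maxHeartbeats 1000000 in
theorem cubic_isTomNumerator :
    IsTomNumerator (tomMatrix cubicRow (cubicBlock a)) cubicNumerator := by
  have hQ : tomQ (tomMatrix cubicRow (cubicBlock a)) =
      !![X 1, X 3, 0, -(C a * X 1); -X 0, 0, -X 3, -X 1; 0, 0, 0, X 3; 0, 0, 0, 0] := by
    ext1 m j
    rw [tomQ_tomMatrix]
    fin_cases m <;> fin_cases j <;>
      simp [pfaffians, lin, Fin.sum_univ_five, cubicRow, cubicBlock, mul_comm]
  intro l i
  rw [hQ]
  fin_cases l <;> fin_cases i <;>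
    simp [adjugate_fin_four, others, tomMatrix, lin,
      Fin.sum_univ_five, cubicRow, cubicNumerator] <;> ring_nf

theorem cubic_equationValues {E : Type*} [CommRing E] [Algebra k E] (x : Fin 6 → E) :
    equationValues cubicRow (cubicBlock a) cubicNumerator x =
      Sum.elim ![x 2 * (x 2 + algebraMap k E a * x 1), x 1 ^ 2 - x 0 * x 2, x 1 * x 3,
          -(x 2 * x 3), x 3 ^ 2 - x 1 * (x 2 + algebraMap k E a * x 1)]
        ![x 1 * x 5, x 2 * x 5, x 3 * x 5, x 4 * x 5 - x 3 ^ 2] := by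
  funext j
  rcases j with j | j <;> fin_cases j <;>
    simp [equationValues, pfaffians, evalLin, cubicRow, cubicBlock,
      cubicNumerator, Algebra.smul_def] <;> ring_nf

theorem cubic_ringKrullDim :
    ringKrullDim (MvPolynomial (Fin 5) k ⧸
      pfaffianIdeal (tomMatrix cubicRow (cubicBlock a))) = 2 := by
  refine le_antisymm (ringKrullDim_tomMatrix_le ![![1, 0, 0, 0, 0], ![0, 0, 0, 0, 1]] ?_)
    (two_le_ringKrullDim_tomMatrix ![X 0, 0, 0, 0, X 1] ?_ ?_)
  · intro D _ _ _ x hx h0 h4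
    simp [Fin.forall_fin_succ, pfaffians, evalLin, cubicRow, cubicBlock] at hx h0 h4 ⊢
    obtain ⟨e0, e1, e2, e3, e4⟩ := hx
    have h1 : x 1 = 0 := by simpa [h0] using e1
    have h2 : x 2 = 0 := by simpa [h0, h1] using e0
    have h3 : x 3 = 0 := by simpa [h0, h1, h2] using e4
    exact ⟨h0, h1, h2, h3, h4⟩
  · simp [Fin.forall_fin_succ, pfaffians, evalLin, cubicRow, cubicBlock]
  · intro i
    fin_cases i
    · exact ⟨0, rfl⟩
    · exact ⟨4, rfl⟩

set_option maxHeartbeats 1000000 in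
/-- The Anglo-Hellenic construction for the algebra generated by `x = e 1` and orthogonal elements
`e 4`, `e 5` annihilated by `x` and with square `x ^ 3 + a x ^ 2`. -/
theorem IsFrobeniusModel.isAngloHellenic_of_cubic {I : Ideal (MvPolynomial (Fin 5) k)}
    (hI : IsHilbAGZero 4 6 I) {B : Type u} [CommRing B] [Algebra k B] {φ : B →ₗ[k] k}
    {v : Fin 5 → B} (hM : IsFrobeniusModel I φ v) (e : Module.Basis (Fin 6) k B)
    (h0 : e 0 = 1) (h11 : e 1 * e 1 = e 2) (h12 : e 1 * e 2 = e 3)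
    (h13 : e 1 * (e 3 + a • e 2) = 0) (h14 : e 1 * e 4 = 0) (h15 : e 1 * e 5 = 0)
    (h44 : e 4 * e 4 = e 3 + a • e 2) (h55 : e 5 * e 5 = e 3 + a • e 2) (h45 : e 4 * e 5 = 0) :
    IsAngloHellenic I := by
  have h24 : e 2 * e 4 = 0 := by rw [← h11, mul_assoc, h14, mul_zero]
  have h34 : e 3 * e 4 = 0 := by rw [← h12, mul_assoc, h24, mul_zero]
  have h25 : e 2 * e 5 = 0 := by rw [← h11, mul_assoc, h15, mul_zero]
  have h35 : e 3 * e 5 = 0 := by rw [← h12, mul_assoc, h25, mul_zero]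
  refine hM.isAngloHellenic_of_form hI (b := cubicRow) (d := cubicBlock a)
    (g := cubicNumerator) (c := ![0, 0, 0, 0, 1, -1])
    (β := ![e 0, e 1, e 2, e 4, e 5, e 5]) (ψ := e.coord 3) ?_ (cubic_ringKrullDim a) ?_
    (cubic_isTomNumerator a) ?_ ?_ ?_ ?_ ?_ ?_ ?_ ?_
  · intro i; fin_cases i <;> rfl
  · intro i
    fin_cases i
    · exact isHomogeneous_zero _ _ _
    · exact isHomogeneous_zero _ _ _
    · exact isHomogeneous_zero _ _ _
    · exact (isHomogeneous_X k 3).pow 2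
  · exact fun h => one_ne_zero (congrFun h 4)
  · intro Ω _ _ _ x hx
    rw [equationValues_iff (cubic_equationValues _ x)] at hx
    simp only [Fin.forall_fin_succ] at hx
    obtain ⟨⟨e0, e1, e2, e3, e4, -⟩, f1, f2, f3, f4, -⟩ := hx
    simp at e0 e1 e2 e3 e4 f1 f2 f3 f4
    -- The line joining (1, t, t², 0, 0, 0) to (0, 0, 0, 0, 1, 0).
    have hsurf (t : k) (ht : t = 0 ∨ t = -a) (h5 : x 5 = 0) (h3 : x 3 = 0)
        (h1 : x 1 = algebraMap k Ω t * x 0) (h2 : x 2 = algebraMap k Ω t ^ 2 * x 0) :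
        ∃ (y : Fin 6 → MvPolynomial (Fin 2) k) (p : Fin 2 → Ω),
          (∀ j, equationValues cubicRow (cubicBlock a) cubicNumerator y j = 0) ∧
          ∑ i, (![0, 0, 0, 0, 1, -1] : Fin 6 → k) i • y i ≠ 0 ∧ ∀ i, aeval p (y i) = x i := by
      refine ⟨![X 0, C t * X 0, C t ^ 2 * X 0, 0, X 1, 0], ![x 0, x 4], ?_, ?_, ?_⟩
      · rw [equationValues_iff (cubic_equationValues _ _)]
        rcases ht with rfl | rfl
        · simp [Fin.forall_fin_succ]
        simp [Fin.forall_fin_succ]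
        grind
      · simp [Fin.sum_univ_six]
      · simp [Fin.forall_fin_succ, h1, h2, h3, h5]
    rcases eq_or_ne (x 5) 0 with h5 | h5
    · have h3 : x 3 = 0 := by simpa [h5] using f4
      rcases eq_or_ne (x 1) 0 with h1 | h1
      · have h2 : x 2 = 0 := by simpa [h1] using e0
        exact hsurf 0 (Or.inl rfl) h5 h3 (by simp [h1]) (by simp [h2])
      · have h2 : x 2 = -(algebraMap k Ω a * x 1) := by
          have : x 1 * (x 2 + algebraMap k Ω a * x 1) = 0 := by
            rw [h3] at e4
            linear_combination -e4
          linear_combination (mul_eq_zero.1 this).resolve_left h1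
        have h1' : x 1 = -(algebraMap k Ω a * x 0) := by
          apply mul_left_cancel₀ h1
          rw [h2] at e1
          linear_combination e1
        refine hsurf (-a) (Or.inr rfl) h5 h3 (by simp [h1']) ?_
        rw [h2, h1', map_neg]
        ring
    · have h1 := f1.resolve_right h5
      have h2 := f2.resolve_right h5
      have h3 := f3.resolve_right h5
      have h4 : x 4 = 0 := by simpa [h3, h5] using f4
      refine ⟨![X 0, 0, 0, 0, 0, X 1], ![x 0, x 5], ?_, ?_, ?_⟩
      · rw [equationValues_iff (cubic_equationValues _ _)]
        simp [Fin.forall_fin_succ]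
      · simp [Fin.sum_univ_six]
      · simp [Fin.forall_fin_succ, *]
  · intro μ hμ
    simp only [cubic_equationValues, Fintype.sum_sum_type] at hμ
    have h (p : Fin 5 → k) := hμ ![p 0, p 1, p 2, p 3, p 4, p 4] (by simp [Fin.sum_univ_six])
    have h4 := h (Pi.single 4 1)
    have h1 := h (Pi.single 1 1)
    have h2 := h (Pi.single 2 1)
    have h3 := h (Pi.single 3 1)
    have h02 := h (Pi.single 0 1 + Pi.single 2 1)
    have h14 := h (Pi.single 1 1 + Pi.single 4 1)
    have h24 := h (Pi.single 2 1 + Pi.single 4 1)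
    have h34 := h (Pi.single 3 1 + Pi.single 4 1)
    have h13 := h (Pi.single 1 1 + Pi.single 3 1)
    have h23 := h (Pi.single 2 1 + Pi.single 3 1)
    simp [Fin.sum_univ_succ] at h1 h2 h3 h4 h14 h24 h34 h02 h13 h23
    funext j
    rcases j with j | j <;> fin_cases j <;> simp <;> grind
  · refine nondegenerate_of_gram e fun a ha => ?_
    simp [Fin.forall_fin_succ, Fin.sum_univ_six, h0, h11, h12, h14, h24, h34, h15, h25, h35, h45,
      h44, h55, mul_comm (e 2) (e 1), mul_comm (e 3) (e 1), mul_comm (e 5), mul_comm (e 4) (e 1),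
      mul_comm (e 4) (e 2), mul_comm (e 4) (e 3)] at ha
    funext i
    fin_cases i <;> simp <;> grind
  · intro i
    fin_cases i <;> simp
  · rw [equationValues_iff (cubic_equationValues _ _)]
    rw [Algebra.smul_def] at h13 h44 h55
    simp only [Fin.forall_fin_succ]
    simp
    grind
  · simp [Fin.sum_univ_six]
  · intro p hp
    have := Fintype.linearIndependent_iff.1 e.linearIndependent
      ![p 0, p 1, p 2, 0, p 3, p 4 + p 5] (by
        rw [← hp]
        simp [Fin.sum_univ_six]
        module)
    simp [Fin.forall_fin_succ] at this
    obtain ⟨p0, p1, p2, p3, p5⟩ := this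
    refine ⟨p 4, funext fun i => ?_⟩
    fin_cases i <;> simp [p0, p1, p2, p3, eq_neg_of_add_eq_zero_right p5]

end CubicFamily

/-! ### Local algebras with Hilbert function 1, 2, 2, 1 -/

section ConicFamily

variable {k : Type u} [Field k]

/-- The unprojection is supported on the two conics x_1 x_3 = x_2² and x_3 s = -x_0², each in its
own plane. They meet where only x_3 is nonzero. -/
noncomputable def conicRow : Fin 4 → Fin 5 → k :=
  ![0, ![0, 0, 1, 0, 0], ![0, 0, 0, 1, 0], ![1, 0, 0, 0, 0]]

noncomputable def conicBlock : Fin 6 → Fin 5 → k :=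
  ![![0, 1, 0, 0, 0], ![0, 0, 1, 0, 0], ![0, 0, 0, 0, 1], ![0, 0, 0, 0, 1], 0, 0]

noncomputable def conicNumerator : Fin 4 → MvPolynomial (Fin 5) k :=
  ![0, 0, -X 0 ^ 2, 0]

set_option maxHeartbeats 1000000 in
theorem conic_isTomNumerator :
    IsTomNumerator (tomMatrix conicRow conicBlock) (conicNumerator (k := k)) := by
  have hQ : tomQ (tomMatrix (k := k) conicRow conicBlock) =
      !![0, 0, X 0, X 3; 0, X 0, 0, -X 2; 0, 0, 0, 0; X 0, -X 3, -X 2, 0] := by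
    ext1 m j
    rw [tomQ_tomMatrix]
    fin_cases m <;> fin_cases j <;>
      simp [pfaffians, lin, Fin.sum_univ_five, conicRow, conicBlock]
  intro l i
  rw [hQ]
  fin_cases l <;> fin_cases i <;>
    simp [adjugate_fin_four, others, tomMatrix, lin,
      Fin.sum_univ_five, conicRow, conicNumerator] <;> ring_nf

theorem conic_equationValues {E : Type*} [CommRing E] [Algebra k E] (x : Fin 6 → E) :
    equationValues (k := k) conicRow conicBlock conicNumerator x =
      Sum.elim ![x 4 ^ 2, x 0 * x 4, x 0 * x 2 - x 3 * x 4, x 0 * x 1 - x 2 * x 4,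
          x 1 * x 3 - x 2 ^ 2]
        ![x 1 * x 5, x 2 * x 5, x 3 * x 5 + x 0 ^ 2, x 4 * x 5] := by
  funext j
  rcases j with j | j <;> fin_cases j <;>
    simp [equationValues, pfaffians, evalLin, conicRow, conicBlock, conicNumerator] <;> ring_nf

theorem conic_ringKrullDim :
    ringKrullDim (MvPolynomial (Fin 5) k ⧸
      pfaffianIdeal (tomMatrix (k := k) conicRow conicBlock)) = 2 := by
  refine le_antisymm (ringKrullDim_tomMatrix_le ![![0, 0, 0, 1, 0], ![1, 1, 0, 0, 0]] ?_)
    (two_le_ringKrullDim_tomMatrix ![X 0, 0, 0, X 1, 0] ?_ ?_)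
  · intro D _ _ _ x hx h3 h01
    simp [Fin.forall_fin_succ, pfaffians, evalLin, conicRow, conicBlock] at hx h3 h01 ⊢
    obtain ⟨e0, e1, e2, e3, e4⟩ := hx
    have h2 : x 2 = 0 := by simpa [h3] using e4
    have h0 : x 0 = 0 := by
      refine pow_eq_zero_iff two_ne_zero |>.1 ?_
      rw [e0] at e3
      linear_combination x 0 * h01 - e3
    have h1 : x 1 = 0 := by simpa [h0] using h01
    exact ⟨h0, h1, h2, h3, e0⟩
  · simp [Fin.forall_fin_succ, pfaffians, evalLin, conicRow, conicBlock]
  · intro i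
    fin_cases i
    · exact ⟨0, rfl⟩
    · exact ⟨3, rfl⟩

set_option maxHeartbeats 1000000 in
/-- The Anglo-Hellenic construction for the local algebras with Hilbert function `1, 2, 2, 1`
generated by `u = e 1` and `w = e 2` with `u w ^ 2 = 0` and `w ^ 2 = b u w + a u ^ 2`. -/
theorem IsFrobeniusModel.isAngloHellenic_of_conic {I : Ideal (MvPolynomial (Fin 5) k)}
    (hI : IsHilbAGZero 4 6 I) {B : Type u} [CommRing B] [Algebra k B] {φ : B →ₗ[k] k}
    {v : Fin 5 → B} (hM : IsFrobeniusModel I φ v) (e : Module.Basis (Fin 6) k B)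
    {a b c : k} (ha : a ≠ 0)
    (h0 : e 0 = 1) (h11 : e 1 * e 1 = e 3) (h12 : e 1 * e 2 = e 4)
    (h22 : e 2 * e 2 = b • e 4 + a • e 3) (h13 : e 1 * e 3 = c • e 5) (h14 : e 1 * e 4 = e 5)
    (h24 : e 2 * e 4 = 0) (h15 : e 1 * e 5 = 0) (h25 : e 2 * e 5 = 0) :
    IsAngloHellenic I := by
  have h23 : e 2 * e 3 = e 5 := by rw [← h14, ← h12, ← h11]; ring
  have h33 : e 3 * e 3 = 0 := by
    nth_rw 1 [← h11]; rw [mul_assoc, h13, mul_smul_comm, h15, smul_zero]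
  have h34 : e 3 * e 4 = 0 := by rw [← h11, mul_assoc, h14, h15]
  have h44 : e 4 * e 4 = 0 := by nth_rw 1 [← h12]; rw [mul_assoc, h24, mul_zero]
  have h35 : e 3 * e 5 = 0 := by rw [← h11, mul_assoc, h15, mul_zero]
  have h45 : e 4 * e 5 = 0 := by rw [← h12, mul_assoc, h25, mul_zero]
  have h122 : e 1 * (e 2 * e 2) = 0 := by rw [← mul_assoc, h12, mul_comm, h24]
  -- The coordinates are w, u², u, 1, u w and s = -w². The hyperplane is the relation w² = b u w + a
  -- u².
  refine hM.isAngloHellenic_of_form hI (b := conicRow) (d := conicBlock)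
    (g := conicNumerator) (c := ![0, a, 0, 0, b, 1])
    (β := ![e 2, e 3, e 1, e 0, e 4, -(e 2 * e 2)]) (ψ := e.coord 5) ?_ conic_ringKrullDim ?_
    conic_isTomNumerator ?_ ?_ ?_ ?_ ?_ ?_ ?_ ?_
  · intro i; fin_cases i <;> rfl
  · intro i
    fin_cases i
    · exact isHomogeneous_zero _ _ _
    · exact isHomogeneous_zero _ _ _
    · exact ((isHomogeneous_X k 0).pow 2).neg
    · exact isHomogeneous_zero _ _ _
  · exact fun h => one_ne_zero (congrFun h 5)
  · intro Ω _ _ _ x hx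
    rw [equationValues_iff (conic_equationValues x)] at hx
    simp only [Fin.forall_fin_succ] at hx
    obtain ⟨⟨e0, e1, e2, e3, e4, -⟩, f1, f2, f3, f4, -⟩ := hx
    simp at e0 e1 e2 e3 e4 f1 f2 f3 f4
    -- A conic is parametrized by squares and products of two parameters, so its points lift only
    -- after square roots.
    have hroot (z : Ω) : ∃ y : Ω, z = y ^ 2 := by
      obtain ⟨y, hy⟩ := IsAlgClosed.exists_pow_nat_eq z (n := 2) (by norm_num)
      exact ⟨y, hy.symm⟩
    rcases eq_or_ne (x 1) 0 with h1 | h1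
    · have h2 : x 2 = 0 := by simpa [h1] using e4
      have hsurf (y z : Ω) (h3 : x 3 = y ^ 2) (h0 : x 0 = y * z) (h5 : x 5 = -z ^ 2) :
          ∃ (y : Fin 6 → MvPolynomial (Fin 2) k) (p : Fin 2 → Ω),
          (∀ j, equationValues (k := k) conicRow conicBlock conicNumerator y j = 0) ∧
          ∑ i, (![0, a, 0, 0, b, 1] : Fin 6 → k) i • y i ≠ 0 ∧ ∀ i, aeval p (y i) = x i := by
        refine ⟨![X 0 * X 1, 0, 0, X 0 ^ 2, 0, -X 1 ^ 2], ![y, z], ?_, ?_, ?_⟩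
        · rw [equationValues_iff (conic_equationValues _)]
          simp [Fin.forall_fin_succ]
          ring
        · simp [Fin.sum_univ_six]
        · simp [Fin.forall_fin_succ, h0, h1, h2, h3, h5, e0]
      obtain ⟨y, hy⟩ := hroot (x 3)
      rcases eq_or_ne y 0 with h | h
      · obtain ⟨z, hz⟩ := hroot (-x 5)
        refine hsurf y z hy ?_ (by rw [← hz, neg_neg])
        rw [h, zero_mul]
        simpa [hy, h] using f3
      · refine hsurf y (x 0 / y) hy (by field_simp) ?_
        rw [hy] at f3
        field_simp
        linear_combination f3
    · have h0 : x 0 = 0 := by simpa [e0, h1] using e3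
      have h5 := f1.resolve_left h1
      obtain ⟨y, hy⟩ := hroot (x 1)
      have hy0 : y ≠ 0 := by
        rintro rfl
        exact h1 (by simpa using hy)
      -- On this conic the hyperplane restricts to `a` times a square, which is where `a ≠ 0` is
      -- needed.
      refine ⟨![0, X 0 ^ 2, X 0 * X 1, X 1 ^ 2, 0, 0], ![y, x 2 / y], ?_, ?_, ?_⟩
      · rw [equationValues_iff (conic_equationValues _)]
        simp [Fin.forall_fin_succ]
        ring
      · simp [Fin.sum_univ_six, ha]
      · have h2 : y * (x 2 / y) = x 2 := by field_simp
        have h3 : (x 2 / y) ^ 2 = x 3 := by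
          rw [hy] at e4
          field_simp
          linear_combination -e4
        simp [Fin.forall_fin_succ, h0, h5, e0, ← hy, h2, h3]
  · intro μ hμ
    simp only [conic_equationValues, Fintype.sum_sum_type] at hμ
    have h (p : Fin 5 → k) := hμ ![p 0, p 1, p 2, p 3, p 4, -(b * p 4) - a * p 1] (by
      simp [Fin.sum_univ_six]; ring)
    have h0 := h (Pi.single 0 1)
    have h1 := h (Pi.single 1 1)
    have h2 := h (Pi.single 2 1)
    have h4 := h (Pi.single 4 1)
    have h12 := h (Pi.single 1 1 + Pi.single 2 1)
    have h14 := h (Pi.single 1 1 + Pi.single 4 1)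
    have h02 := h (Pi.single 0 1 + Pi.single 2 1)
    have h01 := h (Pi.single 0 1 + Pi.single 1 1)
    have h04 := h (Pi.single 0 1 + Pi.single 4 1)
    simp [Fin.sum_univ_succ] at h0 h1 h2 h4 h12 h14 h02 h01 h04
    funext j
    rcases j with j | j <;> fin_cases j <;> simp <;> grind
  · refine nondegenerate_of_gram e fun a ha => ?_
    simp [Fin.forall_fin_succ, Fin.sum_univ_six, h0, h11, h12, h22, h13, h14, h23, h24, h15, h25,
      h33, h34, h44, h35, h45, mul_comm (e 2) (e 1), mul_comm (e 3) (e 1), mul_comm (e 5),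
      mul_comm (e 3) (e 2), mul_comm (e 4) (e 1), mul_comm (e 4) (e 2), mul_comm (e 4) (e 3)] at ha
    funext i
    fin_cases i <;> simp <;> grind
  · intro i
    fin_cases i <;> simp [h22]
  · rw [equationValues_iff (conic_equationValues _)]
    simp only [Fin.forall_fin_succ]
    simp
    grind
  · simp [Fin.sum_univ_six, h22]
    abel
  · intro p hp
    have := Fintype.linearIndependent_iff.1 e.linearIndependent
      ![p 3, p 2, p 0, p 1 - a * p 5, p 4 - b * p 5, 0] (by
        rw [← hp]
        simp [Fin.sum_univ_six, h22]
        module)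
    simp [Fin.forall_fin_succ] at this
    obtain ⟨p0, p1, p2, p3, p5⟩ := this
    refine ⟨p 5, funext fun i => ?_⟩
    fin_cases i <;> simp [p0, p1, p2, sub_eq_zero.1 p3, sub_eq_zero.1 p5, mul_comm]

end ConicFamily

/-! ### Algebras generated by one element -/

section CurvilinearFamily

variable {k : Type u} [Field k]

/-- The unprojection is a rational normal quintic of ℙ⁵ together with a line meeting it at the
parameters 0 and ∞. The coefficients a_2, a_3, a_4 enter the matrix, while a_0 and a_1 enter the
hyperplane. -/
noncomputable def curvilinearRow (a : Fin 5 → k) : Fin 4 → Fin 5 → k :=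
  ![![0, -1, 0, 0, 0], ![0, 0, -1, 0, 0], ![0, -a 2, -a 3, -a 4, -1], ![-1, 0, 0, 0, 0]]

noncomputable def curvilinearBlock : Fin 6 → Fin 5 → k :=
  ![0, ![0, 0, 1, 0, 0], ![0, 0, 0, 1, 0], ![0, 0, 0, 1, 0], ![0, 0, 0, 0, 1], ![0, 1, 0, 0, 0]]

noncomputable def curvilinearNumerator (a : Fin 5 → k) : Fin 4 → MvPolynomial (Fin 5) k :=
  ![-(X 0 * X 1) + X 2 * (X 4 + C (a 4) * X 3 + C (a 3) * X 2 + C (a 2) * X 1), X 1 ^ 2, X 1 * X 2,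
    X 2 ^ 2]

variable (a : Fin 5 → k)

set_option maxHeartbeats 1000000 in
theorem curvilinear_isTomNumerator :
    IsTomNumerator (tomMatrix (curvilinearRow a) curvilinearBlock) (curvilinearNumerator a) := by
  have hQ : tomQ (tomMatrix (curvilinearRow a) curvilinearBlock) =
      !![-X 2, -X 1, 0, 0; 0, -X 0, 0, X 2;
        -X 0, X 4 + C (a 4) * X 3 + C (a 3) * X 2 + C (a 2) * X 1, X 2, -X 1;
        X 4 + C (a 4) * X 3 + C (a 3) * X 2 + C (a 2) * X 1, 0, -X 1, 0] := by
    ext1 m j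
    rw [tomQ_tomMatrix]
    fin_cases m <;> fin_cases j <;>
      simp [pfaffians, lin, Fin.sum_univ_five, curvilinearRow, curvilinearBlock] <;> ring
  intro l i
  rw [hQ]
  fin_cases l <;> fin_cases i <;>
    simp [adjugate_fin_four, others, tomMatrix, lin,
      Fin.sum_univ_five, curvilinearRow, curvilinearNumerator] <;> ring_nf

theorem curvilinear_equationValues {E : Type*} [CommRing E] [Algebra k E] (x : Fin 6 → E) :
    equationValues (curvilinearRow a) curvilinearBlock (curvilinearNumerator a) x =
      Sum.elim ![x 3 ^ 2 - x 2 * x 4,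
          -(x 1 * x 2) + x 4 * (x 4 + algebraMap k E (a 4) * x 3 + algebraMap k E (a 3) * x 2 +
            algebraMap k E (a 2) * x 1) - x 0 * x 3,
          -(x 1 ^ 2) + x 3 * (x 4 + algebraMap k E (a 4) * x 3 + algebraMap k E (a 3) * x 2 +
            algebraMap k E (a 2) * x 1) - x 0 * x 2,
          x 2 * x 3 - x 1 * x 4, x 2 ^ 2 - x 1 * x 3]
        ![x 1 * x 5 + x 0 * x 1 - x 2 * (x 4 + algebraMap k E (a 4) * x 3 +
            algebraMap k E (a 3) * x 2 + algebraMap k E (a 2) * x 1),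
          x 2 * x 5 - x 1 ^ 2, x 3 * x 5 - x 1 * x 2, x 4 * x 5 - x 2 ^ 2] := by
  funext j
  rcases j with j | j <;> fin_cases j <;>
    simp [equationValues, pfaffians, evalLin, curvilinearRow, curvilinearBlock,
      curvilinearNumerator, Algebra.smul_def] <;> ring_nf

/-- The parametrization of the rational quintic. -/
noncomputable def quinticPoint : Fin 6 → MvPolynomial (Fin 2) k :=
  ![X 0 * (-1 + X 1 ^ 5 + C (a 4) * X 1 ^ 4 + C (a 3) * X 1 ^ 3 + C (a 2) * X 1 ^ 2),
    X 0 * X 1, X 0 * X 1 ^ 2, X 0 * X 1 ^ 3, X 0 * X 1 ^ 4, X 0]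

theorem equationValues_quinticPoint (j) :
    equationValues (curvilinearRow a) curvilinearBlock (curvilinearNumerator a)
      (quinticPoint a) j = 0 := by
  rw [curvilinear_equationValues]
  rcases j with j | j <;> fin_cases j <;> simp [quinticPoint] <;> ring

theorem curvilinear_ringKrullDim :
    ringKrullDim (MvPolynomial (Fin 5) k ⧸
      pfaffianIdeal (tomMatrix (curvilinearRow a) curvilinearBlock)) = 2 := by
  refine le_antisymm (ringKrullDim_tomMatrix_le ![![1, 0, 0, 0, 0], ![0, 1, 0, 0, 0]] ?_) ?_
  · intro D _ _ _ x hx h0 h1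
    simp [Fin.forall_fin_succ, pfaffians, evalLin, curvilinearRow, curvilinearBlock] at hx h0 h1 ⊢
    obtain ⟨e0, e1, e2, e3, e4⟩ := hx
    have h2 : x 2 = 0 := by simpa [h0, h1] using e4
    have h3 : x 3 = 0 := by simpa [h0, h1, h2] using e0
    have h4 : x 4 = 0 := by simpa [h0, h1, h2, h3] using e1
    exact ⟨h0, h1, h2, h3, h4⟩
  -- A chain of primes of the cone in ℙ⁴: the projected quintic, its point at parameter 0, and the
  -- vertex. The parameter values X_0 ↦ -X_0, X_1 ↦ 0 specialize the first to the second.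
  · let f₀ : MvPolynomial (Fin 5) k →ₐ[k] MvPolynomial (Fin 2) k :=
      aeval (quinticPoint a ∘ Fin.castSucc)
    let f₁ : MvPolynomial (Fin 5) k →ₐ[k] MvPolynomial (Fin 2) k := aeval ![X 0, 0, 0, 0, 0]
    let f₂ : MvPolynomial (Fin 5) k →ₐ[k] k := aeval 0
    have h01 : (aeval ![-X 0, 0] : MvPolynomial (Fin 2) k →ₐ[k] MvPolynomial (Fin 2) k).comp f₀ =
        f₁ := by
      ext1 i
      fin_cases i <;> simp [f₀, f₁, quinticPoint]
    have h12 : (aeval 0 : MvPolynomial (Fin 2) k →ₐ[k] k).comp f₁ = f₂ := by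
      ext1 i
      fin_cases i <;> simp [f₁, f₂]
    refine two_le_ringKrullDim_quotient (P₀ := RingHom.ker f₀) (P₁ := RingHom.ker f₁)
      (P₂ := RingHom.ker f₂) (RingHom.ker_isPrime f₀.toRingHom) (RingHom.ker_isPrime f₁.toRingHom)
      (RingHom.ker_isPrime f₂.toRingHom) ?_ ?_ ?_
    · refine Ideal.span_le.2 ?_
      rintro _ ⟨i, rfl⟩
      have := equationValues_quinticPoint a (Sum.inl i)
      rw [← aeval_equations, equations, Sum.elim_inl, aeval_rename] at this
      exact this
    · refine SetLike.lt_iff_le_and_exists.2 ⟨fun f hf => ?_, X 1, ?_, ?_⟩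
      · rw [RingHom.mem_ker, ← h01, AlgHom.comp_apply, RingHom.mem_ker.1 hf, map_zero]
      · simp [f₁, RingHom.mem_ker]
      · simp [f₀, quinticPoint, RingHom.mem_ker]
    · refine SetLike.lt_iff_le_and_exists.2 ⟨fun f hf => ?_, X 0, ?_, ?_⟩
      · rw [RingHom.mem_ker, ← h12, AlgHom.comp_apply, RingHom.mem_ker.1 hf, map_zero]
      · simp [f₂, RingHom.mem_ker]
      · simp [f₁, RingHom.mem_ker]

set_option maxHeartbeats 1000000 in
/-- The Anglo-Hellenic construction for the algebra generated by one element. -/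
theorem IsFrobeniusModel.isAngloHellenic_of_curvilinear {I : Ideal (MvPolynomial (Fin 5) k)}
    (hI : IsHilbAGZero 4 6 I) {B : Type u} [CommRing B] [Algebra k B] {φ : B →ₗ[k] k}
    {v : Fin 5 → B} (hM : IsFrobeniusModel I φ v) (e : Module.Basis (Fin 6) k B) {t : B}
    (he : ∀ i, e i = t ^ (i : ℕ))
    (ht : t ^ 6 + a 4 • t ^ 5 + a 3 • t ^ 4 + a 2 • t ^ 3 + a 1 • t ^ 2 + a 0 • t = 0) :
    IsAngloHellenic I := by
  have hmul (i j l : Fin 6) (h : (i : ℕ) + j = l) : e i * e j = e l := by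
    rw [he, he, he, ← pow_add, h]
  -- At parameter t the hyperplane form on the quintic is t⁵ + a_4 t⁴ + a_3 t³ + a_2 t² + a_1 t +
  -- a_0. The first entry of `β` is determined by the hyperplane, and s is 1.
  refine hM.isAngloHellenic_of_form hI (b := curvilinearRow a) (d := curvilinearBlock)
    (g := curvilinearNumerator a) (c := ![1, a 1, 0, 0, 0, a 0 + 1])
    (β := ![-(a 1 • e 1) - (a 0 + 1) • e 0, e 1, e 2, e 3, e 4, e 0]) (ψ := e.coord 5) ?_
    (curvilinear_ringKrullDim a) ?_
    (curvilinear_isTomNumerator a) ?_ ?_ ?_ ?_ ?_ ?_ ?_ ?_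
  · intro i; fin_cases i <;> rfl
  · have h (i j : Fin 5) : (X i * X j : MvPolynomial (Fin 5) k).IsHomogeneous 2 :=
      (isHomogeneous_X k i).mul (isHomogeneous_X k j)
    intro i
    fin_cases i
    · exact (h 0 1).neg.add ((isHomogeneous_X k 2).mul ((((isHomogeneous_X k 4).add
        (isHomogeneous_C_mul_X _ 3)).add (isHomogeneous_C_mul_X _ 2)).add
        (isHomogeneous_C_mul_X _ 1)))
    · exact (isHomogeneous_X k 1).pow 2
    · exact h 1 2
    · exact (isHomogeneous_X k 2).pow 2
  · exact fun h => one_ne_zero (congrFun h 0)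
  · intro Ω _ _ _ x hx
    rw [equationValues_iff (curvilinear_equationValues _ x)] at hx
    simp only [Fin.forall_fin_succ] at hx
    obtain ⟨⟨e0, e1, e2, e3, e4, -⟩, f1, f2, f3, f4, -⟩ := hx
    simp at e0 e1 e2 e3 e4 f1 f2 f3 f4
    rcases eq_or_ne (x 1) 0 with h1 | h1
    · have h2 : x 2 = 0 := by simpa [h1] using e4
      have h3 : x 3 = 0 := by simpa [h2] using e0
      have h4 : x 4 = 0 := by simpa [h1, h2, h3] using e1
      refine ⟨![X 0, 0, 0, 0, 0, X 1], ![x 0, x 5], ?_, ?_, ?_⟩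
      · rw [equationValues_iff (curvilinear_equationValues _ _)]
        simp [Fin.forall_fin_succ]
      -- On the line the form is X_0 + (a_0 + 1) X_1. The point (1, 0) is used because a_0 + 1 may
      -- vanish.
      · intro h
        have := congrArg (aeval ![(1 : k), 0]) h
        simp [Fin.sum_univ_six] at this
      · simp [Fin.forall_fin_succ, *]
    · have h5 : x 5 ≠ 0 := by
        intro h
        exact h1 (by simpa [h] using f2)
      obtain ⟨r, hr⟩ : ∃ r, x 1 = x 5 * r := ⟨x 1 / x 5, by field_simp⟩
      have hr0 : r ≠ 0 := by
        rintro rfl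
        exact h1 (by rw [hr, mul_zero])
      have h2 : x 2 = x 5 * r ^ 2 := by
        apply mul_left_cancel₀ h5
        rw [hr] at f2
        linear_combination f2
      have h3 : x 3 = x 5 * r ^ 3 := by
        apply mul_left_cancel₀ h5
        rw [hr, h2] at f3
        linear_combination f3
      have h4 : x 4 = x 5 * r ^ 4 := by
        apply mul_left_cancel₀ h5
        rw [h2] at f4
        linear_combination f4
      have h0 : x 0 = x 5 * (-1 + r ^ 5 + algebraMap k Ω (a 4) * r ^ 4 +
          algebraMap k Ω (a 3) * r ^ 3 + algebraMap k Ω (a 2) * r ^ 2) := by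
        apply mul_left_cancel₀ h1
        rw [h2, h3, h4, hr] at f1
        rw [hr]
        linear_combination f1
      refine ⟨quinticPoint a, ![x 5, r], equationValues_quinticPoint a, ?_, ?_⟩
      -- With X_0 = 1 the form becomes a polynomial in X_1 whose coefficient of degree 5 is 1.
      · intro h
        have h6 := congrArg (aeval ![(1 : Polynomial k), Polynomial.X]) h
        have h7 := congrArg (fun p => Polynomial.coeff p 5) h6
        simp [Fin.sum_univ_six, quinticPoint, Polynomial.coeff_one, Polynomial.coeff_X] at h7
      · intro i
        fin_cases i <;> simp [quinticPoint, ← h0, ← hr, ← h2, ← h3, ← h4]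
  · intro μ hμ
    simp only [curvilinear_equationValues, Fintype.sum_sum_type] at hμ
    have h (p : Fin 5 → k) := hμ ![-(a 1 * p 0) - (a 0 + 1) * p 4, p 0, p 1, p 2, p 3, p 4] (by
      simp [Fin.sum_univ_six]; ring)
    have h1 := h (Pi.single 0 1)
    have h2 := h (Pi.single 1 1)
    have h3 := h (Pi.single 2 1)
    have h4 := h (Pi.single 3 1)
    have h23 := h (Pi.single 1 1 + Pi.single 2 1)
    have h24 := h (Pi.single 1 1 + Pi.single 3 1)
    have h34 := h (Pi.single 2 1 + Pi.single 3 1)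
    have h25 := h (Pi.single 1 1 + Pi.single 4 1)
    have h35 := h (Pi.single 2 1 + Pi.single 4 1)
    have h45 := h (Pi.single 3 1 + Pi.single 4 1)
    simp [Fin.sum_univ_succ] at h1 h2 h3 h4 h23 h24 h34 h25 h35 h45
    clear h hμ
    have m1 : μ (Sum.inl 1) = 0 := by grind
    have m2 : μ (Sum.inl 2) = 0 := by grind
    have m0 : μ (Sum.inl 0) = 0 := by grind
    have n0 : μ (Sum.inr 0) = 0 := by grind
    have n3 : μ (Sum.inr 3) = 0 := by grind
    have n2 : μ (Sum.inr 2) = 0 := by grind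
    have n1 : μ (Sum.inr 1) = 0 := by grind
    have m4 : μ (Sum.inl 4) = 0 := by grind
    have m3 : μ (Sum.inl 3) = 0 := by grind
    funext j
    rcases j with j | j <;> fin_cases j <;> simp [*]
  · refine nondegenerate_of_gram e fun a ha => ?_
    have e0 : e 0 = 1 := by simp [he]
    simp [Fin.forall_fin_succ, Fin.sum_univ_six, e0, hmul 1 1 2 rfl, hmul 1 2 3 rfl,
      hmul 2 1 3 rfl, hmul 1 3 4 rfl, hmul 3 1 4 rfl, hmul 2 2 4 rfl, hmul 1 4 5 rfl,
      hmul 4 1 5 rfl, hmul 2 3 5 rfl, hmul 3 2 5 rfl] at ha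
    funext i
    fin_cases i <;> simp <;> grind
  · intro i
    fin_cases i <;> simp
  · simp only [he]
    rw [equationValues_iff (curvilinear_equationValues _ _)]
    simp only [Algebra.smul_def] at ht
    simp only [Fin.forall_fin_succ]
    simp [Algebra.smul_def]
    grind
  · simp [Fin.sum_univ_six]
    module
  · intro p hp
    have := Fintype.linearIndependent_iff.1 e.linearIndependent
      ![p 5 - p 0 * (a 0 + 1), p 1 - p 0 * a 1, p 2, p 3, p 4, 0] (by
        rw [← hp]
        simp [Fin.sum_univ_six]
        module)
    simp [Fin.forall_fin_succ] at this
    obtain ⟨p0, p1, p2, p3, p5⟩ := this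
    refine ⟨p 0, funext fun i => ?_⟩
    fin_cases i <;> simp [p2, p3, p5, sub_eq_zero.1 p0, sub_eq_zero.1 p1]

end CurvilinearFamily

/-! ### Approximating a generator by the Chinese remainder theorem -/

section Generator

variable {k : Type u} [Field k] {B : Type u} [CommRing B] [Algebra k B]

/-- The graded pieces of the J-adic filtration are spanned by the powers of x as soon as the first
one is spanned by x, since they are products of it. -/
theorem exists_sub_smul_pow_mem {J : Ideal B} {x : B}
    (hx : x ∈ J) (h : ∀ a ∈ J, ∃ c : k, a - c • x ∈ J ^ 2) (n : ℕ) :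
    ∀ a ∈ J ^ (n + 1), ∃ c : k, a - c • x ^ (n + 1) ∈ J ^ (n + 2) := by
  induction n with
  | zero => simpa using h
  | succ n ih =>
    intro a ha
    rw [pow_succ] at ha
    refine Submodule.mul_induction_on ha (fun p hp q hq => ?_) fun p q hp hq => ?_
    · obtain ⟨c, hc⟩ := ih p hp
      obtain ⟨d, hd⟩ := h q hq
      refine ⟨c * d, ?_⟩
      have h1 : (p - c • x ^ (n + 1)) * q ∈ J ^ (n + 1 + 2) := by
        rw [show n + 1 + 2 = n + 2 + 1 by ring, pow_succ]
        exact Ideal.mul_mem_mul hc hq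
      have h2 : c • (x ^ (n + 1) * (q - d • x)) ∈ J ^ (n + 1 + 2) := by
        rw [pow_add]
        exact Submodule.smul_of_tower_mem _ c (Ideal.mul_mem_mul (Ideal.pow_mem_pow hx _) hd)
      convert! add_mem h1 h2 using 1
      simp only [Algebra.smul_def, map_mul]
      ring
    · obtain ⟨c, hc⟩ := hp
      obtain ⟨d, hd⟩ := hq
      refine ⟨c + d, ?_⟩
      convert! add_mem hc hd using 1
      rw [add_smul]
      ring

theorem exists_aeval_sub_mem_pow {J : Ideal B} {x : B}
    (hx : x ∈ J) (h : ∀ a ∈ J, ∃ c : k, a - c • x ∈ J ^ 2) (n : ℕ) {a : B} (ha : a ∈ J) :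
    ∃ q : Polynomial k, a - Polynomial.aeval x q ∈ J ^ n := by
  cases n with
  | zero => exact ⟨0, by simp⟩
  | succ n =>
    induction n with
    | zero => exact ⟨0, by simpa using ha⟩
    | succ n ih =>
      obtain ⟨q, hq⟩ := ih
      obtain ⟨c, hc⟩ := exists_sub_smul_pow_mem hx h n _ hq
      refine ⟨q + Polynomial.C c * Polynomial.X ^ (n + 1), ?_⟩
      convert! hc using 1
      simp [Algebra.smul_def]
      ring

variable [IsAlgClosed k] [Module.Finite k B]

theorem exists_sub_algebraMap_mem (P : Ideal B) [P.IsMaximal] (b : B) :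
    ∃ c : k, b - algebraMap k B c ∈ P := by
  let := Ideal.Quotient.field P
  obtain ⟨c, hc⟩ := (IsAlgClosed.algebraMap_bijective_of_isIntegral (k := k) (K := B ⧸ P)).2
    (Ideal.Quotient.mk P b)
  exact ⟨c, Ideal.Quotient.eq.1 hc.symm⟩

/-- In an Artinian ring high powers of the maximal ideals intersect in a power of the nilradical,
which is nilpotent. -/
theorem exists_iInf_pow_eq_bot (k : Type u) {B : Type u} [Field k] [CommRing B] [Algebra k B]
    [Module.Finite k B] (n : ℕ) :
    ∃ N, n ≤ N ∧ ⨅ P : MaximalSpectrum B, P.asIdeal ^ N = ⊥ := by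
  have : IsArtinianRing B := IsArtinianRing.of_finite k B
  obtain ⟨m, hm⟩ := IsArtinianRing.isNilpotent_nilradical (R := B)
  refine ⟨m + n, by omega, ?_⟩
  rw [← IsArtinianRing.nilradical_pow_eq_iInf, pow_add, hm, zero_mul, Ideal.zero_eq_bot]

theorem exists_generator (M : MaximalSpectrum B) (Y : Submodule k B)
    (hY : ∀ P : MaximalSpectrum B, P ≠ M → ∀ n, ∀ y ∈ Y, y ∈ P.asIdeal ^ n)
    {x : B} (hx : x ∈ M.asIdeal)
    (hM : ∀ n b, ∃ q : Polynomial k, ∃ y ∈ Y, b - Polynomial.aeval x q - y ∈ M.asIdeal ^ n)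
    (hP : ∀ P : MaximalSpectrum B, P ≠ M → ∃ p ∈ P.asIdeal, ∀ a ∈ P.asIdeal,
      ∃ c : k, a - c • p ∈ P.asIdeal ^ 2) (n : ℕ) :
    ∃ t, t - x ∈ M.asIdeal ^ n ∧
      ∀ b, ∃ q : Polynomial k, ∃ y ∈ Y, b = Polynomial.aeval t q + y := by
  classical
  have : IsArtinianRing B := IsArtinianRing.of_finite k B
  obtain ⟨N, hnN, hN⟩ := exists_iInf_pow_eq_bot k (B := B) (n + 1)
  have : Infinite k := IsAlgClosed.instInfinite
  obtain ⟨l, hl, hlM⟩ : ∃ l : MaximalSpectrum B → k, Function.Injective l ∧ l M = 0 := by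
    obtain ⟨m, ⟨f⟩⟩ := Finite.exists_equiv_fin (MaximalSpectrum B)
    let g : MaximalSpectrum B → k := fun P => Infinite.natEmbedding k (f P)
    have hg : Function.Injective g := fun P Q h =>
      f.injective (Fin.ext ((Infinite.natEmbedding k).injective h))
    exact ⟨fun P => g P - g M, fun P Q h => hg (sub_left_injective h), sub_self _⟩
  choose! p hpP hp using hP
  let z : MaximalSpectrum B → B := fun P => if P = M then x else p P + algebraMap k B (l P)
  have hz (P : MaximalSpectrum B) : z P - algebraMap k B (l P) ∈ P.asIdeal := by
    by_cases h : P = M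
    · subst h
      simpa [z, hlM] using hx
    · simpa [z, h] using hpP P h
  have hloc (P : MaximalSpectrum B) (h : P ≠ M) (b : B) :
      ∃ q : Polynomial k, b - Polynomial.aeval (z P) q ∈ P.asIdeal ^ N := by
    have := P.isMaximal
    obtain ⟨c, hc⟩ := exists_sub_algebraMap_mem (k := k) P.asIdeal b
    obtain ⟨q, hq⟩ := exists_aeval_sub_mem_pow (hpP P h) (hp P h) N hc
    refine ⟨(Polynomial.C c + q).comp (Polynomial.X - Polynomial.C (l P)), ?_⟩
    convert! hq using 1
    simp [Polynomial.aeval_comp, z, h]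
    ring
  have hcop : Pairwise (Function.onFun IsCoprime fun P : MaximalSpectrum B => P.asIdeal ^ N) :=
    fun P Q h => (P.isCoprime_of_ne h).pow
  obtain ⟨t, ht⟩ := Ideal.exists_forall_sub_mem_ideal hcop z
  have htl (P : MaximalSpectrum B) : t - algebraMap k B (l P) ∈ P.asIdeal := by
    rw [← sub_add_sub_cancel t (z P)]
    exact add_mem (Ideal.pow_le_self (by omega) (ht P)) (hz P)
  refine ⟨t, Ideal.pow_le_pow_right (show n ≤ N by omega) (by simpa [z] using ht M), fun b => ?_⟩
  obtain ⟨qM, y, hy, hqM⟩ := hM N b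
  have hall (P : MaximalSpectrum B) :
      ∃ q : Polynomial k, b - y - Polynomial.aeval (z P) q ∈ P.asIdeal ^ N := by
    by_cases h : P = M
    · subst h
      refine ⟨qM, ?_⟩
      simpa [z, sub_right_comm] using hqM
    · exact hloc P h _
  choose q hq using hall
  -- The Chinese remainder theorem is used a second time, in k[X] at the values `l P`, to merge the
  -- local polynomials into one.
  have hcop' : Pairwise (Function.onFun IsCoprime fun P : MaximalSpectrum B =>
      Ideal.span {(Polynomial.X - Polynomial.C (l P)) ^ N}) := by
    intro P Q h
    have := (Polynomial.pairwise_coprime_X_sub_C hl h).pow (m := N) (n := N)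
    exact (Ideal.isCoprime_span_singleton_iff _ _).2 this
  obtain ⟨r, hr⟩ := Ideal.exists_forall_sub_mem_ideal hcop' q
  refine ⟨r, y, hy, ?_⟩
  rw [← sub_eq_iff_eq_add, ← sub_eq_zero, ← Ideal.mem_bot, ← hN, Ideal.mem_iInf]
  intro P
  have h1 : Polynomial.aeval t r - Polynomial.aeval t (q P) ∈ P.asIdeal ^ N := by
    obtain ⟨s, hs⟩ := Ideal.mem_span_singleton'.1 (hr P)
    rw [← map_sub, ← hs]
    simp only [map_mul, map_pow, map_sub, Polynomial.aeval_X, Polynomial.aeval_C]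
    exact Ideal.mul_mem_left _ _ (Ideal.pow_mem_pow (htl P) _)
  have h2 : Polynomial.aeval t (q P) - Polynomial.aeval (z P) (q P) ∈ P.asIdeal ^ N := by
    obtain ⟨s, hs⟩ := Polynomial.sub_dvd_eval_sub t (z P) ((q P).map (algebraMap k B))
    rw [Polynomial.eval_map_algebraMap, Polynomial.eval_map_algebraMap] at hs
    rw [hs]
    exact Ideal.mul_mem_right _ _ (ht P)
  convert! sub_mem (hq P) (add_mem h1 h2) using 1
  ring

end Generator

/-! ### Bases of powers of one element with extra vectors -/

section PowerBasis

variable {k : Type u} [Field k] {B : Type u} [CommRing B] [Algebra k B] [Nontrivial B] [Module.Finite k B]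

/-- The vectors y are independent modulo k[t], which has the powers of t below the degree of the
minimal polynomial as a basis. -/
theorem exists_basis_pow {r : ℕ} {t : B} {y : Fin r → B}
    (hspan : ∀ b, ∃ q : Polynomial k, ∃ c : Fin r → k,
      b = Polynomial.aeval t q + ∑ j, c j • y j)
    (hind : ∀ (q : Polynomial k) (c : Fin r → k),
      Polynomial.aeval t q = ∑ j, c j • y j → c = 0) :
    ∃ (m : ℕ) (e : Module.Basis (Fin m ⊕ Fin r) k B),
      (∀ i : Fin m, e (Sum.inl i) = t ^ (i : ℕ)) ∧ ∀ j, e (Sum.inr j) = y j := by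
  have ht : IsIntegral k t := Algebra.IsIntegral.isIntegral t
  have key (c : Fin (minpoly k t).natDegree → k) : ∑ i, c i • t ^ (i : ℕ) =
      Polynomial.aeval t (∑ i, Polynomial.C (c i) * Polynomial.X ^ (i : ℕ)) := by
    simp [Algebra.smul_def]
  have hli : LinearIndependent k
      (Sum.elim (fun i : Fin (minpoly k t).natDegree => t ^ (i : ℕ)) y) := by
    rw [Fintype.linearIndependent_iff]
    intro g hg
    simp only [Fintype.sum_sum_type, Sum.elim_inl, Sum.elim_inr] at hg
    have h0 := hind _ (fun j => -g (Sum.inr j)) (by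
      rw [← key fun i => g (Sum.inl i), eq_neg_of_add_eq_zero_left hg]
      simp)
    have h1 (j) : g (Sum.inr j) = 0 := by simpa using congrFun h0 j
    simp only [h1, zero_smul, Finset.sum_const_zero, add_zero] at hg
    have h2 := Fintype.linearIndependent_iff.1 (linearIndependent_pow (K := k) t) _ hg
    rintro (i | j)
    · exact h2 i
    · exact h1 j
  refine ⟨_, Module.Basis.mk hli fun b _ => ?_, fun i => by simp, fun j => by simp⟩
  obtain ⟨q, c, rfl⟩ := hspan b
  refine add_mem ?_ (sum_mem fun j _ => Submodule.smul_mem _ _ (Submodule.subset_span ⟨.inr j, rfl⟩))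
  rw [← Polynomial.aeval_modByMonic_eq_self_of_root (minpoly.aeval k t),
    Polynomial.aeval_eq_sum_range' (Polynomial.natDegree_modByMonic_lt q (minpoly.monic ht)
      (minpoly.ne_one k t)), Finset.sum_range]
  exact sum_mem fun i _ => Submodule.smul_mem _ _ (Submodule.subset_span ⟨.inl i, rfl⟩)

end PowerBasis

/-! ### All cotangent spaces of dimension at most one -/

variable {k : Type u} [Field k] [IsAlgClosed k] {I : Ideal (MvPolynomial (Fin 5) k)}
  {B : Type u} [CommRing B] [Algebra k B] {φ : B →ₗ[k] k} {v : Fin 5 → B}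

/-- With nothing missing at any point, Y = 0 and B has a basis of powers of one element. It is
chosen in M so that its degree-six relation has no constant term, as the curvilinear family
requires. -/
theorem IsFrobeniusModel.isAngloHellenic_of_cotangentSpace (hI : IsHilbAGZero 4 6 I)
    (hM : IsFrobeniusModel I φ v)
    (h : ∀ P : MaximalSpectrum B, ∃ p ∈ P.asIdeal, ∀ a ∈ P.asIdeal,
      ∃ c : k, a - c • p ∈ P.asIdeal ^ 2) :
    IsAngloHellenic I := by
  have : Module.Finite k B := hM.finite
  have : Nontrivial B := by
    have := hM.finrank_eq
    exact Module.nontrivial_of_finrank_pos (R := k) (by omega)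
  obtain ⟨M⟩ : Nonempty (MaximalSpectrum B) := inferInstance
  have := M.isMaximal
  obtain ⟨x, hxM, hx⟩ := h M
  obtain ⟨t, htx, ht⟩ := exists_generator (k := k) M ⊥ (by simp) hxM (fun n b => by
    obtain ⟨c, hc⟩ := exists_sub_algebraMap_mem (k := k) M.asIdeal b
    obtain ⟨q, hq⟩ := exists_aeval_sub_mem_pow hxM hx n hc
    refine ⟨Polynomial.C c + q, 0, by simp, ?_⟩
    convert! hq using 1
    simp
    ring) (fun P _ => h P) 1
  have htM : t ∈ M.asIdeal := by
    rw [pow_one] at htx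
    simpa using add_mem htx hxM
  obtain ⟨m, e, he, -⟩ := exists_basis_pow (k := k) (r := 0) (t := t) (y := ![]) (fun b => by
    obtain ⟨q, y, hy, hb⟩ := ht b
    rw [Submodule.mem_bot] at hy
    exact ⟨q, 0, by simp [hb, hy]⟩) (fun _ _ _ => Subsingleton.elim _ _)
  have hm : m = 6 := by
    have := Module.finrank_eq_card_basis e
    rw [hM.finrank_eq] at this
    simpa using this.symm
  subst hm
  let f : Module.Basis (Fin 6) k B := e.reindex (Equiv.sumEmpty _ _)
  have hf (i : Fin 6) : f i = t ^ (i : ℕ) := by simp [f, he]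
  have h6 : f.repr (t ^ 6) 0 • t ^ 0 + f.repr (t ^ 6) 1 • t ^ 1 + f.repr (t ^ 6) 2 • t ^ 2 +
      f.repr (t ^ 6) 3 • t ^ 3 + f.repr (t ^ 6) 4 • t ^ 4 + f.repr (t ^ 6) 5 • t ^ 5 = t ^ 6 := by
    have h := f.sum_repr (t ^ 6)
    rw [Fin.sum_univ_six] at h
    simp only [hf] at h
    exact h
  -- The constant term is a multiple of t, hence a constant in M.
  have hc : f.repr (t ^ 6) 0 = 0 := by
    by_contra hne
    refine this.ne_top ((Ideal.eq_top_iff_one _).2 ?_)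
    have h1 : f.repr (t ^ 6) 0 • (1 : B) ∈ M.asIdeal := by
      have : f.repr (t ^ 6) 0 • (1 : B) = t * (t ^ 5 - f.repr (t ^ 6) 1 • 1 - f.repr (t ^ 6) 2 • t
          - f.repr (t ^ 6) 3 • t ^ 2 - f.repr (t ^ 6) 4 • t ^ 3 - f.repr (t ^ 6) 5 • t ^ 4) := by
        rw [← sub_eq_zero, ← sub_eq_zero.2 h6]
        simp only [Algebra.smul_def]
        ring
      rw [this]
      exact Ideal.mul_mem_right _ _ htM
    have h2 : (f.repr (t ^ 6) 0)⁻¹ • f.repr (t ^ 6) 0 • (1 : B) ∈ M.asIdeal :=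
      Submodule.smul_of_tower_mem M.asIdeal _ h1
    rwa [inv_smul_smul₀ hne] at h2
  refine hM.isAngloHellenic_of_curvilinear (fun i => -f.repr (t ^ 6) i.succ) hI f hf ?_
  rw [hc] at h6
  rw [← neg_eq_zero, ← sub_eq_zero.2 h6]
  simp only [Algebra.smul_def, map_neg, map_zero, Fin.succ_zero_eq_one, Fin.succ_one_eq_two,
    Fin.reduceSucc]
  ring

/-! ### Annihilators and socles in a Frobenius algebra -/

section FrobeniusForm

variable {k : Type u} [Field k] {B : Type u} [CommRing B] [Algebra k B]

/-- The pairing `(b, c) ↦ φ (b * c)`. -/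
noncomputable def frobeniusForm (φ : B →ₗ[k] k) : LinearMap.BilinForm k B :=
  (LinearMap.mul k B).compr₂ φ

@[simp]
theorem frobeniusForm_apply (φ : B →ₗ[k] k) (b c : B) : frobeniusForm φ b c = φ (b * c) := rfl

/-- If φ(Jb) = 0 then φ(Jb · c) = 0 for all c, because J is an ideal; nondegeneracy then gives Jb =
0. -/
theorem orthogonal_frobeniusForm {φ : B →ₗ[k] k}
    (hφ : ∀ b : B, (∀ c, φ (b * c) = 0) → b = 0) (J : Ideal B) :
    (frobeniusForm φ).orthogonal (J.restrictScalars k) = J.annihilator.restrictScalars k := by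
  ext b
  simp only [LinearMap.BilinForm.mem_orthogonal_iff, Submodule.restrictScalars_mem,
    frobeniusForm_apply, Submodule.mem_annihilator, smul_eq_mul]
  refine ⟨fun h n hn => hφ _ fun c => ?_, fun h n hn => ?_⟩
  · rw [mul_assoc, mul_comm]
    exact h _ (Ideal.mul_mem_right _ _ hn)
  · rw [mul_comm, h n hn, map_zero]

theorem nondegenerate_frobeniusForm {φ : B →ₗ[k] k}
    (hφ : ∀ b : B, (∀ c, φ (b * c) = 0) → b = 0) : (frobeniusForm φ).Nondegenerate :=
  ⟨fun b hb => hφ b hb, fun b hb => hφ b fun c => by rw [mul_comm]; exact hb c⟩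

theorem isRefl_frobeniusForm (φ : B →ₗ[k] k) : (frobeniusForm φ).IsRefl := fun b c h => by
  simpa [mul_comm] using h

variable [Module.Finite k B] {φ : B →ₗ[k] k}

theorem finrank_restrictScalars (k : Type u) {B : Type u} [Field k] [CommRing B] [Algebra k B]
    (J : Ideal B) : Module.finrank k (J.restrictScalars k) = Module.finrank k J := rfl

theorem finrank_annihilator (hφ : ∀ b : B, (∀ c, φ (b * c) = 0) → b = 0) (J : Ideal B) :
    Module.finrank k J.annihilator = Module.finrank k B - Module.finrank k J := by
  have h := LinearMap.BilinForm.finrank_orthogonal (nondegenerate_frobeniusForm hφ)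
    (J.restrictScalars k)
  rw [orthogonal_frobeniusForm hφ] at h
  exact h

theorem annihilator_annihilator_eq (hφ : ∀ b : B, (∀ c, φ (b * c) = 0) → b = 0) (J : Ideal B) :
    (Submodule.annihilator (Submodule.annihilator J)) = J := by
  have h := LinearMap.BilinForm.orthogonal_orthogonal (nondegenerate_frobeniusForm hφ)
    (isRefl_frobeniusForm φ) (J.restrictScalars k)
  rw [orthogonal_frobeniusForm hφ, orthogonal_frobeniusForm hφ] at h
  exact Submodule.restrictScalars_injective k _ _ h

theorem finrank_add_one_of_isMaximal [IsAlgClosed k] (M : Ideal B) [M.IsMaximal] :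
    Module.finrank k M + 1 = Module.finrank k B := by
  have h := Submodule.finrank_quotient_add_finrank (M.restrictScalars k)
  have h1 : Module.finrank k (B ⧸ M.restrictScalars k) = 1 := by
    have hne : (Submodule.Quotient.mk 1 : B ⧸ M.restrictScalars k) ≠ 0 := by
      rw [Ne, Submodule.Quotient.mk_eq_zero]
      exact (Ideal.ne_top_iff_one M).1 (Ideal.IsMaximal.ne_top ‹_›)
    refine (finrank_eq_one_iff_of_nonzero' _ hne).2 fun w => ?_
    obtain ⟨b, rfl⟩ := Submodule.Quotient.mk_surjective _ w
    obtain ⟨c, hc⟩ := exists_sub_algebraMap_mem (k := k) M b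
    refine ⟨c, ?_⟩
    rw [← Submodule.Quotient.mk_smul, eq_comm, Submodule.Quotient.eq, Algebra.smul_def, mul_one]
    exact hc
  rw [h1] at h
  rw [← h, add_comm]
  rfl

/-- `ζ` spans the annihilator of `M`, and is normalised by `φ`. -/
structure IsSocleGenerator (φ : B →ₗ[k] k) (M : Ideal B) (ζ : B) : Prop where
  map_eq_one : φ ζ = 1
  mul_eq_zero : ∀ m ∈ M, m * ζ = 0
  eq_smul : ∀ b, (∀ m ∈ M, m * b = 0) → b = φ b • ζ

/-- The annihilator of M has the dimension of B ⧸ M, which is one. B acts on it by scalars, so φ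
cannot vanish on it. -/
theorem exists_isSocleGenerator [IsAlgClosed k]
    (hφ : ∀ b : B, (∀ c, φ (b * c) = 0) → b = 0) (M : Ideal B) [M.IsMaximal] :
    ∃ ζ, IsSocleGenerator φ M ζ := by
  have h1 : Module.finrank k M.annihilator = 1 := by
    rw [finrank_annihilator hφ, ← finrank_add_one_of_isMaximal M]
    omega
  obtain ⟨⟨z, hz⟩, hz0, hzs⟩ := finrank_eq_one_iff'.1 h1
  have hz0 : z ≠ 0 := fun h => hz0 (Subtype.ext h)
  have hzM (m) (hm : m ∈ M) : m * z = 0 := by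
    rw [mul_comm]
    exact Submodule.mem_annihilator.1 hz m hm
  have hφz : φ z ≠ 0 := by
    refine fun h => hz0 (hφ z fun c => ?_)
    obtain ⟨a, ha⟩ := exists_sub_algebraMap_mem (k := k) M c
    have := hzM _ ha
    rw [sub_mul, sub_eq_zero, ← Algebra.smul_def] at this
    rw [mul_comm, this, map_smul, h, smul_zero]
  refine ⟨(φ z)⁻¹ • z, ?_, fun m hm => ?_, fun b hb => ?_⟩
  · rw [map_smul, smul_eq_mul, inv_mul_cancel₀ hφz]
  · rw [mul_smul_comm, hzM m hm, smul_zero]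
  · obtain ⟨c, hc⟩ := hzs ⟨b, Submodule.mem_annihilator.2 fun m hm => by
      rw [smul_eq_mul, mul_comm, hb m hm]⟩
    have hc : c • z = b := congrArg Subtype.val hc
    rw [← hc, map_smul, smul_smul, smul_eq_mul, mul_assoc, mul_inv_cancel₀ hφz, mul_one]

end FrobeniusForm

/-! ### Maximal ideals with a large cotangent space -/

section Cotangent

variable {k : Type u} [Field k] {B : Type u} [CommRing B] [Algebra k B]

variable (k) in
/-- `M` is spanned modulo its square by a single element. -/
def IsCotangentCyclic (M : Ideal B) : Prop :=
  ∃ p ∈ M, ∀ a ∈ M, ∃ c : k, a - c • p ∈ M ^ 2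

variable {φ : B →ₗ[k] k}

/-- An element killed by a power of M is supported at M: write 1 as a sum of elements of P^n and
M^j. -/
theorem mem_pow_of_mem_annihilator {M P : MaximalSpectrum B} (h : P ≠ M) {y : B} {j : ℕ}
    (hy : ∀ m ∈ M.asIdeal ^ j, y * m = 0) (n : ℕ) : y ∈ P.asIdeal ^ n := by
  obtain ⟨p, hp, m, hm, hpm⟩ := Ideal.isCoprime_iff_exists.1
    ((P.isCoprime_of_ne h).pow (m := n) (n := j))
  rw [← mul_one y, ← hpm, mul_add, hy m hm, add_zero]
  exact Ideal.mul_mem_left _ _ hp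

/-- An element v outside M which kills M² would map M to the line of ζ, with kernel inside M²
because v is invertible modulo M. Then M modulo M² would be at most a line. -/
theorem annihilator_sq_le {M : Ideal B} [M.IsMaximal] (hM : ¬IsCotangentCyclic k M) {ζ : B}
    (hζ : IsSocleGenerator φ M ζ) : (M ^ 2).annihilator ≤ M := by
  intro v hv
  by_contra hvM
  refine hM ?_
  rw [Submodule.mem_annihilator] at hv
  have hmul (m) (hm : m ∈ M) : v * m = φ (v * m) • ζ := hζ.eq_smul _ fun n hn => by
    rw [mul_left_comm]
    exact hv _ (by rw [pow_two]; exact Ideal.mul_mem_mul hn hm)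
  obtain ⟨u, m, hm, hu⟩ : ∃ u, ∃ m ∈ M, v * u = 1 - m := by
    obtain ⟨u, hu⟩ := Ideal.IsMaximal.exists_inv ‹M.IsMaximal› hvM
    obtain ⟨i, hi, h⟩ := hu
    exact ⟨u, i, hi, by rw [← h]; ring⟩
  have hker (a) (ha : a ∈ M) (h : v * a = 0) : a ∈ M ^ 2 := by
    have : a = m * a := by
      rw [← sub_eq_zero, ← one_sub_mul, ← hu, mul_right_comm, h, zero_mul]
    rw [this, pow_two]
    exact Ideal.mul_mem_mul hm ha
  by_cases h : ∀ a ∈ M, v * a = 0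
  · exact ⟨0, zero_mem _, fun a ha => ⟨0, by simpa using hker a ha (h a ha)⟩⟩
  · push Not at h
    obtain ⟨p, hp, hvp⟩ := h
    have hne : φ (v * p) ≠ 0 := fun h => hvp (by rw [hmul p hp, h, zero_smul])
    refine ⟨p, hp, fun a ha => ⟨φ (v * a) / φ (v * p), hker _ (sub_mem ha
      (Submodule.smul_of_tower_mem M _ hp)) ?_⟩⟩
    rw [mul_sub, mul_smul_comm, hmul p hp, hmul a ha]
    simp [hζ.map_eq_one, smul_smul, hne]

/-- The product is killed by M, hence lies on the socle line. -/
theorem mul_eq_smul_of_mem_annihilator_sq {M : Ideal B} [M.IsMaximal] {ζ : B}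
    (hζ : IsSocleGenerator φ M ζ) {y m : B} (hy : y ∈ (M ^ 2).annihilator) (hm : m ∈ M) :
    y * m = φ (y * m) • ζ :=
  hζ.eq_smul _ fun n hn => by
    rw [mul_left_comm]
    exact Submodule.mem_annihilator.1 hy _ (by rw [pow_two]; exact Ideal.mul_mem_mul hn hm)

theorem IsSocleGenerator.mem_annihilator_sq {M : Ideal B} {ζ : B}
    (hζ : IsSocleGenerator φ M ζ) : ζ ∈ (M ^ 2).annihilator :=
  Submodule.mem_annihilator.2 fun n hn => by
    rw [smul_eq_mul, mul_comm]
    exact hζ.mul_eq_zero n (Ideal.pow_le_self two_ne_zero hn)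

variable [Module.Finite k B]

/-- By duality it is enough that ζ is killed by the annihilator of M², which is contained in M. -/
theorem IsSocleGenerator.mem_sq (hφ : ∀ b : B, (∀ c, φ (b * c) = 0) → b = 0) {M : Ideal B}
    [M.IsMaximal] (hM : ¬IsCotangentCyclic k M) {ζ : B} (hζ : IsSocleGenerator φ M ζ) :
    ζ ∈ M ^ 2 := by
  rw [← annihilator_annihilator_eq hφ (M ^ 2), Submodule.mem_annihilator]
  intro n hn
  rw [smul_eq_mul, mul_comm]
  exact hζ.mul_eq_zero n (annihilator_sq_le hM hζ hn)

variable [IsAlgClosed k]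

theorem exists_sub_smul_mem {k V : Type*} [Field k] [AddCommGroup V] [Module k V]
    [Module.Finite k V] {U W : Submodule k V} (hUW : U ≤ W)
    (h : Module.finrank k W ≤ Module.finrank k U + 1) {p : V} (hp : p ∈ W) (hpU : p ∉ U)
    {a : V} (ha : a ∈ W) : ∃ c : k, a - c • p ∈ U := by
  have hs : U ⊔ Submodule.span k {p} = W := by
    refine Submodule.eq_of_le_of_finrank_le
      (sup_le hUW (Submodule.span_le.2 (by simpa using hp))) ?_
    have hlt : U < U ⊔ Submodule.span k {p} := by
      refine lt_of_le_of_ne le_sup_left fun h => hpU ?_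
      rw [h]
      exact Submodule.mem_sup_right (Submodule.mem_span_singleton_self p)
    have h1 := Submodule.finrank_lt_finrank_of_lt hlt
    omega
  rw [← hs] at ha
  obtain ⟨y, hy, z, hz, rfl⟩ := Submodule.mem_sup.1 ha
  obtain ⟨c, rfl⟩ := Submodule.mem_span_singleton.1 hz
  exact ⟨c, by simpa using hy⟩

theorem finrank_sq_add_two_le {M : Ideal B} [M.IsMaximal] (hM : ¬IsCotangentCyclic k M) :
    Module.finrank k ↥(M ^ 2) + 3 ≤ Module.finrank k B := by
  rw [← finrank_add_one_of_isMaximal M]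
  by_contra! hlt
  refine hM ?_
  by_cases h : M ≤ M ^ 2
  · exact ⟨0, zero_mem _, fun a ha => ⟨0, by simpa using h ha⟩⟩
  · obtain ⟨p, hp, hp2⟩ := Set.not_subset.1 h
    refine ⟨p, hp, fun a ha => ?_⟩
    refine exists_sub_smul_mem (U := (M ^ 2).restrictScalars k) (W := M.restrictScalars k)
      (Ideal.pow_le_self (I := M) two_ne_zero) ?_ hp hp2 ha
    rw [finrank_restrictScalars, finrank_restrictScalars]
    omega

/-- If both M and P were large, M² and P² would have codimension at least 3 and sum B, so their
intersection would be zero in dimension 6. But the socle generator at M lies in both. -/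
theorem isCotangentCyclic_of_ne (hB : Module.finrank k B ≤ 6)
    (hφ : ∀ b : B, (∀ c, φ (b * c) = 0) → b = 0) {M P : MaximalSpectrum B}
    (hM : ¬IsCotangentCyclic k M.asIdeal) (h : P ≠ M) : IsCotangentCyclic k P.asIdeal := by
  by_contra hP
  have := M.isMaximal
  have := P.isMaximal
  obtain ⟨ζ, hζ⟩ := exists_isSocleGenerator hφ M.asIdeal
  have h1 := finrank_sq_add_two_le hM
  have h2 := finrank_sq_add_two_le hP
  have h3 := Submodule.finrank_sup_add_finrank_inf_eq ((M.asIdeal ^ 2).restrictScalars k)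
    ((P.asIdeal ^ 2).restrictScalars k)
  have hsup : (M.asIdeal ^ 2).restrictScalars k ⊔ (P.asIdeal ^ 2).restrictScalars k = ⊤ := by
    rw [← Submodule.restrictScalars_sup, ← Ideal.add_eq_sup,
      Ideal.isCoprime_iff_add.1 (M.isCoprime_of_ne h.symm).pow, Ideal.one_eq_top]
    rfl
  rw [hsup, finrank_top, finrank_restrictScalars, finrank_restrictScalars] at h3
  have hbot := Submodule.finrank_eq_zero.1 (show Module.finrank k
    ↥((M.asIdeal ^ 2).restrictScalars k ⊓ (P.asIdeal ^ 2).restrictScalars k) = 0 by omega)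
  have hmem : ζ ∈ (M.asIdeal ^ 2).restrictScalars k ⊓ (P.asIdeal ^ 2).restrictScalars k :=
    ⟨hζ.mem_sq hφ hM, mem_pow_of_mem_annihilator h (j := 1) (fun m hm => by
      rw [mul_comm]
      exact hζ.mul_eq_zero m (by simpa using hm)) 2⟩
  rw [hbot, Submodule.mem_bot] at hmem
  simpa [hmem] using hζ.map_eq_one

end Cotangent

/-! ### Splitting off orthonormal vectors -/

variable {k : Type u} [Field k] [IsAlgClosed k] {B : Type u} [CommRing B] [Algebra k B]
  {φ : B →ₗ[k] k}

/-- Gram–Schmidt for the pairing on the annihilator of M², where products lie on the line of ζ. The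
radical of this pairing is the part inside M², so the vector n outside M² has a partner. -/
theorem exists_orthonormal_step (h2 : (2 : k) ≠ 0) [Module.Finite k B]
    (hφ : ∀ b : B, (∀ c, φ (b * c) = 0) → b = 0)
    {M : Ideal B} [M.IsMaximal] (hM : ¬IsCotangentCyclic k M) {ζ : B}
    (hζ : IsSocleGenerator φ M ζ) {r : ℕ} {y : Fin r → B} (hy : ∀ i, y i ∈ (M ^ 2).annihilator)
    (hyy : ∀ i j, y i * y j = if i = j then ζ else 0) {n : B} (hn : n ∈ (M ^ 2).annihilator)
    (hyn : ∀ i, φ (y i * n) = 0) (hnM : n ∉ M ^ 2) :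
    ∃ w ∈ (M ^ 2).annihilator, (∀ i, y i * w = 0) ∧ w * w = ζ := by
  have hle := annihilator_sq_le hM hζ
  have hyn (i) : y i * n = 0 := by
    rw [mul_eq_smul_of_mem_annihilator_sq hζ (hy i) (hle hn), hyn i, zero_smul]
  obtain ⟨n', hn', hnn'⟩ : ∃ n' ∈ (M ^ 2).annihilator, n * n' ≠ 0 := by
    by_contra! h
    refine hnM ?_
    rw [← annihilator_annihilator_eq hφ (M ^ 2), Submodule.mem_annihilator]
    exact h
  let u := n' - ∑ i, φ (y i * n') • y i
  have hu : u ∈ (M ^ 2).annihilator :=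
    sub_mem hn' (sum_mem fun i _ => Submodule.smul_of_tower_mem _ _ (hy i))
  have hyu (j) : y j * u = 0 := by
    simp only [u, mul_sub, Finset.mul_sum, mul_smul_comm, hyy, smul_ite, smul_zero,
      Finset.sum_ite_eq, Finset.mem_univ, if_true]
    rw [← mul_eq_smul_of_mem_annihilator_sq hζ (hy j) (hle hn'), sub_self]
  have hnu : n * u ≠ 0 := by
    have : n * u = n * n' := by
      simp only [u, mul_sub, Finset.mul_sum, mul_smul_comm, mul_comm n (y _), hyn, smul_zero,
        Finset.sum_const_zero, sub_zero]
    rwa [this]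
  -- Polarization: if `n`, `u` and `n + u` all had square zero, then `2 * n * u` would vanish.
  obtain ⟨w, hw, hyw, hww⟩ : ∃ w ∈ (M ^ 2).annihilator, (∀ i, y i * w = 0) ∧ w * w ≠ 0 := by
    by_contra! h
    have h1 := h n hn hyn
    have h3 := h u hu hyu
    have h4 := h (n + u) (add_mem hn hu) fun i => by rw [mul_add, hyn, hyu, add_zero]
    have h5 : (2 : k) • (n * u) = 0 := by
      rw [Algebra.smul_def, map_ofNat]
      linear_combination h4 - h1 - h3
    exact hnu ((smul_eq_zero.1 h5).resolve_left h2)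
  have hww' := mul_eq_smul_of_mem_annihilator_sq hζ hw (hle hw)
  have hne : φ (w * w) ≠ 0 := fun h => hww (by rw [hww', h, zero_smul])
  obtain ⟨a, ha⟩ : ∃ a, φ (w * w) = a := ⟨_, rfl⟩
  rw [ha] at hww' hne
  obtain ⟨s, hs⟩ := IsAlgClosed.exists_pow_nat_eq a⁻¹ two_pos
  refine ⟨s • w, Submodule.smul_of_tower_mem _ _ hw, fun i => by
    rw [mul_smul_comm, hyw, smul_zero], ?_⟩
  rw [smul_mul_smul_comm, ← pow_two s, hs, hww', smul_smul, inv_mul_cancel₀ hne, one_smul]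

theorem exists_orthonormal (h2 : (2 : k) ≠ 0) [Module.Finite k B]
    (hφ : ∀ b : B, (∀ c, φ (b * c) = 0) → b = 0)
    {M : Ideal B} [M.IsMaximal] (hM : ¬IsCotangentCyclic k M) {ζ : B}
    (hζ : IsSocleGenerator φ M ζ) {r : ℕ}
    (hr : Module.finrank k ↥(M ^ 2) + r ≤ Module.finrank k (M ^ 2).annihilator) :
    ∃ y : Fin r → B, (∀ i, y i ∈ (M ^ 2).annihilator) ∧
      ∀ i j, y i * y j = if i = j then ζ else 0 := by
  induction r with
  | zero => exact ⟨![], fun i => i.elim0, fun i => i.elim0⟩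
  | succ r ih =>
    obtain ⟨y, hy, hyy⟩ := ih (by omega)
    -- Orthogonality to r vectors imposes r conditions, which leaves a space of dimension greater
    -- than that of M².
    obtain ⟨n, hn, hyn, hnM⟩ : ∃ n ∈ (M ^ 2).annihilator,
        (∀ i, φ (y i * n) = 0) ∧ n ∉ M ^ 2 := by
      by_contra! h
      let N := (M ^ 2).annihilator.restrictScalars k
      let f : N →ₗ[k] Fin r → k :=
        (LinearMap.pi fun i => φ ∘ₗ LinearMap.mulLeft k (y i)) ∘ₗ N.subtype
      have h1 := f.finrank_range_add_finrank_ker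
      have h3 := Submodule.finrank_le (LinearMap.range f)
      have h4 : Module.finrank k (LinearMap.ker f) ≤
          Module.finrank k ((M ^ 2).restrictScalars k) := by
        rw [← Submodule.finrank_map_subtype_eq]
        refine Submodule.finrank_mono ?_
        rintro _ ⟨⟨n, hn⟩, hnf, rfl⟩
        exact h n hn fun i => congrFun (LinearMap.mem_ker.1 hnf) i
      rw [Module.finrank_fin_fun] at h3
      rw [finrank_restrictScalars] at h1 h4
      omega
    obtain ⟨w, hw, hyw, hww⟩ := exists_orthonormal_step h2 hφ hM hζ hy hyy hn hyn hnM
    refine ⟨Fin.snoc y w, fun i => ?_, fun i j => ?_⟩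
    · refine Fin.lastCases ?_ (fun i => ?_) i
      · simpa using hw
      · simpa using hy i
    · refine Fin.lastCases ?_ (fun i => ?_) i <;> refine Fin.lastCases ?_ (fun j => ?_) j
      · simpa using hww
      · simpa [mul_comm w, Fin.ext_iff, j.2.ne'] using hyw j
      · simpa [Fin.ext_iff, i.2.ne] using hyw i
      · simpa [Fin.ext_iff] using hyy i j

/-- The elements of M orthogonal to the y_i form an ideal M₀ complementary to their span in M. It
has the same square as M and is cyclic modulo this square by dimension, so one element generates
what the y_i leave over. -/
theorem exists_generator_of_orthonormal [Module.Finite k B]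
    (hB : Module.finrank k B = 6) (hφ : ∀ b : B, (∀ c, φ (b * c) = 0) → b = 0)
    {M : MaximalSpectrum B} (hM : ¬IsCotangentCyclic k M.asIdeal) {ζ : B}
    (hζ : IsSocleGenerator φ M.asIdeal ζ) {r : ℕ} {y : Fin r → B}
    (hy : ∀ i, y i ∈ (M.asIdeal ^ 2).annihilator)
    (hyy : ∀ i j, y i * y j = if i = j then ζ else 0)
    (hr : Module.finrank k ↥(M.asIdeal ^ 2) + r = 4) :
    ∃ t ∈ M.asIdeal, t ∉ M.asIdeal ^ 2 ∧ (∀ i, t * y i = 0) ∧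
      ∀ b, ∃ q : Polynomial k, ∃ c : Fin r → k, b = Polynomial.aeval t q + ∑ j, c j • y j := by
  have := M.isMaximal
  have hle := annihilator_sq_le hM hζ
  set M' := M.asIdeal with hM'
  let Y := Submodule.span k (Set.range y)
  let M₀ := M' ⊓ (Ideal.span (Set.range y)).annihilator
  have hdim := finrank_add_one_of_isMaximal (k := k) M'
  have hM₀ {a : B} : a ∈ M₀ ↔ a ∈ M' ∧ ∀ i, a * y i = 0 := by
    simp only [M₀, Ideal.mem_inf, Submodule.mem_annihilator_span, smul_eq_mul]
    simp
  have hdec (a) (ha : a ∈ M') : ∃ c : Fin r → k, a - ∑ i, c i • y i ∈ M₀ := by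
    refine ⟨fun i => φ (y i * a), hM₀.2 ⟨sub_mem ha (sum_mem fun i _ =>
      Submodule.smul_of_tower_mem _ _ (hle (hy i))), fun j => ?_⟩⟩
    simp only [sub_mul, Finset.sum_mul, smul_mul_assoc, hyy, smul_ite, smul_zero,
      Finset.sum_ite_eq', Finset.mem_univ, if_true]
    rw [← mul_eq_smul_of_mem_annihilator_sq hζ (hy j) ha, mul_comm, sub_self]
  -- Otherwise M² and the r vectors, together of dimension at most 4, would span M, of dimension 5.
  have hnle : ¬M₀ ≤ M' ^ 2 := by
    intro h
    have h1 : M'.restrictScalars k ≤ (M' ^ 2).restrictScalars k ⊔ Y := by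
      intro a ha
      obtain ⟨c, hc⟩ := hdec a ha
      rw [← sub_add_cancel a (∑ i, c i • y i)]
      exact Submodule.add_mem_sup (h hc) (sum_mem fun i _ =>
        Submodule.smul_mem _ _ (Submodule.subset_span ⟨i, rfl⟩))
    have h3 := Submodule.finrank_mono h1
    have h4 := Submodule.finrank_add_le_finrank_add_finrank ((M' ^ 2).restrictScalars k) Y
    have h5 : Module.finrank k Y ≤ r := by
      simpa [Set.finrank] using finrank_range_le_card (R := k) y
    rw [finrank_restrictScalars] at h3 h4
    omega
  -- By duality it suffices that everything killing M₀² lies in M. An element outside M which kills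
  -- M₀² sends M₀ into the socle line, and being invertible modulo M it would force M₀ into M².
  have hζ₀ : ζ ∈ M₀ ^ 2 := by
    rw [← annihilator_annihilator_eq hφ (M₀ ^ 2), Submodule.mem_annihilator]
    intro v hv
    rw [Submodule.mem_annihilator] at hv
    suffices v ∈ M' by
      rw [smul_eq_mul, mul_comm]
      exact hζ.mul_eq_zero v this
    by_contra hvM
    refine hnle fun a ha => ?_
    obtain ⟨u, m, hm, hu⟩ := Ideal.IsMaximal.exists_inv ‹M'.IsMaximal› hvM
    have hva : v * a = φ (v * a) • ζ := by
      refine hζ.eq_smul _ fun b hb => ?_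
      obtain ⟨c, hc⟩ := hdec b hb
      have h1 : v * (a * (b - ∑ i, c i • y i)) = 0 :=
        hv _ (by rw [pow_two]; exact Ideal.mul_mem_mul ha hc)
      rw [mul_sub, Finset.mul_sum] at h1
      simp only [mul_smul_comm, (hM₀.1 ha).2, smul_zero, Finset.sum_const_zero, sub_zero] at h1
      rw [mul_comm, mul_assoc, h1]
    have : a = u * (v * a) + m * a := by
      linear_combination -a * hu
    rw [this, hva]
    refine add_mem (Ideal.mul_mem_left _ _ (Submodule.smul_of_tower_mem _ _ (hζ.mem_sq hφ hM))) ?_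
    rw [pow_two]
    exact Ideal.mul_mem_mul hm (hM₀.1 ha).1
  -- A product of two elements of M differs from one of elements of M₀ by a multiple of ζ.
  have hsq : M₀ ^ 2 = M' ^ 2 := by
    refine le_antisymm (Ideal.pow_right_mono inf_le_left _) ?_
    rw [pow_two M', Ideal.mul_le]
    intro a ha b hb
    obtain ⟨c, hc⟩ := hdec a ha
    obtain ⟨d, hd⟩ := hdec b hb
    have h1 : (∑ i, c i • y i) * ∑ j, d j • y j = (∑ i, c i * d i) • ζ := by
      simp [Finset.sum_mul_sum, hyy, smul_smul, Finset.sum_smul, mul_comm]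
    have h3 : a * b = (a - ∑ i, c i • y i) * (b - ∑ j, d j • y j) + (∑ i, c i * d i) • ζ := by
      have h4 : (a - ∑ i, c i • y i) * ∑ j, d j • y j = 0 := by
        simp [Finset.mul_sum, (hM₀.1 hc).2]
      have h5 : (b - ∑ i, d i • y i) * ∑ j, c j • y j = 0 := by
        simp [Finset.mul_sum, (hM₀.1 hd).2]
      linear_combination h1 + h4 + h5
    rw [h3]
    refine add_mem ?_ (Submodule.smul_of_tower_mem _ _ hζ₀)
    rw [pow_two]
    exact Ideal.mul_mem_mul hc hd
  have hdim₀ : Module.finrank k M₀ + r ≤ Module.finrank k M' := by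
    let f : (M₀.restrictScalars k) × (Fin r → k) →ₗ[k] B :=
      (M₀.restrictScalars k).subtype.coprod (Fintype.linearCombination k y)
    have hf : Function.Injective f := by
      rw [← LinearMap.ker_eq_bot, LinearMap.ker_eq_bot']
      rintro ⟨⟨a, ha⟩, c⟩ h
      have h : a + ∑ i, c i • y i = 0 := h
      have hc : c = 0 := by
        funext j
        have h1 := congrArg (· * y j) h
        simp only [add_mul, (hM₀.1 ha).2, Finset.sum_mul, smul_mul_assoc, hyy, smul_ite, smul_zero,
          Finset.sum_ite_eq', Finset.mem_univ, if_true, zero_add, zero_mul] at h1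
        have h3 := congrArg φ h1
        simpa [hζ.map_eq_one] using h3
      subst hc
      have : a = 0 := by simpa using h
      subst this
      rfl
    have h1 := LinearMap.finrank_range_of_inj hf
    have h3 : LinearMap.range f ≤ M'.restrictScalars k := by
      rintro _ ⟨⟨⟨a, ha⟩, c⟩, rfl⟩
      change a + ∑ i, c i • y i ∈ M'
      exact add_mem (hM₀.1 ha).1 (sum_mem fun i _ =>
        Submodule.smul_of_tower_mem _ _ (hle (hy i)))
    have h4 := Submodule.finrank_mono h3
    rw [h1, Module.finrank_prod, Module.finrank_fin_fun, finrank_restrictScalars,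
      finrank_restrictScalars] at h4
    exact h4
  obtain ⟨x, hx, hx2⟩ := Set.not_subset.1 hnle
  have hx2 : x ∉ M' ^ 2 := hx2
  have hcyc (a) (ha : a ∈ M₀) : ∃ c : k, a - c • x ∈ M₀ ^ 2 := by
    refine exists_sub_smul_mem (U := (M₀ ^ 2).restrictScalars k) (W := M₀.restrictScalars k)
      (Ideal.pow_le_self (I := M₀) two_ne_zero) ?_ hx (by rw [hsq]; exact hx2) ha
    rw [finrank_restrictScalars, finrank_restrictScalars, hsq]
    omega
  -- Agreement with x modulo M² is enough for t to kill every y_i, because the y_i kill M².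
  obtain ⟨t, htx, ht⟩ := exists_generator (k := k) M Y (fun P hP n z hz =>
      mem_pow_of_mem_annihilator hP (j := 2) (fun m hm => by
        have : Y ≤ (M' ^ 2).annihilator.restrictScalars k :=
          Submodule.span_le.2 (by rintro _ ⟨i, rfl⟩; exact hy i)
        exact Submodule.mem_annihilator.1 (this hz) m hm) n)
    (hM₀.1 hx).1 (fun n b => by
      obtain ⟨c, hc⟩ := exists_sub_algebraMap_mem (k := k) M' b
      obtain ⟨d, hd⟩ := hdec _ hc
      obtain ⟨q, hq⟩ := exists_aeval_sub_mem_pow hx hcyc n hd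
      refine ⟨Polynomial.C c + q, ∑ i, d i • y i, sum_mem fun i _ =>
        Submodule.smul_mem _ _ (Submodule.subset_span ⟨i, rfl⟩), ?_⟩
      convert! Ideal.pow_right_mono (inf_le_left : M₀ ≤ M') n hq using 1
      simp
      ring)
    (fun P hP => isCotangentCyclic_of_ne hB.le hφ hM hP) 2
  rw [← hM'] at htx
  refine ⟨t, ?_, fun h => hx2 ?_, fun i => ?_, fun b => ?_⟩
  · rw [← sub_add_cancel t x]
    exact add_mem (Ideal.pow_le_self two_ne_zero htx) (hM₀.1 hx).1
  · rw [← sub_sub_cancel t x]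
    exact sub_mem h htx
  · rw [← sub_add_cancel t x, add_mul, (hM₀.1 hx).2, add_zero, mul_comm]
    exact Submodule.mem_annihilator.1 (hy i) _ htx
  · obtain ⟨q, z, hz, hb⟩ := ht b
    obtain ⟨c, rfl⟩ := (Submodule.mem_span_range_iff_exists_fun k).1 hz
    exact ⟨q, c, hb⟩

/-! ### Algebras with orthonormal vectors: reduction to the first three families -/

variable {k : Type u} [Field k] {I : Ideal (MvPolynomial (Fin 5) k)}
  {B : Type u} [CommRing B] [Algebra k B] {φ : B →ₗ[k] k} {v : Fin 5 → B}

theorem eq_zero_of_smul_one_mem {M : Ideal B} [M.IsMaximal] {c : k} (h : c • (1 : B) ∈ M) :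
    c = 0 := by
  by_contra hc
  have h2 : c⁻¹ • c • (1 : B) ∈ M := Submodule.smul_of_tower_mem _ _ h
  rw [inv_smul_smul₀ hc] at h2
  exact (Ideal.ne_top_iff_one M).1 (Ideal.IsMaximal.ne_top ‹_›) h2

theorem eq_zero_of_smul_mem {M : Ideal B} {t : B} (ht : t ∉ M) {c : k} (h : c • t ∈ M) :
    c = 0 := by
  by_contra hc
  have h2 : c⁻¹ • c • t ∈ M := Submodule.smul_of_tower_mem _ _ h
  rw [inv_smul_smul₀ hc] at h2
  exact ht h2

/-- The constant term of ζ vanishes since ζ is in M. Multiplying by y_j kills everything except the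
coefficient of y_j. -/
theorem IsSocleGenerator.coeff_eq_zero {M : Ideal B} [M.IsMaximal] {ζ : B}
    (hM : ¬IsCotangentCyclic k M) (hζ : IsSocleGenerator φ M ζ) {r : ℕ} {y : Fin r → B}
    (hy : ∀ i, y i ∈ (M ^ 2).annihilator) (hyy : ∀ i j, y i * y j = if i = j then ζ else 0)
    {t p : B} (ht : t ∈ M) (hty : ∀ i, t * y i = 0) (hζM : ζ ∈ M) {c : k} {d : Fin r → k}
    (h : ζ = c • 1 + t * p + ∑ i, d i • y i) : c = 0 ∧ d = 0 := by
  have hyM (i) := annihilator_sq_le hM hζ (hy i)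
  have hc : c = 0 := by
    refine eq_zero_of_smul_one_mem (M := M) ?_
    have : c • (1 : B) = ζ - (t * p + ∑ i, d i • y i) := by
      rw [h]
      ring
    rw [this]
    exact sub_mem hζM (add_mem (Ideal.mul_mem_right _ _ ht)
      (sum_mem fun i _ => Submodule.smul_of_tower_mem _ _ (hyM i)))
  refine ⟨hc, funext fun j => ?_⟩
  have h1 := congrArg (· * y j) h
  simp only [hc, zero_smul, zero_add, add_mul, mul_right_comm t p, hty, zero_mul, Finset.sum_mul,
    smul_mul_assoc, hyy, smul_ite, smul_zero, Finset.sum_ite_eq', Finset.mem_univ, if_true] at h1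
  rw [mul_comm, hζ.mul_eq_zero _ (hyM j)] at h1
  simpa [hζ.map_eq_one] using (congrArg φ h1).symm

/-- The linear term is the only one that could lie outside M². -/
theorem linear_coeff_eq_zero {M : Ideal B} {ζ : B} (hζ : ζ ∈ M ^ 2) {t p : B}
    (ht : t ∈ M) (ht2 : t ∉ M ^ 2) {c : k} (h : ζ = c • t + t ^ 2 * p) : c = 0 := by
  refine eq_zero_of_smul_mem ht2 ?_
  rw [← sub_eq_iff_eq_add.2 h]
  exact sub_mem hζ (Ideal.mul_mem_right _ _ (Ideal.pow_mem_pow ht 2))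

variable [IsAlgClosed k]

theorem exists_basis_of_orthonormal [Module.Finite k B]
    (hB : Module.finrank k B = 6) (hφ : ∀ b : B, (∀ c, φ (b * c) = 0) → b = 0)
    {M : MaximalSpectrum B} (hM : ¬IsCotangentCyclic k M.asIdeal) {ζ : B}
    (hζ : IsSocleGenerator φ M.asIdeal ζ) {r : ℕ} {y : Fin r → B}
    (hy : ∀ i, y i ∈ (M.asIdeal ^ 2).annihilator)
    (hyy : ∀ i j, y i * y j = if i = j then ζ else 0)
    (hr : Module.finrank k ↥(M.asIdeal ^ 2) + r = 4) :
    ∃ t ∈ M.asIdeal, t ∉ M.asIdeal ^ 2 ∧ (∀ i, t * y i = 0) ∧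
      ∃ (m : ℕ) (e : Module.Basis (Fin m ⊕ Fin r) k B), m + r = 6 ∧
        (∀ i : Fin m, e (Sum.inl i) = t ^ (i : ℕ)) ∧ ∀ j, e (Sum.inr j) = y j := by
  have := M.isMaximal
  have : Nontrivial B := Module.nontrivial_of_finrank_pos (R := k) (by omega)
  have hle := annihilator_sq_le hM hζ
  obtain ⟨t, htM, ht2, hty, ht⟩ := exists_generator_of_orthonormal hB hφ hM hζ hy hyy hr
  obtain ⟨m, e, he⟩ := exists_basis_pow ht fun q c h => by
    have hq : Polynomial.aeval t q = t * Polynomial.aeval t q.divX + q.coeff 0 • 1 := by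
      have := congrArg (Polynomial.aeval t) (Polynomial.divX_mul_X_add q)
      rw [map_add, map_mul, Polynomial.aeval_X, Polynomial.aeval_C] at this
      rw [← this, Algebra.smul_def, mul_one, mul_comm t]
    have h0 : q.coeff 0 = 0 := by
      refine eq_zero_of_smul_one_mem (M := M.asIdeal) ?_
      rw [← sub_eq_iff_eq_add'.2 hq, h]
      exact sub_mem (sum_mem fun i _ => Submodule.smul_of_tower_mem _ _ (hle (hy i)))
        (Ideal.mul_mem_right _ _ htM)
    funext j
    have h1 := congrArg (· * y j) h
    simp only [hq, h0, zero_smul, add_zero, mul_right_comm t _ (y j), hty, zero_mul,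
      Finset.sum_mul, smul_mul_assoc, hyy, smul_ite, smul_zero,
      Finset.sum_ite_eq', Finset.mem_univ, if_true] at h1
    simpa [hζ.map_eq_one] using (congrArg φ h1).symm
  refine ⟨t, htM, ht2, hty, m, e, ?_, he⟩
  have := Module.finrank_eq_card_basis e
  rw [hB] at this
  simpa using this.symm

/-- In the basis 1, t, …, t⁴, y the socle generator is a combination of t², t³, t⁴. Rescaling y
makes its square the monic multiple, which is the presentation of the quartic family. -/
theorem IsFrobeniusModel.isAngloHellenic_of_finrank_sq_eq_three (hI : IsHilbAGZero 4 6 I)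
    (hF : IsFrobeniusModel I φ v) {M : MaximalSpectrum B} (hM : ¬IsCotangentCyclic k M.asIdeal)
    {ζ : B} (hζ : IsSocleGenerator φ M.asIdeal ζ) {y : B} (hy : y ∈ (M.asIdeal ^ 2).annihilator)
    (hyy : y * y = ζ) (h3 : Module.finrank k ↥(M.asIdeal ^ 2) = 3) : IsAngloHellenic I := by
  have := hF.finite
  have := M.isMaximal
  obtain ⟨t, htM, ht2, hty, m, e, hm, hel, her⟩ := exists_basis_of_orthonormal (r := 1)
    (y := fun _ => y) hF.finrank_eq hF.nondegenerate hM hζ (fun _ => hy)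
    (fun i j => by simp [hyy, Subsingleton.elim i j]) (by omega)
  obtain rfl : m = 5 := by omega
  have hty : t * y = 0 := hty 0
  let f : Module.Basis (Fin 6) k B := e.reindex (finSumFinEquiv (m := 5) (n := 1))
  have h0 : f 0 = 1 := (e.reindex_apply _ _).trans ((hel 0).trans (pow_zero t))
  have h1 : f 1 = t := (e.reindex_apply _ _).trans ((hel 1).trans (pow_one t))
  have h2 : f 2 = t ^ 2 := (e.reindex_apply _ _).trans (hel 2)
  have h3 : f 3 = t ^ 3 := (e.reindex_apply _ _).trans (hel 3)
  have h4 : f 4 = t ^ 4 := (e.reindex_apply _ _).trans (hel 4)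
  have h5 : f 5 = y := (e.reindex_apply _ _).trans (her 0)
  have hsum := f.sum_repr ζ
  rw [Fin.sum_univ_six, h0, h1, h2, h3, h4, h5] at hsum
  generalize f.repr ζ = c at hsum
  have hζ2 := hζ.mem_sq hF.nondegenerate hM
  obtain ⟨hc0, hc5⟩ := hζ.coeff_eq_zero hM (r := 1) (y := fun _ => y) (fun _ => hy)
    (fun i j => by simp [hyy, Subsingleton.elim i j]) htM (fun _ => hty)
    (Ideal.pow_le_self two_ne_zero hζ2) (c := c 0) (d := fun _ => c 5)
    (p := c 1 • 1 + c 2 • t + c 3 • t ^ 2 + c 4 • t ^ 3) (by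
      rw [← hsum]
      simp only [Algebra.smul_def, Finset.univ_unique, Finset.sum_singleton]
      ring)
  have hc5 : c 5 = 0 := congrFun hc5 0
  have hc1 : c 1 = 0 := linear_coeff_eq_zero hζ2 htM ht2
    (p := c 2 • 1 + c 3 • t + c 4 • t ^ 2) (by
      rw [← hsum, hc0, hc5]
      simp only [Algebra.smul_def, map_zero]
      ring)
  rw [hc0, hc1, hc5, zero_smul, zero_smul, zero_smul, zero_add, zero_add, add_zero] at hsum
  have htζ : t * (c 2 • t ^ 2 + c 3 • t ^ 3 + c 4 • t ^ 4) = 0 := by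
    rw [hsum]
    exact hζ.mul_eq_zero t htM
  -- Without the term t⁴, the relation t ζ = 0 would be a linear relation between t³ and t⁴, forcing
  -- ζ = 0.
  have hc4 : c 4 ≠ 0 := by
    intro hc4
    have h6 : c 2 • f 3 + c 3 • f 4 = 0 := by
      rw [h3, h4, ← htζ, hc4]
      simp only [Algebra.smul_def, map_zero]
      ring
    have h7 : c 2 = 0 := by simpa using congrArg (f.coord 3) h6
    have h8 : c 3 = 0 := by simpa using congrArg (f.coord 4) h6
    rw [hc4, h7, h8] at hsum
    simpa [← hsum] using hζ.map_eq_one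
  -- The scaling for which `(s • y) ^ 2` is ζ divided by its leading coefficient.
  obtain ⟨s, hs⟩ := IsAlgClosed.exists_pow_nat_eq (c 4)⁻¹ two_pos
  have hs0 : s ≠ 0 := by
    rintro rfl
    exact inv_ne_zero hc4 (by rw [← hs]; simp)
  let w : Fin 6 → k := ![1, 1, 1, 1, 1, s]
  let g : Module.Basis (Fin 6) k B := f.isUnitSMul (w := w) fun i => by
    fin_cases i <;> simp [w, hs0]
  have hg (i) : g i = w i • f i := Module.Basis.isUnitSMul_apply _ _
  have g0 : g 0 = 1 := by rw [hg, h0]; exact one_smul _ _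
  have g1 : g 1 = t := by rw [hg, h1]; exact one_smul _ _
  have g2 : g 2 = t ^ 2 := by rw [hg, h2]; exact one_smul _ _
  have g3 : g 3 = t ^ 3 := by rw [hg, h3]; exact one_smul _ _
  have g4 : g 4 = t ^ 4 := by rw [hg, h4]; exact one_smul _ _
  have g5 : g 5 = s • y := by rw [hg, h5]; rfl
  have key : t ^ 4 + (c 3 / c 4) • t ^ 3 + (c 2 / c 4) • t ^ 2 = (c 4)⁻¹ • ζ := by
    rw [← hsum, smul_add, smul_add, smul_smul, smul_smul, smul_smul, inv_mul_cancel₀ hc4, one_smul,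
      div_eq_inv_mul, div_eq_inv_mul]
    abel
  refine hF.isAngloHellenic_of_quartic (c 3 / c 4) (c 2 / c 4) hI g g0 ?_ ?_ ?_ ?_ ?_ ?_
  · rw [g1, g2]; ring
  · rw [g1, g2, g3]; ring
  · rw [g1, g3, g4]; ring
  · rw [g1, g2, g3, g4, key, mul_smul_comm, hζ.mul_eq_zero t htM, smul_zero]
  · rw [g1, g5, mul_smul_comm, hty, smul_zero]
  · rw [g2, g3, g4, g5, key, smul_mul_smul_comm, hyy, ← pow_two, hs]

/-- The annihilator of M² has dimension 4, which leaves room for two orthonormal vectors; 1, t, t²,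
t³ complete the basis, and ζ is a combination of t² and t³. -/
theorem IsFrobeniusModel.isAngloHellenic_of_finrank_sq_eq_two (hk : (2 : k) ≠ 0)
    (hI : IsHilbAGZero 4 6 I) (hF : IsFrobeniusModel I φ v) {M : MaximalSpectrum B}
    (hM : ¬IsCotangentCyclic k M.asIdeal) {ζ : B} (hζ : IsSocleGenerator φ M.asIdeal ζ)
    (h : Module.finrank k ↥(M.asIdeal ^ 2) = 2) : IsAngloHellenic I := by
  have := hF.finite
  have := M.isMaximal
  obtain ⟨y, hy, hyy⟩ := exists_orthonormal hk hF.nondegenerate hM hζ (r := 2) (by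
    rw [finrank_annihilator hF.nondegenerate, hF.finrank_eq]
    omega)
  obtain ⟨t, htM, ht2, hty, m, e, hm, hel, her⟩ :=
    exists_basis_of_orthonormal hF.finrank_eq hF.nondegenerate hM hζ hy hyy (by omega)
  obtain rfl : m = 4 := by omega
  let f : Module.Basis (Fin 6) k B := e.reindex (finSumFinEquiv (m := 4) (n := 2))
  have h0 : f 0 = 1 := (e.reindex_apply _ _).trans ((hel 0).trans (pow_zero t))
  have h1 : f 1 = t := (e.reindex_apply _ _).trans ((hel 1).trans (pow_one t))
  have h2 : f 2 = t ^ 2 := (e.reindex_apply _ _).trans (hel 2)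
  have h3 : f 3 = t ^ 3 := (e.reindex_apply _ _).trans (hel 3)
  have h4 : f 4 = y 0 := (e.reindex_apply _ _).trans (her 0)
  have h5 : f 5 = y 1 := (e.reindex_apply _ _).trans (her 1)
  have hsum := f.sum_repr ζ
  rw [Fin.sum_univ_six, h0, h1, h2, h3, h4, h5] at hsum
  generalize f.repr ζ = c at hsum
  have hζ2 := hζ.mem_sq hF.nondegenerate hM
  obtain ⟨hc0, hd⟩ := hζ.coeff_eq_zero hM hy hyy htM hty (Ideal.pow_le_self two_ne_zero hζ2)
    (c := c 0) (d := ![c 4, c 5]) (p := c 1 • 1 + c 2 • t + c 3 • t ^ 2) (by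
      rw [← hsum, Fin.sum_univ_two]
      simp only [Algebra.smul_def, Matrix.cons_val_zero, Matrix.cons_val_one]
      ring)
  have hc4 : c 4 = 0 := congrFun hd 0
  have hc5 : c 5 = 0 := congrFun hd 1
  have hc1 : c 1 = 0 := linear_coeff_eq_zero hζ2 htM ht2 (p := c 2 • 1 + c 3 • t) (by
    rw [← hsum, hc0, hc4, hc5]
    simp only [Algebra.smul_def, map_zero]
    ring)
  rw [hc0, hc1, hc4, hc5, zero_smul, zero_smul, zero_smul, zero_smul, zero_add, zero_add,
    add_zero, add_zero] at hsum
  have htζ : t * (c 2 • t ^ 2 + c 3 • t ^ 3) = 0 := by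
    rw [hsum]
    exact hζ.mul_eq_zero t htM
  have hc3 : c 3 ≠ 0 := by
    intro hc3
    have h6 : c 2 • f 3 = 0 := by
      rw [h3, ← htζ, hc3]
      simp only [Algebra.smul_def, map_zero]
      ring
    have h7 : c 2 = 0 := by simpa using congrArg (f.coord 3) h6
    rw [hc3, h7] at hsum
    simpa [← hsum] using hζ.map_eq_one
  obtain ⟨s, hs⟩ := IsAlgClosed.exists_pow_nat_eq (c 3)⁻¹ two_pos
  have hs0 : s ≠ 0 := by
    rintro rfl
    exact inv_ne_zero hc3 (by rw [← hs]; simp)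
  let w : Fin 6 → k := ![1, 1, 1, 1, s, s]
  let g : Module.Basis (Fin 6) k B := f.isUnitSMul (w := w) fun i => by
    fin_cases i <;> simp [w, hs0]
  have hg (i) : g i = w i • f i := Module.Basis.isUnitSMul_apply _ _
  have g0 : g 0 = 1 := by rw [hg, h0]; exact one_smul _ _
  have g1 : g 1 = t := by rw [hg, h1]; exact one_smul _ _
  have g2 : g 2 = t ^ 2 := by rw [hg, h2]; exact one_smul _ _
  have g3 : g 3 = t ^ 3 := by rw [hg, h3]; exact one_smul _ _
  have g4 : g 4 = s • y 0 := by rw [hg, h4]; rfl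
  have g5 : g 5 = s • y 1 := by rw [hg, h5]; rfl
  have key : t ^ 3 + (c 2 / c 3) • t ^ 2 = (c 3)⁻¹ • ζ := by
    rw [← hsum, smul_add, smul_smul, smul_smul, inv_mul_cancel₀ hc3, one_smul, div_eq_inv_mul]
    abel
  have hs' (i : Fin 2) : s • y i * s • y i = (c 3)⁻¹ • ζ := by
    rw [smul_mul_smul_comm, hyy, if_pos rfl, ← pow_two, hs]
  refine hF.isAngloHellenic_of_cubic (c 2 / c 3) hI g g0 ?_ ?_ ?_ ?_ ?_ ?_ ?_ ?_
  · rw [g1, g2]; ring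
  · rw [g1, g2, g3]; ring
  · rw [g1, g2, g3, key, mul_smul_comm, hζ.mul_eq_zero t htM, smul_zero]
  · rw [g1, g4, mul_smul_comm, hty, smul_zero]
  · rw [g1, g5, mul_smul_comm, hty, smul_zero]
  · rw [g2, g3, g4, key, hs']
  · rw [g2, g3, g5, key, hs']
  · rw [g4, g5, smul_mul_smul_comm, hyy, if_neg (by decide), smul_zero]

/-- The annihilator of M² has dimension at least 5, which leaves room for four orthonormal vectors;
with 1 and ζ they form a basis. -/
theorem IsFrobeniusModel.isAngloHellenic_of_finrank_sq_le_one (hk : (2 : k) ≠ 0)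
    (hI : IsHilbAGZero 4 6 I) (hF : IsFrobeniusModel I φ v) {M : MaximalSpectrum B}
    (hM : ¬IsCotangentCyclic k M.asIdeal) {ζ : B} (hζ : IsSocleGenerator φ M.asIdeal ζ)
    (h : Module.finrank k ↥(M.asIdeal ^ 2) ≤ 1) : IsAngloHellenic I := by
  have := hF.finite
  have := M.isMaximal
  obtain ⟨y, hy, hyy⟩ := exists_orthonormal hk hF.nondegenerate hM hζ (r := 4) (by
    rw [finrank_annihilator hF.nondegenerate, hF.finrank_eq]
    omega)
  have hyM (i) := annihilator_sq_le hM hζ (hy i)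
  have hζM : ζ ∈ M.asIdeal := Ideal.pow_le_self two_ne_zero (hζ.mem_sq hF.nondegenerate hM)
  have hyζ (i) : y i * ζ = 0 := hζ.mul_eq_zero _ (hyM i)
  have hli : LinearIndependent k ![1, y 0, y 1, y 2, y 3, ζ] := by
    rw [Fintype.linearIndependent_iff]
    intro g hg
    simp only [Fin.sum_univ_six, Matrix.cons_val_zero, Matrix.cons_val_one, Matrix.cons_val] at hg
    have g0 : g 0 = 0 := by
      refine eq_zero_of_smul_one_mem (M := M.asIdeal) ?_
      have : g 0 • (1 : B) =
          -(g 1 • y 0 + g 2 • y 1 + g 3 • y 2 + g 4 • y 3 + g 5 • ζ) := by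
        rw [← sub_eq_zero, ← hg]
        abel
      rw [this]
      have hs {a : B} (d : k) (ha : a ∈ M.asIdeal) : d • a ∈ M.asIdeal :=
        Submodule.smul_of_tower_mem _ _ ha
      exact neg_mem (add_mem (add_mem (add_mem (add_mem (hs _ (hyM 0)) (hs _ (hyM 1)))
        (hs _ (hyM 2))) (hs _ (hyM 3))) (hs _ hζM))
    rw [g0, zero_smul, zero_add] at hg
    have key (j : Fin 4) :
        φ (y j * (g 1 • y 0 + g 2 • y 1 + g 3 • y 2 + g 4 • y 3 + g 5 • ζ)) = 0 := by
      rw [hg, mul_zero, map_zero]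
    have g1 : g 1 = 0 := by simpa [mul_add, hyy, hyζ, hζ.map_eq_one] using key 0
    have g2 : g 2 = 0 := by simpa [mul_add, hyy, hyζ, hζ.map_eq_one] using key 1
    have g3 : g 3 = 0 := by simpa [mul_add, hyy, hyζ, hζ.map_eq_one] using key 2
    have g4 : g 4 = 0 := by simpa [mul_add, hyy, hyζ, hζ.map_eq_one] using key 3
    have g5 : g 5 = 0 := by
      have := congrArg φ hg
      simpa [g1, g2, g3, g4, hζ.map_eq_one] using this
    intro i
    fin_cases i <;> assumption
  have hcard : Fintype.card (Fin 6) = Module.finrank k B := by rw [hF.finrank_eq]; rfl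
  let e := basisOfLinearIndependentOfCardEqFinrank hli hcard
  have he (i) : e i = ![1, y 0, y 1, y 2, y 3, ζ] i := by
    simp [e]
  have e0 : e 0 = 1 := he 0
  have e1 : e 1 = y 0 := he 1
  have e2 : e 2 = y 1 := he 2
  have e3 : e 3 = y 2 := he 3
  have e4 : e 4 = y 3 := he 4
  have e5 : e 5 = ζ := he 5
  have hsq (i) : y i * y i = ζ := by rw [hyy, if_pos rfl]
  have hne {i j} (h : i ≠ j) : y i * y j = 0 := by rw [hyy, if_neg h]
  refine hF.isAngloHellenic_of_orthonormal hI e e0 ?_ ?_ ?_ ?_ ?_ ?_ ?_ ?_ ?_ ?_ ?_ ?_ ?_ ?_ <;>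
    simp only [e1, e2, e3, e4, e5, hsq, hyζ] <;> exact hne (by decide)

/-! ### The case where M² is its own annihilator -/

variable {k : Type u} [Field k] {I : Ideal (MvPolynomial (Fin 5) k)}
  {B : Type u} [CommRing B] [Algebra k B] {φ : B →ₗ[k] k} {v : Fin 5 → B}

variable (k) in
/-- `x` and `y` span `M` modulo its square. -/
structure IsCotangentPair (M : Ideal B) (x y : B) : Prop where
  left_mem : x ∈ M
  right_mem : y ∈ M
  exists_sub_mem : ∀ m ∈ M, ∃ a b : k, m - a • x - b • y ∈ M ^ 2

namespace IsCotangentPair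

variable {M : Ideal B} {x y ζ : B}

theorem symm (h : IsCotangentPair k M x y) : IsCotangentPair k M y x :=
  ⟨h.2, h.1, fun m hm => by
    obtain ⟨a, b, hab⟩ := h.3 m hm
    exact ⟨b, a, by rwa [sub_right_comm]⟩⟩

theorem left_notMem (hM : ¬IsCotangentCyclic k M) (h : IsCotangentPair k M x y) : x ∉ M ^ 2 := by
  refine fun hx => hM ⟨y, h.2, fun m hm => ?_⟩
  obtain ⟨a, b, hab⟩ := h.3 m hm
  refine ⟨b, ?_⟩
  have := add_mem hab (Submodule.smul_of_tower_mem _ a hx)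
  convert! this using 1
  abel

theorem add_left (h : IsCotangentPair k M x y) {n : B} (hn : n ∈ M ^ 2) :
    IsCotangentPair k M (x + n) y :=
  ⟨add_mem h.1 (Ideal.pow_le_self two_ne_zero hn), h.2, fun m hm => by
    obtain ⟨a, b, hab⟩ := h.3 m hm
    refine ⟨a, b, ?_⟩
    convert! sub_mem hab (Submodule.smul_of_tower_mem _ a hn) using 1
    rw [smul_add]
    abel⟩

theorem smul_right (h : IsCotangentPair k M x y) {s : k} (hs : s ≠ 0) :
    IsCotangentPair k M x (s • y) :=
  ⟨h.1, Submodule.smul_of_tower_mem _ _ h.2, fun m hm => by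
    obtain ⟨a, b, hab⟩ := h.3 m hm
    refine ⟨a, b * s⁻¹, ?_⟩
    rwa [smul_smul, inv_mul_cancel_right₀ hs]⟩

theorem add_smul_right (h : IsCotangentPair k M x y) (s : k) :
    IsCotangentPair k M x (y + s • x) :=
  ⟨h.1, add_mem h.2 (Submodule.smul_of_tower_mem _ _ h.1), fun m hm => by
    obtain ⟨a, b, hab⟩ := h.3 m hm
    refine ⟨a - b * s, b, ?_⟩
    convert! hab using 1
    rw [smul_add, sub_smul, smul_smul]
    abel⟩

/-- As M² kills M², the cube of M lies on the line of ζ, so the second-order errors in expanding a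
product only contribute multiples of ζ. -/
theorem exists_smul_eq (h : IsCotangentPair k M x y) (hζ : IsSocleGenerator φ M ζ)
    (hN : (M ^ 2).annihilator = M ^ 2) {z : B} (hz : z ∈ M ^ 2) :
    ∃ a b c d : k, z = a • x ^ 2 + b • (x * y) + c • y ^ 2 + d • ζ := by
  have hmul {n m : B} (hn : n ∈ M ^ 2) (hm : m ∈ M) : n * m = φ (n * m) • ζ :=
    hζ.eq_smul _ fun l hl => by
      rw [mul_left_comm]
      rw [← hN] at hn
      exact Submodule.mem_annihilator.1 hn _ (by rw [pow_two]; exact Ideal.mul_mem_mul hl hm)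
  rw [pow_two] at hz
  refine Submodule.mul_induction_on hz (fun p hp q hq => ?_) ?_
  · obtain ⟨a, b, h1⟩ := h.3 p hp
    obtain ⟨c, d, h2⟩ := h.3 q hq
    have hl : c • x + d • y ∈ M := add_mem (Submodule.smul_of_tower_mem _ _ h.1)
      (Submodule.smul_of_tower_mem _ _ h.2)
    have h3 := hmul h1 hq
    have h4 := hmul h2 (add_mem (Submodule.smul_of_tower_mem _ a h.1)
      (Submodule.smul_of_tower_mem _ b h.2))
    refine ⟨a * c, a * d + b * c, b * d, φ ((p - a • x - b • y) * q) +
      φ ((q - c • x - d • y) * (a • x + b • y)), ?_⟩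
    rw [add_smul _ _ ζ, ← h3, ← h4]
    simp only [Algebra.smul_def, map_mul, map_add]
    ring
  · rintro _ _ ⟨a, b, c, d, rfl⟩ ⟨a', b', c', d', rfl⟩
    exact ⟨a + a', b + b', c + c', d + d', by simp only [add_smul]; abel⟩

theorem span_eq_top [IsAlgClosed k] [Module.Finite k B] [M.IsMaximal]
    (h : IsCotangentPair k M x y) (hζ : IsSocleGenerator φ M ζ)
    (hN : (M ^ 2).annihilator = M ^ 2) {S : Submodule k B} (h1 : 1 ∈ S) (hx : x ∈ S) (hy : y ∈ S)
    (hxx : x ^ 2 ∈ S) (hxy : x * y ∈ S) (hyy : y ^ 2 ∈ S) (hζS : ζ ∈ S) : ⊤ ≤ S := by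
  intro b _
  obtain ⟨c, hc⟩ := exists_sub_algebraMap_mem (k := k) M b
  obtain ⟨a₁, a₂, ha⟩ := h.3 _ hc
  obtain ⟨b₁, b₂, b₃, b₄, hb⟩ := h.exists_smul_eq hζ hN ha
  have : b = c • 1 + a₁ • x + a₂ • y + b₁ • x ^ 2 + b₂ • (x * y) + b₃ • y ^ 2 + b₄ • ζ := by
    rw [Algebra.smul_def c, mul_one]
    linear_combination hb
  rw [this]
  exact add_mem (add_mem (add_mem (add_mem (add_mem (add_mem (S.smul_mem _ h1) (S.smul_mem _ hx))
    (S.smul_mem _ hy)) (S.smul_mem _ hxx)) (S.smul_mem _ hxy)) (S.smul_mem _ hyy))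
    (S.smul_mem _ hζS)

end IsCotangentPair

/-- An x outside M² does not kill M², and its products with M² lie on the socle line. This is used
to correct products by second-order terms. -/
theorem exists_mul_eq_smul [Module.Finite k B]
    {M : Ideal B} [M.IsMaximal] {ζ : B} (hζ : IsSocleGenerator φ M ζ)
    (hN : (M ^ 2).annihilator = M ^ 2) {x : B} (hx : x ∈ M) (hx2 : x ∉ M ^ 2) (c : k) :
    ∃ m ∈ M ^ 2, x * m = c • ζ := by
  obtain ⟨m, hm, hxm⟩ : ∃ m ∈ M ^ 2, x * m ≠ 0 := by
    by_contra! h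
    rw [← hN] at hx2
    exact hx2 (Submodule.mem_annihilator.2 h)
  have h1 := mul_eq_smul_of_mem_annihilator_sq hζ (hN ▸ hm) hx
  rw [mul_comm] at h1
  have hne : φ (x * m) ≠ 0 := fun h => hxm (by rw [h1, h, zero_smul])
  refine ⟨(c / φ (x * m)) • m, Submodule.smul_of_tower_mem _ _ hm, ?_⟩
  rw [mul_smul_comm, h1, smul_smul]
  simp [hζ.map_eq_one, hne]

variable [IsAlgClosed k]

theorem exists_isCotangentPair [Module.Finite k B] (hB : Module.finrank k B = 6)
    {M : Ideal B} [M.IsMaximal] (hM2 : Module.finrank k ↥(M ^ 2) = 3) {x y : B} (hx : x ∈ M) (hx2 : x ∉ M ^ 2) (hy : y ∈ M)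
    (hxy : ∀ c : k, y - c • x ∉ M ^ 2) : IsCotangentPair k M x y := by
  refine ⟨hx, hy, fun m hm => ?_⟩
  have hle : M ^ 2 ≤ M := Ideal.pow_le_self two_ne_zero
  let U := (M ^ 2).restrictScalars k ⊔ Submodule.span k {x}
  have hxU : x ∈ U := Submodule.mem_sup_right (Submodule.mem_span_singleton_self x)
  have hU : Module.finrank k M ≤ Module.finrank k U + 1 := by
    have hlt : (M ^ 2).restrictScalars k < U := by
      refine lt_of_le_of_ne le_sup_left fun h => hx2 ?_
      rw [← h] at hxU
      exact hxU
    have h1 := Submodule.finrank_lt_finrank_of_lt hlt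
    rw [finrank_restrictScalars] at h1
    have := finrank_add_one_of_isMaximal (k := k) M
    omega
  have hyU : y ∉ U := by
    intro h
    obtain ⟨n, hn, z, hz, h⟩ := Submodule.mem_sup.1 h
    obtain ⟨c, rfl⟩ := Submodule.mem_span_singleton.1 hz
    refine hxy c ?_
    rw [← h, add_sub_cancel_right]
    exact hn
  obtain ⟨b, hb⟩ := exists_sub_smul_mem (U := U) (W := M.restrictScalars k)
    (sup_le hle (Submodule.span_le.2 (by simpa using hx))) hU hy hyU hm
  obtain ⟨n, hn, z, hz, h⟩ := Submodule.mem_sup.1 hb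
  obtain ⟨a, rfl⟩ := Submodule.mem_span_singleton.1 hz
  refine ⟨a, b, ?_⟩
  rw [sub_right_comm, ← h, add_sub_cancel_right]
  exact hn

/-- Modulo ζ the space M² has dimension 2, so the three products x², x y, y² satisfy a quadratic
relation, which factors into two linear forms over an algebraically closed field. -/
theorem exists_mul_eq_smul_socle [Module.Finite k B] (hB : Module.finrank k B = 6)
    {M : Ideal B} [M.IsMaximal] (hM : ¬IsCotangentCyclic k M) {ζ : B}
    (hζ : IsSocleGenerator φ M ζ) (hN : (M ^ 2).annihilator = M ^ 2)
    (hM2 : Module.finrank k ↥(M ^ 2) = 3) :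
    ∃ p ∈ M, ∃ q ∈ M, p ∉ M ^ 2 ∧ q ∉ M ^ 2 ∧ ∃ c : k, p * q = c • ζ := by
  obtain ⟨x, hx, hx2⟩ : ∃ x ∈ M, x ∉ M ^ 2 := by
    by_contra! h
    exact hM ⟨0, zero_mem _, fun a ha => ⟨0, by simpa using h a ha⟩⟩
  obtain ⟨y, hy, hxy⟩ : ∃ y ∈ M, ∀ c : k, y - c • x ∉ M ^ 2 := by
    by_contra! h
    exact hM ⟨x, hx, h⟩
  have hP := exists_isCotangentPair hB hM2 hx hx2 hy hxy
  have hy2 := hP.symm.left_notMem hM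
  have hxy' {a b : k} (h : a • x + b • y ∈ M ^ 2) : b = 0 := by
    by_contra hb
    refine hxy (-(b⁻¹ * a)) ?_
    have := Submodule.smul_of_tower_mem (M ^ 2) b⁻¹ h
    rw [smul_add, inv_smul_smul₀ hb, smul_smul] at this
    convert! this using 1
    rw [neg_smul]
    abel
  obtain ⟨a, b, c, d, habc, h⟩ : ∃ a b c d : k, (a, b, c) ≠ 0 ∧
      a • x ^ 2 + b • (x * y) + c • y ^ 2 = d • ζ := by
    have hnli : ¬LinearIndependent k ![x ^ 2, x * y, y ^ 2, ζ] := by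
      intro hli
      have h2 : Submodule.span k (Set.range ![x ^ 2, x * y, y ^ 2, ζ]) ≤
          (M ^ 2).restrictScalars k := by
        rw [Submodule.span_le]
        rintro _ ⟨i, rfl⟩
        fin_cases i
        · exact Ideal.pow_mem_pow hx 2
        · change x * y ∈ M ^ 2
          rw [pow_two]
          exact Ideal.mul_mem_mul hx hy
        · exact Ideal.pow_mem_pow hy 2
        · change ζ ∈ M ^ 2
          rw [← hN]
          exact hζ.mem_annihilator_sq
      have h3 := finrank_span_eq_card hli
      have h4 := Submodule.finrank_mono h2
      rw [h3, finrank_restrictScalars, hM2] at h4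
      simp at h4
    rw [Fintype.linearIndependent_iff] at hnli
    push Not at hnli
    obtain ⟨g, hg, i, hi⟩ := hnli
    simp only [Fin.sum_univ_four, Matrix.cons_val_zero, Matrix.cons_val_one, Matrix.cons_val] at hg
    refine ⟨g 0, g 1, g 2, -g 3, fun h => ?_, ?_⟩
    · simp only [Prod.mk_eq_zero] at h
      obtain ⟨g0, g1, g2⟩ := h
      rw [g0, g1, g2] at hg
      have g3 : g 3 = 0 := by simpa [hζ.map_eq_one] using congrArg φ hg
      apply hi
      fin_cases i <;> assumption
    · rw [neg_smul]
      exact eq_neg_of_add_eq_zero_left hg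
  by_cases ha : a = 0
  · refine ⟨y, hy, b • x + c • y, add_mem (Submodule.smul_of_tower_mem _ _ hx)
      (Submodule.smul_of_tower_mem _ _ hy), hy2, fun h1 => ?_, d, ?_⟩
    · have hc := hxy' h1
      rw [hc, zero_smul, add_zero] at h1
      have hb := eq_zero_of_smul_mem hx2 h1
      exact habc (by simp [ha, hb, hc])
    · rw [← h, ha, zero_smul, zero_add, mul_add, mul_smul_comm, mul_smul_comm, mul_comm, pow_two]
  · obtain ⟨r, hr⟩ : ∃ r, a * r ^ 2 + b * r + c = 0 := by
      obtain ⟨r, hr⟩ := IsAlgClosed.exists_root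
        (Polynomial.C a * Polynomial.X ^ 2 + Polynomial.C b * Polynomial.X + Polynomial.C c)
        (by rw [Polynomial.degree_quadratic ha]; norm_num)
      exact ⟨r, by simpa [Polynomial.IsRoot] using hr⟩
    have hne (s : k) (e : k) (he : e ≠ 0) : e • x + s • y ∉ M ^ 2 := by
      intro h1
      rw [hxy' h1, zero_smul, add_zero] at h1
      exact he (eq_zero_of_smul_mem hx2 h1)
    -- The factorization of a X² + b X Y + c Y² with root r.
    refine ⟨(1 : k) • x + (-r) • y, ?_, a • x + (b + a * r) • y, ?_, hne _ _ one_ne_zero,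
      hne _ _ ha, d, ?_⟩
    · exact add_mem (Submodule.smul_of_tower_mem _ _ hx) (Submodule.smul_of_tower_mem _ _ hy)
    · exact add_mem (Submodule.smul_of_tower_mem _ _ hx) (Submodule.smul_of_tower_mem _ _ hy)
    · have hc : c = -(a * r ^ 2 + b * r) := by linear_combination hr
      rw [← h, hc]
      simp only [Algebra.smul_def, map_add, map_mul, map_neg, map_pow, map_one]
      ring

/-! ### Reduction to the conic family, and the classification -/

variable {k : Type u} [Field k] [IsAlgClosed k] {I : Ideal (MvPolynomial (Fin 5) k)}
  {B : Type u} [CommRing B] [Algebra k B] {φ : B →ₗ[k] k} {v : Fin 5 → B}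

theorem IsFrobeniusModel.isAngloHellenic_of_mul_eq_zero (hk : (2 : k) ≠ 0)
    (hI : IsHilbAGZero 4 6 I) (hF : IsFrobeniusModel I φ v) {M : Ideal B} [M.IsMaximal]
    (hM : ¬IsCotangentCyclic k M) {ζ : B} (hζ : IsSocleGenerator φ M ζ)
    (hN : (M ^ 2).annihilator = M ^ 2) {x y : B} (h : IsCotangentPair k M x y)
    (hxy : x * y = 0) : IsAngloHellenic I := by
  have := hF.finite
  have hcube {x y : B} (h : IsCotangentPair k M x y) (hxy : x * y = 0) :
      ∃ a : k, a ≠ 0 ∧ x ^ 3 = a • ζ := by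
    have hx3 := mul_eq_smul_of_mem_annihilator_sq hζ (y := x ^ 2) (m := x)
      (by rw [hN]; exact Ideal.pow_mem_pow h.left_mem 2) h.left_mem
    rw [← pow_succ] at hx3
    refine ⟨_, fun h0 => ?_, hx3⟩
    rw [h0, zero_smul] at hx3
    obtain ⟨m, hm, hxm⟩ := exists_mul_eq_smul hζ hN h.left_mem (h.left_notMem hM) 1
    obtain ⟨a, b, c, d, rfl⟩ := h.exists_smul_eq hζ hN hm
    have : (1 : k) • ζ = 0 := by
      rw [← hxm]
      have h1 := hζ.mul_eq_zero x h.left_mem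
      simp only [Algebra.smul_def]
      linear_combination (algebraMap k B a) * hx3 +
        (algebraMap k B b * x + algebraMap k B c * y) * hxy + algebraMap k B d * h1
    simpa [hζ.map_eq_one] using congrArg φ this
  obtain ⟨a, ha, hx3⟩ := hcube h hxy
  obtain ⟨b, hb, hy3⟩ := hcube h.symm (by rw [mul_comm, hxy])
  -- Rescaling one variable makes the cubes equal. With u = x - z and w = x + z, this gives u w² =
  -- x³ - z³ = 0 and w² = u².
  obtain ⟨s, hs⟩ := IsAlgClosed.exists_pow_nat_eq (a / b) three_pos
  have hs0 : s ≠ 0 := by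
    rintro rfl
    exact div_ne_zero ha hb (by rw [← hs]; simp)
  obtain ⟨z, hz, hxz, hz3⟩ : ∃ z, IsCotangentPair k M x z ∧ x * z = 0 ∧ z ^ 3 = a • ζ :=
    ⟨s • y, h.smul_right hs0, by rw [mul_smul_comm, hxy, smul_zero], by
      rw [smul_pow, hs, hy3, smul_smul, div_mul_cancel₀ _ hb]⟩
  let w : Fin 6 → B := ![1, x - z, x + z, (x - z) ^ 2, (x - z) * (x + z), (x - z) ^ 2 * (x + z)]
  have hw5 : (x - z) ^ 2 * (x + z) = (2 * a) • ζ := by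
    simp only [Algebra.smul_def, map_mul, map_ofNat] at hx3 hz3 ⊢
    linear_combination hx3 + hz3 - (x + z) * hxz
  have hζx := hζ.mul_eq_zero x h.left_mem
  have hζz := hζ.mul_eq_zero z hz.right_mem
  have htop : ⊤ ≤ Submodule.span k (Set.range w) := by
    have hmem (i) : w i ∈ Submodule.span k (Set.range w) := Submodule.subset_span ⟨i, rfl⟩
    have hhalf {t : B} (ht : (2 : k) • t ∈ Submodule.span k (Set.range w)) :
        t ∈ Submodule.span k (Set.range w) := by
      rw [← inv_smul_smul₀ hk t]
      exact Submodule.smul_mem _ _ ht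
    refine hz.span_eq_top hζ hN (hmem 0) (hhalf ?_) (hhalf ?_) (hhalf ?_) ?_ (hhalf ?_) ?_
    · convert! add_mem (hmem 1) (hmem 2) using 1
      simp only [w, Matrix.cons_val_zero, Matrix.cons_val_one, Matrix.cons_val, Algebra.smul_def,
        map_ofNat]
      ring
    · convert! sub_mem (hmem 2) (hmem 1) using 1
      simp only [w, Matrix.cons_val_zero, Matrix.cons_val_one, Matrix.cons_val, Algebra.smul_def,
        map_ofNat]
      ring
    · convert! add_mem (hmem 3) (hmem 4) using 1
      simp only [w, Matrix.cons_val, Algebra.smul_def,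
        map_ofNat]
      linear_combination 2 * hxz
    · rw [hxz]
      exact zero_mem _
    · convert! sub_mem (hmem 3) (hmem 4) using 1
      simp only [w, Matrix.cons_val, Algebra.smul_def,
        map_ofNat]
      linear_combination 2 * hxz
    · rw [← inv_smul_smul₀ (mul_ne_zero hk ha) ζ, ← hw5]
      exact Submodule.smul_mem _ _ (hmem 5)
  let e := basisOfTopLeSpanOfCardEqFinrank w htop (by rw [hF.finrank_eq]; rfl)
  have he (i) : e i = w i := by simp [e]
  have e0 : e 0 = 1 := he 0
  have e1 : e 1 = x - z := he 1
  have e2 : e 2 = x + z := he 2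
  have e3 : e 3 = (x - z) ^ 2 := he 3
  have e4 : e 4 = (x - z) * (x + z) := he 4
  have e5 : e 5 = (x - z) ^ 2 * (x + z) := he 5
  refine hF.isAngloHellenic_of_conic hI e (a := 1) (b := 0) (c := 0) one_ne_zero e0
    ?_ ?_ ?_ ?_ ?_ ?_ ?_ ?_
  · rw [e1, e3, pow_two]
  · rw [e1, e2, e4]
  · rw [e2, e3, zero_smul, one_smul]
    linear_combination 4 * hxz
  · rw [e1, e3, zero_smul]
    linear_combination hx3 - hz3 - 3 * (x - z) * hxz
  · rw [e1, e4, e5]; ring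
  · rw [e2, e4]
    linear_combination hx3 - hz3 + (x - z) * hxz
  · rw [e1, e5, hw5, mul_smul_comm, sub_mul, hζx, hζz, sub_zero, smul_zero]
  · rw [e2, e5, hw5, mul_smul_comm, add_mul, hζx, hζz, add_zero, smul_zero]

theorem IsFrobeniusModel.isAngloHellenic_of_sq_eq_zero (hk : (3 : k) ≠ 0)
    (hI : IsHilbAGZero 4 6 I) (hF : IsFrobeniusModel I φ v) {M : Ideal B} [M.IsMaximal]
    (hM : ¬IsCotangentCyclic k M) {ζ : B} (hζ : IsSocleGenerator φ M ζ)
    (hN : (M ^ 2).annihilator = M ^ 2) {x y : B} (h : IsCotangentPair k M x y)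
    (hx2 : x ^ 2 = 0) : IsAngloHellenic I := by
  have := hF.finite
  have hmul {n m : B} (hn : n ∈ M ^ 2) (hm : m ∈ M) : n * m = φ (n * m) • ζ :=
    mul_eq_smul_of_mem_annihilator_sq hζ (by rwa [hN]) hm
  obtain ⟨a, ha, hxyy⟩ : ∃ a : k, a ≠ 0 ∧ x * y ^ 2 = a • ζ := by
    have hxyy := hmul (Ideal.pow_mem_pow h.right_mem 2) h.left_mem
    rw [mul_comm] at hxyy
    refine ⟨_, fun h0 => ?_, hxyy⟩
    rw [h0, zero_smul] at hxyy
    obtain ⟨m, hm, hxm⟩ := exists_mul_eq_smul hζ hN h.left_mem (h.left_notMem hM) 1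
    obtain ⟨a, b, c, d, rfl⟩ := h.exists_smul_eq hζ hN hm
    have : (1 : k) • ζ = 0 := by
      rw [← hxm]
      have h1 := hζ.mul_eq_zero x h.left_mem
      simp only [Algebra.smul_def]
      linear_combination (algebraMap k B a * x + algebraMap k B b * y) * hx2 +
        algebraMap k B c * hxyy + algebraMap k B d * h1
    simpa [hζ.map_eq_one] using congrArg φ this
  obtain ⟨z, hz, hz3, hxzz⟩ :
      ∃ z, IsCotangentPair k M x z ∧ z ^ 3 = 0 ∧ x * z ^ 2 = a • ζ := by
    have hy3 := hmul (Ideal.pow_mem_pow h.right_mem 2) h.right_mem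
    generalize φ (y ^ 2 * y) = b at hy3
    -- As x² = 0, adding s x to y changes y³ by 3 s x y², so this s kills the cube.
    refine ⟨y + (-b / (3 * a)) • x, h.add_smul_right _, ?_, ?_⟩
    · have hs : b + 3 * (-b / (3 * a)) * a = 0 := by
        field_simp
        ring
      have hs' := congrArg (algebraMap k B) hs
      generalize -b / (3 * a) = s at hs'
      simp only [Algebra.smul_def, map_add, map_mul, map_ofNat, map_zero] at hy3 hxyy hs' ⊢
      linear_combination hy3 + 3 * algebraMap k B s * hxyy +
        (3 * algebraMap k B s ^ 2 * y + algebraMap k B s ^ 3 * x) * hx2 + ζ * hs'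
    · rw [← hxyy]
      generalize -b / (3 * a) = s
      simp only [Algebra.smul_def]
      linear_combination (2 * algebraMap k B s * y + algebraMap k B s ^ 2 * x) * hx2
  -- Chosen so that, with w = z + x, the coefficient of x z² in u w² vanishes. Then u² w = -3 x z²
  -- is a nonzero socle element, and w² = 2 u w - u².
  let u := z - 2 * x
  let w : Fin 6 → B := ![1, u, z + x, u ^ 2, u * (z + x), u ^ 2 * (z + x)]
  have hw5 : u ^ 2 * (z + x) = (-(3 * a)) • ζ := by
    simp only [Algebra.smul_def, map_mul, map_neg, map_ofNat, u] at hxzz ⊢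
    linear_combination hz3 - 3 * hxzz + 4 * x * hx2
  have hζx := hζ.mul_eq_zero x h.left_mem
  have hζz := hζ.mul_eq_zero z hz.right_mem
  have htop : ⊤ ≤ Submodule.span k (Set.range w) := by
    have hmem (i) : w i ∈ Submodule.span k (Set.range w) := Submodule.subset_span ⟨i, rfl⟩
    have hthird {t : B} (ht : (3 : k) • t ∈ Submodule.span k (Set.range w)) :
        t ∈ Submodule.span k (Set.range w) := by
      rw [← inv_smul_smul₀ hk t]
      exact Submodule.smul_mem _ _ ht
    refine hz.span_eq_top hζ hN (hmem 0) (hthird ?_) (hthird ?_) ?_ (hthird ?_) (hthird ?_) ?_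
    · convert! sub_mem (hmem 2) (hmem 1) using 1
      simp only [w, u, Matrix.cons_val_zero, Matrix.cons_val_one, Matrix.cons_val,
        Algebra.smul_def, map_ofNat]
      ring
    · convert! add_mem (hmem 1) (add_mem (hmem 2) (hmem 2)) using 1
      simp only [w, u, Matrix.cons_val_zero, Matrix.cons_val_one, Matrix.cons_val,
        Algebra.smul_def, map_ofNat]
      ring
    · rw [hx2]
      exact zero_mem _
    · convert! sub_mem (hmem 4) (hmem 3) using 1
      simp only [w, u, Matrix.cons_val,
        Algebra.smul_def, map_ofNat]
      linear_combination 6 * hx2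
    · convert! sub_mem (add_mem (add_mem (hmem 4) (hmem 4)) (add_mem (hmem 4) (hmem 4)))
        (hmem 3) using 1
      simp only [w, u, Matrix.cons_val,
        Algebra.smul_def, map_ofNat]
      linear_combination 12 * hx2
    · rw [← inv_smul_smul₀ (neg_ne_zero.2 (mul_ne_zero hk ha)) ζ, ← hw5]
      exact Submodule.smul_mem _ _ (hmem 5)
  let e := basisOfTopLeSpanOfCardEqFinrank w htop (by rw [hF.finrank_eq]; rfl)
  have he (i) : e i = w i := by simp [e]
  have e0 : e 0 = 1 := he 0
  have e1 : e 1 = u := he 1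
  have e2 : e 2 = z + x := he 2
  have e3 : e 3 = u ^ 2 := he 3
  have e4 : e 4 = u * (z + x) := he 4
  have e5 : e 5 = u ^ 2 * (z + x) := he 5
  refine hF.isAngloHellenic_of_conic hI e (a := -1) (b := 2) (c := 2)
    (neg_ne_zero.2 one_ne_zero) e0 ?_ ?_ ?_ ?_ ?_ ?_ ?_ ?_
  · rw [e1, e3, pow_two]
  · rw [e1, e2, e4]
  · rw [e2, e3, e4, neg_one_smul]
    simp only [Algebra.smul_def, map_ofNat, u]
    linear_combination 9 * hx2
  · rw [e1, e3, e5]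
    simp only [Algebra.smul_def, map_ofNat, u]
    linear_combination -hz3 + (12 * z - 16 * x) * hx2
  · rw [e1, e4, e5]; ring
  · rw [e2, e4]
    simp only [u]
    linear_combination hz3 + (-3 * z - 2 * x) * hx2
  · rw [e1, e5, hw5, mul_smul_comm, sub_mul, mul_assoc, hζx, hζz, mul_zero, sub_zero, smul_zero]
  · rw [e2, e5, hw5, mul_smul_comm, add_mul, hζx, hζz, add_zero, smul_zero]

/-- The two factors p, q of a product in the socle are either proportional or independent modulo M².
Adding to p an element of M² turns the relation into p² = 0 or p q = 0 exactly. -/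
theorem IsFrobeniusModel.isAngloHellenic_of_annihilator_sq_eq (hk2 : (2 : k) ≠ 0)
    (hk3 : (3 : k) ≠ 0) (hI : IsHilbAGZero 4 6 I) (hF : IsFrobeniusModel I φ v) {M : Ideal B}
    [M.IsMaximal] (hM : ¬IsCotangentCyclic k M) {ζ : B} (hζ : IsSocleGenerator φ M ζ)
    (hN : (M ^ 2).annihilator = M ^ 2) (hM2 : Module.finrank k ↥(M ^ 2) = 3) :
    IsAngloHellenic I := by
  have := hF.finite
  obtain ⟨p, hp, q, hq, hp2, hq2, c, hpq⟩ :=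
    exists_mul_eq_smul_socle hF.finrank_eq hM hζ hN hM2
  have hmul {n m : B} (hn : n ∈ M ^ 2) (hm : m ∈ M) : n * m = φ (n * m) • ζ :=
    mul_eq_smul_of_mem_annihilator_sq hζ (by rwa [hN]) hm
  by_cases hc : ∃ s : k, q - s • p ∈ M ^ 2
  · obtain ⟨s, hs⟩ := hc
    have hs0 : s ≠ 0 := by
      rintro rfl
      exact hq2 (by simpa using hs)
    have hpp : p ^ 2 = (s⁻¹ * (c - φ ((q - s • p) * p))) • ζ := by
      rw [mul_smul, sub_smul, ← hpq, ← hmul hs hp, eq_inv_smul_iff₀ hs0]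
      simp only [Algebra.smul_def]
      ring
    generalize s⁻¹ * (c - φ ((q - s • p) * p)) = d at hpp
    -- As m² = 0, the square of p + m is p² + 2 p m, and this m cancels it.
    obtain ⟨m, hm, hpm⟩ := exists_mul_eq_smul hζ hN hp hp2 (-d / 2)
    obtain ⟨y, hy, hpy⟩ : ∃ y ∈ M, ∀ c : k, y - c • p ∉ M ^ 2 := by
      by_contra! h
      exact hM ⟨p, hp, h⟩
    have hmm : m * m = 0 := Submodule.mem_annihilator.1 (show m ∈ (M ^ 2).annihilator by rwa [hN]) m hm
    refine hF.isAngloHellenic_of_sq_eq_zero hk3 hI hM hζ hN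
      ((exists_isCotangentPair hF.finrank_eq hM2 hp hp2 hy hpy).add_left hm) ?_
    have h1 : (p + m) ^ 2 = d • ζ + (2 : k) • (-d / 2) • ζ := by
      rw [← hpp, ← hpm, Algebra.smul_def, map_ofNat]
      linear_combination hmm
    rw [h1, smul_smul, mul_div_cancel₀ _ hk2, neg_smul, add_neg_cancel]
  · push Not at hc
    obtain ⟨m, hm, hqm⟩ := exists_mul_eq_smul hζ hN hq hq2 (-c)
    refine hF.isAngloHellenic_of_mul_eq_zero hk2 hI hM hζ hN
      ((exists_isCotangentPair hF.finrank_eq hM2 hp hp2 hq hc).add_left hm) ?_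
    rw [add_mul, mul_comm m, hpq, hqm, neg_smul, add_neg_cancel]

theorem IsFrobeniusModel.isAngloHellenic_of_isAlgClosed (hk2 : (2 : k) ≠ 0)
    (hk3 : (3 : k) ≠ 0) (hI : IsHilbAGZero 4 6 I) (hF : IsFrobeniusModel I φ v) :
    IsAngloHellenic I := by
  have := hF.finite
  by_cases h : ∀ P : MaximalSpectrum B, IsCotangentCyclic k P.asIdeal
  · exact hF.isAngloHellenic_of_cotangentSpace hI h
  push Not at h
  obtain ⟨M, hM⟩ := h
  have := M.isMaximal
  obtain ⟨ζ, hζ⟩ := exists_isSocleGenerator hF.nondegenerate M.asIdeal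
  have h3 := finrank_sq_add_two_le hM
  have hN := finrank_annihilator hF.nondegenerate (M.asIdeal ^ 2)
  rw [hF.finrank_eq] at h3 hN
  obtain h1 | h2 | h3 : Module.finrank k ↥(M.asIdeal ^ 2) ≤ 1 ∨
      Module.finrank k ↥(M.asIdeal ^ 2) = 2 ∨ Module.finrank k ↥(M.asIdeal ^ 2) = 3 := by omega
  · exact hF.isAngloHellenic_of_finrank_sq_le_one hk2 hI hM hζ h1
  · exact hF.isAngloHellenic_of_finrank_sq_eq_two hk2 hI hM hζ h2
  -- Here M² and its annihilator both have dimension 3, so they agree unless some annihilator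
  -- element lies outside M²; such an element starts an orthonormal system.
  by_cases hle : (M.asIdeal ^ 2).annihilator ≤ M.asIdeal ^ 2
  · refine hF.isAngloHellenic_of_annihilator_sq_eq hk2 hk3 hI hM hζ ?_ h3
    refine Submodule.restrictScalars_injective k _ _ (Submodule.eq_of_le_of_finrank_le
      (S₁ := (M.asIdeal ^ 2).annihilator.restrictScalars k)
      (S₂ := (M.asIdeal ^ 2).restrictScalars k) hle ?_)
    rw [finrank_restrictScalars, finrank_restrictScalars]
    omega
  · obtain ⟨n, hn, hn2⟩ := Set.not_subset.1 hle
    obtain ⟨w, hw, -, hww⟩ := exists_orthonormal_step hk2 hF.nondegenerate hM hζ (r := 0)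
      (y := ![]) (fun i => i.elim0) (fun i => i.elim0) hn (fun i => i.elim0) hn2
    exact hF.isAngloHellenic_of_finrank_sq_eq_three hI hM hζ hw hww h3

end TomUnprojection

theorem proposition6p6p3 (k : Type*) [Field k] [IsAlgClosed k]
    (h2 : ringChar k ≠ 2) (h3 : ringChar k ≠ 3)
    (I : Ideal (MvPolynomial (Fin 5) k)) (hI : TomUnprojection.IsHilbAGZero 4 6 I) :
    TomUnprojection.IsAngloHellenic I := by
  have hk2 : (2 : k) ≠ 0 := fun h => by
    have := (Nat.dvd_prime Nat.prime_two).1 (ringChar.dvd (R := k) (x := 2) (by exact_mod_cast h))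
    exact this.elim CharP.ringChar_ne_one h2
  have hk3 : (3 : k) ≠ 0 := fun h => by
    have := (Nat.dvd_prime Nat.prime_three).1 (ringChar.dvd (R := k) (x := 3) (by exact_mod_cast h))
    exact this.elim CharP.ringChar_ne_one h3
  have : Infinite k := IsAlgClosed.instInfinite
  obtain ⟨B, _, _, φ, v, hF⟩ := TomUnprojection.exists_isFrobeniusModel hI
  exact hF.isAngloHellenic_of_isAlgClosed hk2 hk3 hI
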